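/- Let $K$ be a field of characteristic zero, let $n \ge 0$, and let $f \in K[x_1,\dots,x_n]$ be a polynomial of degree $d$ (the zero polynomial is counted among those with $d \le 2$). Write $\nabla f = (\partial f/\partial x_1,\dots,\partial f/\partial x_n)$ for its gradient map and $\mathcal{H}f = (\partial^2 f/\partial x_i\partial x_j)_{i,j}$ for its Hessian matrix. For $T \in \operatorname{GL}_n(K)$ let $f(Tx)$ be the polynomial obtained by substituting $\sum_j T_{ij}x_j$ for $x_i$, and consider the condition $(\ast)$ all entries of $\mathcal{H}(f(Tx))$ below the anti-diagonal, i.e. at the positions $(i,j)$ with $i+j>n+1$, are zero. The quadratic part of $f$ is its homogeneous component of degree $2$. We say that a polynomial map $F : K^n \to K^n$ satisfies the Jacobian conjecture if the following implication holds: if the Jacobian determinant of $F$ is a nonzero constant, then $F$ has a polynomial inverse, i.e. there is a polynomial map $G$ with $F\circ G = G \circ F = \mathrm{id}$ (as identities of tuples of polynomials). Suppose that $\det \mathcal{H}f \in K$ (zero is allowed). Then the following holds. (i) If $T \in \operatorname{GL}_n(K)$ satisfies $(\ast)$, then $\nabla f$ satisfies the Jacobian conjecture, and, if $n \ge 2$,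 the quadratic part of $f$ vanishes at the last column of $T$. (ii) If $2 \le n \le 3 \le d$, then there exists a $T \in \operatorname{GL}_n(K)$ satisfying $(\ast)$. In particular, the quadratic part of $f$ vanishes at some nonzero vector of $K^n$. (iii) If $d \le 2 \le n \le 3$, then there exists a $T \in \operatorname{GL}_n(K)$ satisfying $(\ast)$ if and only if the quadratic part of $f$ vanishes at some nonzero vector of $K^n$. (iv) If $n \le 3$, then $\nabla f$ satisfies the Jacobian conjecture; moreover, if in addition $d \ge 3$, there exists a $T \in \operatorname{GL}_n(K)$ satisfying $(\ast)$. -/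

import Mathlib

namespace PolyMap

open MvPolynomial

variable {K : Type*} [Field K] {n : ℕ}

/-- The Jacobian matrix of a polynomial map `F = (F₁, …, Fₙ)`: the entry `(i, j)` is `∂Fᵢ/∂xⱼ`. -/
noncomputable def jacobian (F : Fin n → MvPolynomial (Fin n) K) :
    Matrix (Fin n) (Fin n) (MvPolynomial (Fin n) K) :=
  Matrix.of fun i j => pderiv j (F i)

/-- The gradient map `∇f = (∂f/∂x₁, …, ∂f/∂xₙ)` of a polynomial. -/
noncomputable def grad (f : MvPolynomial (Fin n) K) : Fin n → MvPolynomial (Fin n) K :=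
  fun i => pderiv i f

/-- The Hessian matrix of a polynomial, i.e. the Jacobian matrix of its gradient map. -/
noncomputable def hessian (f : MvPolynomial (Fin n) K) :
    Matrix (Fin n) (Fin n) (MvPolynomial (Fin n) K) :=
  jacobian (grad f)

/-- The polynomial map `F` has a two-sided inverse under composition that is a polynomial map
(`bind₁ F g` is the polynomial `g(F₁, …, Fₙ)`). -/
def IsInvertible (F : Fin n → MvPolynomial (Fin n) K) : Prop :=
  ∃ G : Fin n → MvPolynomial (Fin n) K,
    (∀ i, bind₁ F (G i) = X i) ∧ (∀ i, bind₁ G (F i) = X i)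

/-- `F` satisfies the Jacobian conjecture: if the Jacobian determinant of `F` is a nonzero
constant, then `F` is invertible as a polynomial map. -/
def SatisfiesJacobianConjecture (F : Fin n → MvPolynomial (Fin n) K) : Prop :=
  (∃ c : K, c ≠ 0 ∧ (jacobian F).det = C c) → IsInvertible F

/-- The polynomial `f(Tx)`: the variable `xᵢ` is replaced by `∑ⱼ Tᵢⱼ xⱼ`. -/
noncomputable def linSubst (f : MvPolynomial (Fin n) K) (T : Matrix (Fin n) (Fin n) K) :
    MvPolynomial (Fin n) K :=
  bind₁ (fun i => ∑ j, C (T i j) * X j) f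

/-- All entries strictly below the anti-diagonal are zero. With indices starting at `0`, the
anti-diagonal consists of the entries `(i, j)` with `i + j = n - 1`. -/
def ZeroBelowAntidiagonal {R : Type*} [Zero R] (M : Matrix (Fin n) (Fin n) R) : Prop :=
  ∀ i j : Fin n, n ≤ (i : ℕ) + (j : ℕ) → M i j = 0

/-- The quadratic part of `f`, i.e. its homogeneous component of degree two. -/
noncomputable def quadraticPart (f : MvPolynomial (Fin n) K) : MvPolynomial (Fin n) K :=
  homogeneousComponent 2 f

/-- The polynomial `q` vanishes at some nonzero vector of `Kⁿ`. -/
def VanishesAtNonzero (q : MvPolynomial (Fin n) K) : Prop :=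
  ∃ v : Fin n → K, v ≠ 0 ∧ eval v q = 0

end PolyMap

/-!
Invertibility of the gradient map is elementary algebra. If the Hessian matrix of `f` has zeros
below the anti-diagonal and constant nonzero determinant, then its anti-diagonal entries are
nonzero constants. Hence the variables are, one after the other, polynomials in the partial
derivatives of `f`: substituting the gradient induces a surjective, hence bijective, endomorphism
of the Noetherian polynomial ring (`surjective_of_zeroBelowAntidiagonal`,
`isInvertible_of_surjective`). The gradient of a polynomial of degree at most two is affine and
needs no coordinates. The statement on the quadratic part `q` follows since the constant term of
the second derivative in a direction `v` is `2 q(v)` (`coeff_zero_dirD_dirD`).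

What remains is the existence of antitriangular coordinates in dimension at most three. The key
fact is that a polynomial of degree at least three with constant Hessian determinant is affine
along some direction `e`, i.e. `D_e D_e f = 0`. In two variables this is the antitriangular shape
itself. In three variables with `e` as the `z`-axis, the derivative of the Hessian determinant with
respect to `z` is, up to sign, the curvature of the level curves of `a = f_z`, a polynomial in `x,
y`. So these curves are straight, `a` depends on a single linear form, and a rotation in the `(x,
y)`-plane gives the zeros below the anti-diagonal (`exists_antitriangular_of_dirD_dirD`).

Such a direction is found with leading forms with respect to rational, possibly negative weights.
The leading form of an equation such as `det = c` is the same equation for leading forms with `c`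
replaced by zero, as soon as the left hand side has positive weight; and leading forms that are
powers of a variable, together with the leading form of the terms in the other variables, give
second order information. In two variables this is `exists_dirD_iterate_eq_zero`, for a family
`Phi` of operators that contains the Hessian determinant, the curvature of level curves, and the
Hessian determinant of `a(x, y) z ^ m`.

In three variables the direction is found by descent on the degree `m` of `f` along lines of a
fixed direction (`exists_dirD_iterate_eq_zero_pred`). Suppose that `2 ≤ m < deg f` is minimal,
attained in the direction `z`. The coefficient of `z ^ m` satisfies `Phi = 0`, so it depends on one
linear form only. If it is not constant, then `f` has degree `m` in a plane of directions, and the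
form of degree `m` on this plane takes a constant value in some direction
(`exists_direction_of_homogeneous`). The proof uses that a kernel vector of a singular Hessian
matrix is a zero of the top forms of the partial derivatives (`aeval_lead_pderiv_eq_zero`), because
the gradient is constant along kernel lines. This reduces to the case of a constant coefficient.
There, two suitable weights contradict the vanishing of the `(x, y)`-Hessian of the terms off the
`z`-axis (`NoLowDirection.false_of_const_top`). Minimality is thus impossible for `m ≥ 2`.

The descent starts at a zero of the top form `h` of `f`, which exists over the algebraic closure.
Applied to `h`, whose Hessian determinant vanishes, it shows that the partial derivatives of `h`
are linearly dependent; this descends to `K`, and gives a direction over `K` in which `f` has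
degree less than `deg f` (`exists_dirD_eq_zero_of_det_hessian`, `exists_dirD_dirD_eq_zero_of_det`).
-/

noncomputable section

namespace PolyMap

open MvPolynomial

/-! ### Weighted leading forms -/

section Coeff

variable {ι : Type*} {K : Type*} [Field K]

/-- The sum of the terms of `f` whose exponent vectors satisfy `P`. -/
def part (P : (ι →₀ ℕ) → Prop) [DecidablePred P] (f : MvPolynomial ι K) : MvPolynomial ι K :=
  ∑ α ∈ f.support with P α, monomial α (coeff α f)

lemma coeff_part (P : (ι →₀ ℕ) → Prop) [DecidablePred P] (f : MvPolynomial ι K) (α : ι →₀ ℕ) :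
    coeff α (part P f) = if P α then coeff α f else 0 := by
  classical
  simp only [part, coeff_sum, coeff_monomial, Finset.sum_ite_eq', Finset.mem_filter, mem_support_iff]
  by_cases h : P α <;> by_cases h' : coeff α f = 0 <;> simp [h, h']

lemma coeff_add_ne {α : ι →₀ ℕ} {f g : MvPolynomial ι K} (h : coeff α (f + g) ≠ 0) :
    coeff α f ≠ 0 ∨ coeff α g ≠ 0 := by
  by_contra! h'
  simp [h'.1, h'.2] at h

lemma coeff_sub_ne {α : ι →₀ ℕ} {f g : MvPolynomial ι K} (h : coeff α (f - g) ≠ 0) :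
    coeff α f ≠ 0 ∨ coeff α g ≠ 0 := by
  by_contra! h'
  simp [h'.1, h'.2] at h

lemma exists_of_coeff_mul_ne {α : ι →₀ ℕ} {f g : MvPolynomial ι K} (h : coeff α (f * g) ≠ 0) :
    ∃ β γ, β + γ = α ∧ coeff β f ≠ 0 ∧ coeff γ g ≠ 0 := by
  classical
  rw [coeff_mul] at h
  obtain ⟨⟨β, γ⟩, hm, hne⟩ := Finset.exists_ne_zero_of_sum_ne_zero h
  exact ⟨β, γ, Finset.HasAntidiagonal.mem_antidiagonal.1 hm, left_ne_zero_of_mul hne, right_ne_zero_of_mul hne⟩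

end Coeff

section Lead

variable {ι : Type*} [Fintype ι] {K : Type*} [Field K]

/-- The weight `∑ᵢ αᵢ wᵢ` of an exponent vector `α`. Weights may be negative, so that leading
forms also capture the lowest terms with respect to a variable. -/
def wt (w : ι → ℚ) (α : ι →₀ ℕ) : ℚ := ∑ i, (α i : ℚ) * w i

/-- All monomials of `f` have weight less than `D`. -/
def WtLT (w : ι → ℚ) (D : ℚ) (f : MvPolynomial ι K) : Prop :=
  ∀ α, coeff α f ≠ 0 → wt w α < D

/-- All monomials of `f` have weight at most `D`. -/
def WtLE (w : ι → ℚ) (D : ℚ) (f : MvPolynomial ι K) : Prop :=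
  ∀ α, coeff α f ≠ 0 → wt w α ≤ D

/-- All monomials of `f` have weight `D`. -/
def WtEq (w : ι → ℚ) (D : ℚ) (f : MvPolynomial ι K) : Prop :=
  ∀ α, coeff α f ≠ 0 → wt w α = D

/-- `g` is the part of weight `D` of `f`, and all other monomials of `f` have smaller weight.
The polynomial `g` may be zero; this is what makes the notion compatible with sums. -/
def Lead (w : ι → ℚ) (D : ℚ) (f g : MvPolynomial ι K) : Prop :=
  WtEq w D g ∧ WtLT w D (f - g)

lemma wt_add (w : ι → ℚ) (α β : ι →₀ ℕ) : wt w (α + β) = wt w α + wt w β := by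
  simp [wt, add_mul, Finset.sum_add_distrib]

lemma wt_single (w : ι → ℚ) (i : ι) (k : ℕ) : wt w (Finsupp.single i k) = k * w i := by
  classical
  simp [wt, Finsupp.single_apply, ite_mul]

@[simp] lemma wt_zero (w : ι → ℚ) : wt w 0 = 0 := by simp [wt]

lemma WtLT.le {w : ι → ℚ} {D : ℚ} {f : MvPolynomial ι K} (h : WtLT w D f) : WtLE w D f :=
  fun α hα => (h α hα).le

lemma WtEq.le {w : ι → ℚ} {D : ℚ} {f : MvPolynomial ι K} (h : WtEq w D f) : WtLE w D f :=
  fun α hα => (h α hα).le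

lemma WtLE.lt {w : ι → ℚ} {D E : ℚ} {f : MvPolynomial ι K} (h : WtLE w D f) (hE : D < E) :
    WtLT w E f := fun α hα => (h α hα).trans_lt hE

lemma wtEq_zero (w : ι → ℚ) (D : ℚ) : WtEq w D (0 : MvPolynomial ι K) := by intro α; simp
lemma wtLT_zero (w : ι → ℚ) (D : ℚ) : WtLT w D (0 : MvPolynomial ι K) := by intro α; simp

lemma WtLT.add {w : ι → ℚ} {D : ℚ} {f g : MvPolynomial ι K} (hf : WtLT w D f) (hg : WtLT w D g) :
    WtLT w D (f + g) := fun α h => (coeff_add_ne h).elim (hf α) (hg α)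
lemma WtLT.sub {w : ι → ℚ} {D : ℚ} {f g : MvPolynomial ι K} (hf : WtLT w D f) (hg : WtLT w D g) :
    WtLT w D (f - g) := fun α h => (coeff_sub_ne h).elim (hf α) (hg α)
lemma WtLE.add {w : ι → ℚ} {D : ℚ} {f g : MvPolynomial ι K} (hf : WtLE w D f) (hg : WtLE w D g) :
    WtLE w D (f + g) := fun α h => (coeff_add_ne h).elim (hf α) (hg α)
lemma WtEq.add {w : ι → ℚ} {D : ℚ} {f g : MvPolynomial ι K} (hf : WtEq w D f) (hg : WtEq w D g) :
    WtEq w D (f + g) := fun α h => (coeff_add_ne h).elim (hf α) (hg α)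
lemma WtEq.sub {w : ι → ℚ} {D : ℚ} {f g : MvPolynomial ι K} (hf : WtEq w D f) (hg : WtEq w D g) :
    WtEq w D (f - g) := fun α h => (coeff_sub_ne h).elim (hf α) (hg α)

lemma WtEq.mul {w : ι → ℚ} {D E : ℚ} {f g : MvPolynomial ι K} (hf : WtEq w D f)
    (hg : WtEq w E g) : WtEq w (D + E) (f * g) := by
  intro α h
  obtain ⟨β, γ, rfl, h1, h2⟩ := exists_of_coeff_mul_ne h
  rw [wt_add, hf β h1, hg γ h2]

lemma WtLE.mul {w : ι → ℚ} {D E : ℚ} {f g : MvPolynomial ι K} (hf : WtLE w D f)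
    (hg : WtLE w E g) : WtLE w (D + E) (f * g) := by
  intro α h
  obtain ⟨β, γ, rfl, h1, h2⟩ := exists_of_coeff_mul_ne h
  rw [wt_add]
  exact add_le_add (hf β h1) (hg γ h2)

lemma WtLT.mul_le {w : ι → ℚ} {D E : ℚ} {f g : MvPolynomial ι K} (hf : WtLT w D f)
    (hg : WtLE w E g) : WtLT w (D + E) (f * g) := by
  intro α h
  obtain ⟨β, γ, rfl, h1, h2⟩ := exists_of_coeff_mul_ne h
  rw [wt_add]
  exact add_lt_add_of_lt_of_le (hf β h1) (hg γ h2)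

lemma WtLE.mul_lt {w : ι → ℚ} {D E : ℚ} {f g : MvPolynomial ι K} (hf : WtLE w D f)
    (hg : WtLT w E g) : WtLT w (D + E) (f * g) := by
  rw [mul_comm, add_comm]
  exact hg.mul_le hf

lemma wt_sub_of_coeff_pderiv {w : ι → ℚ} {i : ι} {f : MvPolynomial ι K} {α : ι →₀ ℕ}
    (h : coeff α (pderiv i f) ≠ 0) :
    coeff (α + Finsupp.single i 1) f ≠ 0 ∧ wt w α = wt w (α + Finsupp.single i 1) - w i := by
  rw [coeff_pderiv] at h
  refine ⟨left_ne_zero_of_mul h, ?_⟩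
  rw [wt_add, wt_single]
  ring

lemma WtEq.pderiv {w : ι → ℚ} {D : ℚ} {f : MvPolynomial ι K} (hf : WtEq w D f) (i : ι) :
    WtEq w (D - w i) (pderiv i f) := fun α h => by
  obtain ⟨h1, h2⟩ := wt_sub_of_coeff_pderiv (w := w) h
  rw [h2, hf _ h1]

lemma WtLT.pderiv {w : ι → ℚ} {D : ℚ} {f : MvPolynomial ι K} (hf : WtLT w D f) (i : ι) :
    WtLT w (D - w i) (pderiv i f) := fun α h => by
  obtain ⟨h1, h2⟩ := wt_sub_of_coeff_pderiv (w := w) h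
  rw [h2]
  exact sub_lt_sub_right (hf _ h1) _

lemma WtLE.pderiv {w : ι → ℚ} {D : ℚ} {f : MvPolynomial ι K} (hf : WtLE w D f) (i : ι) :
    WtLE w (D - w i) (pderiv i f) := fun α h => by
  obtain ⟨h1, h2⟩ := wt_sub_of_coeff_pderiv (w := w) h
  rw [h2]
  exact sub_le_sub_right (hf _ h1) _

lemma wtEq_C (w : ι → ℚ) (c : K) : WtEq w 0 (C c : MvPolynomial ι K) := by
  classical
  intro α h
  rw [coeff_C] at h
  have : 0 = α := by
    by_contra h'
    simp [h'] at h
  simp [← this]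

lemma wtEq_X (w : ι → ℚ) (i : ι) : WtEq w (w i) (X i : MvPolynomial ι K) := by
  classical
  intro α h
  rw [coeff_X] at h
  have : Finsupp.single i 1 = α := by
    by_contra h'
    simp [h'] at h
  rw [← this, wt_single]
  simp

lemma WtEq.C_mul {w : ι → ℚ} {D : ℚ} {f : MvPolynomial ι K} (hf : WtEq w D f) (c : K) :
    WtEq w D (C c * f) := by simpa using (wtEq_C w c).mul hf

lemma WtLE.C_mul {w : ι → ℚ} {D : ℚ} {f : MvPolynomial ι K} (hf : WtLE w D f) (c : K) :
    WtLE w D (C c * f) := by simpa using (wtEq_C w c).le.mul hf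

lemma WtLE.pow {w : ι → ℚ} {D : ℚ} {f : MvPolynomial ι K} (hf : WtLE w D f) (k : ℕ) :
    WtLE w (k * D) (f ^ k) := by
  induction k with
  | zero => simpa using (wtEq_C w (1 : K)).le
  | succ k ih =>
    rw [pow_succ]
    convert ih.mul hf using 1
    push_cast
    ring

/-- If `D` is a lower bound of all weights, then no monomial has weight less than `D`. -/
lemma WtLT.eq_zero_of_forall {w : ι → ℚ} {D : ℚ} {f : MvPolynomial ι K} (hf : WtLT w D f)
    (h : ∀ α, D ≤ wt w α) : f = 0 := by
  ext α
  by_contra h'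
  exact absurd (hf α (by simpa using h')) (not_lt.2 (h α))

lemma WtEq.lead {w : ι → ℚ} {D : ℚ} {g : MvPolynomial ι K} (h : WtEq w D g) : Lead w D g g :=
  ⟨h, by simpa using wtLT_zero w D⟩

lemma WtLT.lead {w : ι → ℚ} {D : ℚ} {f : MvPolynomial ι K} (h : WtLT w D f) : Lead w D f 0 :=
  ⟨wtEq_zero w D, by simpa using h⟩

lemma WtLE.lead {w : ι → ℚ} {D : ℚ} {f : MvPolynomial ι K} (h : WtLE w D f) :
    Lead w D f (part (fun α => wt w α = D) f) := by
  constructor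
  · intro α hα
    rw [coeff_part] at hα
    by_contra h'
    simp [h'] at hα
  · intro α hα
    rw [coeff_sub, coeff_part] at hα
    by_cases h' : wt w α = D
    · simp [h'] at hα
    · exact lt_of_le_of_ne (h α (by simpa [h'] using hα)) h'

lemma Lead.le {w : ι → ℚ} {D : ℚ} {f g : MvPolynomial ι K} (h : Lead w D f g) : WtLE w D f := by
  have := h.1.le.add h.2.le
  rwa [add_sub_cancel] at this

lemma Lead.lt {w : ι → ℚ} {D : ℚ} {f : MvPolynomial ι K} (h : Lead w D f 0) : WtLT w D f := by
  simpa using h.2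

lemma Lead.cast {w : ι → ℚ} {D E : ℚ} {f g : MvPolynomial ι K} (h : Lead w D f g) (hE : D = E) :
    Lead w E f g := hE ▸ h

lemma Lead.lower {w : ι → ℚ} {D E : ℚ} {f g : MvPolynomial ι K} (h : Lead w D f g) (hE : D < E) :
    Lead w E f 0 := (h.le.lt hE).lead

lemma Lead.add {w : ι → ℚ} {D : ℚ} {f g f' g' : MvPolynomial ι K} (h : Lead w D f g)
    (h' : Lead w D f' g') : Lead w D (f + f') (g + g') :=
  ⟨h.1.add h'.1, by
    have := h.2.add h'.2
    rwa [show f - g + (f' - g') = f + f' - (g + g') by ring] at this⟩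

lemma Lead.sub {w : ι → ℚ} {D : ℚ} {f g f' g' : MvPolynomial ι K} (h : Lead w D f g)
    (h' : Lead w D f' g') : Lead w D (f - f') (g - g') :=
  ⟨h.1.sub h'.1, by
    have := h.2.sub h'.2
    rwa [show f - g - (f' - g') = f - f' - (g - g') by ring] at this⟩

lemma Lead.mul {w : ι → ℚ} {D E : ℚ} {f g f' g' : MvPolynomial ι K} (h : Lead w D f g)
    (h' : Lead w E f' g') : Lead w (D + E) (f * f') (g * g') :=
  ⟨h.1.mul h'.1, by
    have := (h.2.mul_le h'.le).add (h.1.le.mul_lt h'.2)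
    rwa [show (f - g) * f' + g * (f' - g') = f * f' - g * g' by ring] at this⟩

lemma Lead.C_mul {w : ι → ℚ} {D : ℚ} {f g : MvPolynomial ι K} (h : Lead w D f g) (c : K) :
    Lead w D (C c * f) (C c * g) := by simpa using (wtEq_C w c).lead.mul h

lemma Lead.pderiv {w : ι → ℚ} {D : ℚ} {f g : MvPolynomial ι K} (h : Lead w D f g) (i : ι) :
    Lead w (D - w i) (pderiv i f) (pderiv i g) :=
  ⟨h.1.pderiv i, by simpa using h.2.pderiv i⟩

lemma Lead.unique {w : ι → ℚ} {D : ℚ} {f g g' : MvPolynomial ι K} (h : Lead w D f g)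
    (h' : Lead w D f g') : g = g' := by
  ext α
  by_contra hne
  have h1 : coeff α (g - g') ≠ 0 := by simpa [sub_eq_zero] using hne
  have h2 := (h.1.sub h'.1) α h1
  have h3 := (h'.2.sub h.2) α (by rwa [show f - g' - (f - g) = g - g' by ring])
  exact absurd h2 h3.ne

lemma Lead.coeff_eq {w : ι → ℚ} {D : ℚ} {f g : MvPolynomial ι K} (h : Lead w D f g) {α : ι →₀ ℕ}
    (hα : wt w α = D) : coeff α g = coeff α f := by
  by_contra hne
  have := h.2 α (by simpa [sub_eq_zero] using Ne.symm hne)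
  exact absurd hα this.ne

lemma lead_C {w : ι → ℚ} {D : ℚ} (hD : 0 < D) (c : K) : Lead w D (C c : MvPolynomial ι K) 0 :=
  ((wtEq_C w c).le.lt hD).lead

lemma Lead.eq_zero_of_C {w : ι → ℚ} {D : ℚ} {c : K} {g : MvPolynomial ι K}
    (h : Lead w D (C c) g) (hD : 0 < D) : g = 0 := h.unique (lead_C hD c)

end Lead

/-! ### Directional derivatives and linear substitutions -/

section LinSubst

variable {K : Type*} [Field K] {n : ℕ}

/-- The derivative `∑ᵢ eᵢ ∂/∂xᵢ` in the direction of the vector `e`. -/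
def dirD (e : Fin n → K) : Derivation K (MvPolynomial (Fin n) K) (MvPolynomial (Fin n) K) :=
  mkDerivation K (fun i => C (e i))

lemma dirD_X (e : Fin n → K) (i : Fin n) : dirD e (X i) = C (e i) := mkDerivation_X _ _ _

lemma dirD_apply (e : Fin n → K) (f : MvPolynomial (Fin n) K) :
    dirD e f = ∑ i, C (e i) * pderiv i f := by
  induction f using MvPolynomial.induction_on with
  | C a => simp
  | add p q hp hq => simp [hp, hq, mul_add, Finset.sum_add_distrib]
  | mul_X p i hp =>
    simp only [Derivation.leibniz, dirD_X, hp, smul_eq_mul, mul_add, Finset.sum_add_distrib]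
    congr 1
    · simp [pderiv_X, Pi.single_apply, mul_comm]
    · rw [Finset.mul_sum]
      exact Finset.sum_congr rfl fun j _ => by ring

lemma dirD_single (i : Fin n) : dirD (Pi.single i (1 : K)) = pderiv i := by
  apply derivation_ext
  intro j
  rw [dirD_X]
  by_cases h : j = i
  · subst h; simp
  · simp [h, pderiv_X_of_ne h]

lemma dirD_smul (c : K) (e : Fin n → K) (f : MvPolynomial (Fin n) K) :
    dirD (c • e) f = C c * dirD e f := by
  simp [dirD_apply, Finset.mul_sum, mul_assoc]

lemma linSubst_eq_aeval (f : MvPolynomial (Fin n) K) (T : Matrix (Fin n) (Fin n) K) :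
    linSubst f T = aeval (fun i => ∑ j, C (T i j) * X j) f := rfl

section algebra

variable (f g : MvPolynomial (Fin n) K) (T S : Matrix (Fin n) (Fin n) K)

@[simp] lemma linSubst_add : linSubst (f + g) T = linSubst f T + linSubst g T := map_add _ _ _
@[simp] lemma linSubst_sub : linSubst (f - g) T = linSubst f T - linSubst g T := map_sub _ _ _
@[simp] lemma linSubst_mul : linSubst (f * g) T = linSubst f T * linSubst g T := map_mul _ _ _
@[simp] lemma linSubst_zero : linSubst 0 T = 0 := map_zero _
@[simp] lemma linSubst_C (c : K) : linSubst (C c) T = C c := by simp [linSubst_eq_aeval, algebraMap_eq]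
@[simp] lemma linSubst_X (i : Fin n) : linSubst (X i) T = ∑ j, C (T i j) * X j := by
  simp [linSubst_eq_aeval]
@[simp] lemma linSubst_sum {ι : Type*} (s : Finset ι) (F : ι → MvPolynomial (Fin n) K) :
    linSubst (∑ i ∈ s, F i) T = ∑ i ∈ s, linSubst (F i) T := map_sum _ _ _

lemma linSubst_linSubst : linSubst (linSubst f T) S = linSubst f (T * S) := by
  induction f using MvPolynomial.induction_on with
  | C a => simp
  | add p q hp hq => simp [hp, hq]
  | mul_X p i hp =>
    simp only [linSubst_mul, hp, linSubst_X, linSubst_sum, linSubst_C, Matrix.mul_apply, map_sum,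
      map_mul, Finset.sum_mul, Finset.mul_sum]
    rw [Finset.sum_comm]
    simp [mul_assoc]

@[simp] lemma linSubst_one : linSubst f 1 = f := by
  induction f using MvPolynomial.induction_on with
  | C a => simp
  | add p q hp hq => simp [hp, hq]
  | mul_X p i hp => simp [hp, Matrix.one_apply, apply_ite C, ite_mul]

variable {f g T S}

lemma linSubst_injective (h : T * S = 1) :
    Function.Injective (fun f : MvPolynomial (Fin n) K => linSubst f T) := by
  intro p q hpq
  have := congrArg (fun r => linSubst r S) hpq
  simpa [linSubst_linSubst, h] using this

variable (f T)

/-- The chain rule: the derivative of `f(Tx)` in the direction `e` is the derivative of `f` in the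
direction `Te`, taken at `Tx`. -/
lemma dirD_linSubst (e : Fin n → K) :
    dirD e (linSubst f T) = linSubst (dirD (T.mulVec e) f) T := by
  induction f using MvPolynomial.induction_on with
  | C a => simp
  | add p q hp hq => simp [hp, hq]
  | mul_X p i hp =>
    have hX : dirD e (∑ j, C (T i j) * X j) = C (T.mulVec e i) := by
      rw [map_sum]
      simp only [Matrix.mulVec, dotProduct, map_sum, map_mul]
      refine Finset.sum_congr rfl fun j _ => ?_
      rw [Derivation.leibniz, dirD_X, derivation_C]
      simp
    simp [hp, hX, dirD_X]

lemma dirD_iterate_linSubst (e : Fin n → K) (k : ℕ) :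
    (dirD e)^[k] (linSubst f T) = linSubst ((dirD (T.mulVec e))^[k] f) T := by
  induction k generalizing f with
  | zero => rfl
  | succ k ih => simp only [Function.iterate_succ, Function.comp, dirD_linSubst, ih]

lemma pderiv_linSubst (j : Fin n) :
    pderiv j (linSubst f T) = ∑ i, C (T i j) * linSubst (pderiv i f) T := by
  rw [← dirD_single, dirD_linSubst, dirD_apply]
  simp

lemma hessian_apply (i j : Fin n) : hessian f i j = pderiv j (pderiv i f) := rfl

lemma pderiv_comm' {σ : Type*} (i j : σ) (f : MvPolynomial σ K) :
    pderiv i (pderiv j f) = pderiv j (pderiv i f) := by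
  ext α
  simp only [coeff_pderiv, Finsupp.add_apply]
  rw [add_right_comm]
  by_cases h : i = j
  · subst h; rfl
  · have h' : j ≠ i := fun h' => h h'.symm
    simp [h, h']
    ring

lemma hessian_linSubst :
    hessian (linSubst f T) = (T.map C).transpose * (hessian f).map (fun p => linSubst p T) * T.map C := by
  ext1 i j
  simp only [hessian_apply, pderiv_linSubst, map_sum, Matrix.mul_apply, Matrix.transpose_apply,
    Matrix.map_apply, pderiv_C_mul, Finset.sum_mul, Finset.mul_sum]
  rw [Finset.sum_comm]
  refine Finset.sum_congr rfl fun k _ => Finset.sum_congr rfl fun l _ => by ring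

lemma det_hessian_linSubst :
    (hessian (linSubst f T)).det = C (T.det ^ 2) * linSubst (hessian f).det T := by
  have h1 : (T.map C).det = (C T.det : MvPolynomial (Fin n) K) :=
    (RingHom.map_det (C : K →+* MvPolynomial (Fin n) K) T).symm
  have h2 : ((hessian f).map (fun p => linSubst p T)).det = linSubst (hessian f).det T :=
    (AlgHom.map_det (aeval (fun i => ∑ j, C (T i j) * X j)) (hessian f)).symm
  rw [hessian_linSubst, Matrix.det_mul, Matrix.det_mul, Matrix.det_transpose, h1, h2]
  simp
  ring

end algebra

section weights

variable {w : Fin n → ℚ} {D : ℚ} {T : Matrix (Fin n) (Fin n) K} {f g : MvPolynomial (Fin n) K}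

lemma exists_of_coeff_linSubst_ne (hT : ∀ i j, T i j ≠ 0 → w j ≤ w i) {α : Fin n →₀ ℕ}
    (h : coeff α (linSubst f T) ≠ 0) : ∃ β, coeff β f ≠ 0 ∧ wt w α ≤ wt w β := by
  have hX : ∀ i, WtLE w (w i) (∑ j, C (T i j) * X j : MvPolynomial (Fin n) K) := by
    intro i α hα
    rw [coeff_sum] at hα
    obtain ⟨j, -, hj⟩ := Finset.exists_ne_zero_of_sum_ne_zero hα
    have h0 : T i j ≠ 0 := by
      rintro h0
      simp [h0] at hj
    exact (((wtEq_X w j).C_mul _ α hj).le).trans (hT i j h0)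
  rw [linSubst_eq_aeval, aeval_def, eval₂_eq', coeff_sum] at h
  obtain ⟨β, hβ, hne⟩ := Finset.exists_ne_zero_of_sum_ne_zero h
  refine ⟨β, mem_support_iff.1 hβ, ?_⟩
  have hprod : ∀ s : Finset (Fin n), WtLE w (∑ i ∈ s, (β i : ℚ) * w i)
      (∏ i ∈ s, (∑ j, C (T i j) * X j : MvPolynomial (Fin n) K) ^ β i) := by
    intro s
    induction s using Finset.induction_on with
    | empty => simpa using (wtEq_C w (1 : K)).le
    | insert i s hi ih =>
      rw [Finset.sum_insert hi, Finset.prod_insert hi]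
      exact ((hX i).pow _).mul ih
  exact (hprod Finset.univ).C_mul _ α hne

lemma WtLT.linSubst (hf : WtLT w D f) (hT : ∀ i j, T i j ≠ 0 → w j ≤ w i) :
    WtLT w D (linSubst f T) := fun α hα => by
  obtain ⟨β, hβ, h⟩ := exists_of_coeff_linSubst_ne hT hα
  exact h.trans_lt (hf β hβ)

lemma WtLE.linSubst (hf : WtLE w D f) (hT : ∀ i j, T i j ≠ 0 → w j ≤ w i) :
    WtLE w D (linSubst f T) := fun α hα => by
  obtain ⟨β, hβ, h⟩ := exists_of_coeff_linSubst_ne hT hα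
  exact h.trans (hf β hβ)

lemma WtEq.linSubst (hf : WtEq w D f) (hT : ∀ i j, T i j ≠ 0 → w i = w j) :
    WtEq w D (linSubst f T) := fun α hα => by
  have h1 := hf.le.linSubst (fun i j h => (hT i j h).ge) α hα
  obtain ⟨β, hβ, h2⟩ := exists_of_coeff_linSubst_ne (w := fun i => - w i)
    (fun i j h => (neg_le_neg (hT i j h).le)) hα
  have h3 := hf β hβ
  simp only [wt, mul_neg, Finset.sum_neg_distrib, neg_le_neg_iff] at h1 h2 h3 ⊢
  linarith

lemma Lead.linSubst (h : Lead w D f g) (hT : ∀ i j, T i j ≠ 0 → w i = w j) :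
    Lead w D (linSubst f T) (linSubst g T) :=
  ⟨h.1.linSubst hT, by simpa using h.2.linSubst fun i j h => (hT i j h).ge⟩

end weights

end LinSubst

/-! ### Polynomials in two variables -/

section Tools

variable {ι : Type*} {K : Type*} [Field K]

lemma pderiv_eq_zero_iff [CharZero K] {f : MvPolynomial ι K} {k : ι} :
    pderiv k f = 0 ↔ ∀ α, coeff α f ≠ 0 → α k = 0 := by
  constructor
  · intro h α hα
    by_contra h0
    have h1 : coeff (α - Finsupp.single k 1) (pderiv k f) = 0 := by rw [h]; simp
    have h2 : α - Finsupp.single k 1 + Finsupp.single k 1 = α :=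
      tsub_add_cancel_of_le (Finsupp.single_le_iff.2 (Nat.one_le_iff_ne_zero.2 h0))
    rw [coeff_pderiv, h2] at h1
    rcases mul_eq_zero.1 h1 with h1 | h1
    · exact hα h1
    · exact Nat.cast_add_one_ne_zero _ h1
  · intro h
    ext α
    rw [coeff_pderiv, coeff_zero]
    by_contra hne
    simpa using h _ (left_ne_zero_of_mul hne)

lemma coeff_pderiv_pred {f : MvPolynomial ι K} {k : ι} {α : ι →₀ ℕ} (h : α k ≠ 0) :
    coeff (α - Finsupp.single k 1) (pderiv k f) = coeff α f * (α k : K) := by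
  have h2 : α - Finsupp.single k 1 + Finsupp.single k 1 = α :=
    tsub_add_cancel_of_le (Finsupp.single_le_iff.2 (Nat.one_le_iff_ne_zero.2 h))
  rw [coeff_pderiv, h2]
  congr 1
  rw [← Nat.cast_add_one]
  congr 1
  simp
  omega

lemma pderiv_iterate_eq_zero_iff [CharZero K] {f : MvPolynomial ι K} {k : ι} {m : ℕ} :
    (pderiv k)^[m] f = 0 ↔ ∀ α, coeff α f ≠ 0 → α k < m := by
  induction m generalizing f with
  | zero =>
    simp only [Function.iterate_zero, id]
    constructor
    · rintro rfl α h
      simp at h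
    · intro h
      ext α
      by_contra hne
      exact absurd (h α (by simpa using hne)) (Nat.not_lt_zero _)
  | succ m ih =>
    rw [Function.iterate_succ, Function.comp, ih]
    constructor
    · intro h α hα
      by_cases h0 : α k = 0
      · omega
      · have := h (α - Finsupp.single k 1) (by
          rw [coeff_pderiv_pred h0]
          exact mul_ne_zero hα (Nat.cast_ne_zero.2 h0))
        simp at this
        omega
    · intro h α hα
      rw [coeff_pderiv] at hα
      have := h _ (left_ne_zero_of_mul hα)
      simp at this
      omega

/-- Euler's relation for a polynomial that is homogeneous in the single variable `xₖ`. -/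
lemma X_mul_pderiv_of_forall {f : MvPolynomial ι K} {k : ι} {m : ℕ}
    (h : ∀ α, coeff α f ≠ 0 → α k = m) : X k * pderiv k f = (m : MvPolynomial ι K) * f := by
  rw [f.as_sum, map_sum, Finset.mul_sum, Finset.mul_sum]
  refine Finset.sum_congr rfl fun α hα => ?_
  rw [X_mul_pderiv_monomial, h α (mem_support_iff.1 hα)]
  simp

lemma X_mul_pderiv_pderiv {f : MvPolynomial ι K} {k : ι} {m : ℕ}
    (h : X k * pderiv k f = (m : MvPolynomial ι K) * f) :
    X k ^ 2 * pderiv k (pderiv k f) = (m : MvPolynomial ι K) * ((m : MvPolynomial ι K) - 1) * f := by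
  have h1 := congrArg (pderiv k) h
  simp only [Derivation.leibniz, pderiv_X_self, smul_eq_mul, Derivation.map_natCast] at h1
  linear_combination X k * h1 + ((m : MvPolynomial ι K) - 1) * h

lemma X_mul_pderiv_pderiv_of_ne {f : MvPolynomial ι K} {k l : ι} {m : ℕ} (hkl : k ≠ l)
    (h : X k * pderiv k f = (m : MvPolynomial ι K) * f) :
    X k * pderiv l (pderiv k f) = (m : MvPolynomial ι K) * pderiv l f := by
  have h1 := congrArg (pderiv l) h
  simp only [Derivation.leibniz, pderiv_X_of_ne hkl, smul_eq_mul, Derivation.map_natCast] at h1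
  linear_combination h1

lemma natCast_eq_C (m : ℕ) : (m : MvPolynomial ι K) = C (m : K) := (map_natCast C m).symm

end Tools

/-- A separating slope: `m` is the largest ordinate of a set of lattice points, and the points
`p` in `S`, with abscissa `x p ≥ 1` and ordinate `y p < m`, do not all lie below the line through
`(0, m)` with slope `-1`. Then there is a line of slope `-σ` with `0 < σ < 1` that supports `S`,
passes strictly below `(0, m)`, and leaves no point of abscissa `1` on it. -/
lemma exists_slope {A : Type*} (S : Finset A) (x y : A → ℕ) (m : ℕ)
    (h1 : ∀ p ∈ S, 1 ≤ x p ∧ y p < m) (h2 : ∃ p ∈ S, m < x p + y p) :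
    ∃ σ ρ : ℚ, 0 < σ ∧ σ < 1 ∧ (∀ p ∈ S, σ * x p + y p ≤ ρ) ∧ (∃ p ∈ S, σ * x p + y p = ρ) ∧
      m - 1 + σ < ρ ∧ ρ < m := by
  obtain ⟨p₁, hp₁, hp₁'⟩ := h2
  have hne : S.Nonempty := ⟨p₁, hp₁⟩
  obtain ⟨p₀, hp₀, hmin⟩ := S.exists_min_image (fun p => ((m : ℚ) - y p) / x p) hne
  set s : ℚ := ((m : ℚ) - y p₀) / x p₀ with hs
  have hx : ∀ p ∈ S, (1 : ℚ) ≤ x p := fun p hp => by exact_mod_cast (h1 p hp).1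
  have hy : ∀ p ∈ S, (y p : ℚ) < m := fun p hp => by exact_mod_cast (h1 p hp).2
  have hx₀ := hx p₀ hp₀
  have hs0 : 0 < s := div_pos (by linarith [hy p₀ hp₀]) (by linarith)
  have hs1 : s < 1 := by
    refine (hmin p₁ hp₁).trans_lt ?_
    rw [div_lt_one (by linarith [hx p₁ hp₁])]
    have : (m : ℚ) < x p₁ + y p₁ := by exact_mod_cast hp₁'
    linarith
  have hsx : s * x p₀ = m - y p₀ := by rw [hs]; field_simp
  have hle : ∀ p ∈ S, s * x p + y p ≤ m := by
    intro p hp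
    have h3 := hmin p hp
    rw [le_div_iff₀ (by linarith [hx p hp])] at h3
    linarith
  obtain ⟨δ, hδ0, hδs, hδ1⟩ : ∃ δ : ℚ, 0 < δ ∧ δ < s ∧ δ * x p₀ < 1 - s := by
    refine ⟨min s ((1 - s) / x p₀) / 2, ?_, ?_, ?_⟩
    · have : 0 < (1 - s) / x p₀ := div_pos (by linarith) (by linarith)
      have := lt_min hs0 this
      linarith
    · have := min_le_left s ((1 - s) / x p₀)
      have : 0 < (1 - s) / x p₀ := div_pos (by linarith) (by linarith)
      have := lt_min hs0 this
      linarith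
    · have h3 := min_le_right s ((1 - s) / x p₀)
      rw [le_div_iff₀ (by linarith)] at h3
      linarith
  obtain ⟨p₂, hp₂, hmax⟩ := S.exists_max_image (fun p => (s - δ) * x p + y p) hne
  refine ⟨s - δ, (s - δ) * x p₂ + y p₂, by linarith, by linarith, hmax, ⟨p₂, hp₂, rfl⟩, ?_, ?_⟩
  · have h3 := hmax p₀ hp₀
    linarith
  · have h3 := hle p₂ hp₂
    have h4 : 0 < δ * x p₂ := mul_pos hδ0 (by linarith [hx p₂ hp₂])
    linarith

section LeadPderiv

variable {ι : Type*} [Fintype ι] {K : Type*} [Field K]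

/-- The leading form of `∂f/∂xᵢ` depends only on the monomials of `f` that involve `xᵢ`. -/
lemma lead_pderiv_of_coeff {w : ι → ℚ} {ρ : ℚ} {f U : MvPolynomial ι K} {i : ι}
    (hf : ∀ α, coeff α f ≠ 0 → α i ≠ 0 → wt w α ≤ ρ)
    (hU : WtEq w ρ U) (hUf : ∀ α, α i ≠ 0 → wt w α = ρ → coeff α U = coeff α f) :
    Lead w (ρ - w i) (pderiv i f) (pderiv i U) := by
  refine ⟨hU.pderiv i, fun α hα => ?_⟩
  rw [← map_sub] at hα
  obtain ⟨h1, h2⟩ := wt_sub_of_coeff_pderiv (w := w) hα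
  have hi : (α + Finsupp.single i 1 : ι →₀ ℕ) i ≠ 0 := by simp
  have h3 : wt w (α + Finsupp.single i 1) ≠ ρ := by
    intro h3
    apply h1
    rw [coeff_sub, hUf _ hi h3, sub_self]
  have h4 : coeff (α + Finsupp.single i 1) U = 0 := by
    by_contra h4
    exact h3 (hU _ h4)
  rw [coeff_sub, h4, sub_zero] at h1
  rw [h2]
  exact sub_lt_sub_right (lt_of_le_of_ne (hf _ h1 hi) h3) _

lemma Lead.natCast_mul {w : ι → ℚ} {D : ℚ} {f g : MvPolynomial ι K} (h : Lead w D f g) (m : ℕ) :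
    Lead w D ((m : MvPolynomial ι K) * f) ((m : MvPolynomial ι K) * g) := by
  rw [natCast_eq_C]
  exact h.C_mul _

end LeadPderiv

section Binary

variable {K : Type*} [Field K] {n : ℕ}

/-- The determinant `a_ii a_jj - a_ij ^ 2` of the Hessian of `a` with respect to `xᵢ, xⱼ`. -/
def hess2 (i j : Fin n) (a : MvPolynomial (Fin n) K) : MvPolynomial (Fin n) K :=
  pderiv i (pderiv i a) * pderiv j (pderiv j a) - pderiv i (pderiv j a) ^ 2

/-- The form `a_i ^ 2 a_jj - 2 a_i a_j a_ij + a_j ^ 2 a_ii`, which vanishes identically if and only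
if the level curves of `a` in the `(xᵢ, xⱼ)`-plane have curvature zero. -/
def levelCurv (i j : Fin n) (a : MvPolynomial (Fin n) K) : MvPolynomial (Fin n) K :=
  pderiv i a ^ 2 * pderiv j (pderiv j a) - 2 * (pderiv i a * pderiv j a * pderiv i (pderiv j a))
    + pderiv j a ^ 2 * pderiv i (pderiv i a)

/-- The operator `μ a (a_ii a_jj - a_ij ^ 2) - ν (a_i ^ 2 a_jj - 2 a_i a_j a_ij + a_j ^ 2 a_ii)`.
For `μ = m - 1` and `ν = m` it is, up to the factor `m z ^ (3m-2)`, the Hessian determinant of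
`a z ^ m`. -/
def Phi (i j : Fin n) (μ ν : ℕ) (a : MvPolynomial (Fin n) K) : MvPolynomial (Fin n) K :=
  (μ : MvPolynomial (Fin n) K) * (a * hess2 i j a) - (ν : MvPolynomial (Fin n) K) * levelCurv i j a

variable {i j : Fin n} {μ ν : ℕ} {w : Fin n → ℚ} {D : ℚ} {a b f g : MvPolynomial (Fin n) K}

lemma Lead.hess2 (h : Lead w D f g) (i j : Fin n) :
    Lead w (2 * D - 2 * w i - 2 * w j) (hess2 i j f) (hess2 i j g) := by
  have h1 := ((h.pderiv i).pderiv i).mul ((h.pderiv j).pderiv j)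
  have h2 := ((h.pderiv j).pderiv i).mul ((h.pderiv j).pderiv i)
  have := (h1.cast (E := 2 * D - 2 * w i - 2 * w j) (by ring)).sub (h2.cast (by ring))
  simpa only [PolyMap.hess2, sq] using this

lemma Lead.levelCurv (h : Lead w D f g) (i j : Fin n) :
    Lead w (3 * D - 2 * w i - 2 * w j) (levelCurv i j f) (levelCurv i j g) := by
  have h1 := ((h.pderiv i).mul (h.pderiv i)).mul ((h.pderiv j).pderiv j)
  have h2 := (((h.pderiv i).mul (h.pderiv j)).mul ((h.pderiv j).pderiv i)).C_mul 2
  have h3 := ((h.pderiv j).mul (h.pderiv j)).mul ((h.pderiv i).pderiv i)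
  have := ((h1.cast (E := 3 * D - 2 * w i - 2 * w j) (by ring)).sub (h2.cast (by ring))).add
    (h3.cast (by ring))
  simpa only [PolyMap.levelCurv, sq, map_ofNat] using this

lemma Lead.Phi (h : Lead w D f g) (i j : Fin n) (μ ν : ℕ) :
    Lead w (3 * D - 2 * w i - 2 * w j) (Phi i j μ ν f) (Phi i j μ ν g) :=
  ((h.mul (h.hess2 i j)).natCast_mul μ |>.cast (by ring)).sub ((h.levelCurv i j).natCast_mul ν)

/-- Passage to leading forms preserves the equation `Φ(a) = c a`, with `c` replaced by zero. -/
lemma Phi_lead_eq_zero {c : K} (h : Lead w D a b) (ha : Phi i j μ ν a = C c * a)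
    (hc : c = 0 ∨ 2 * w i + 2 * w j < 2 * D) : Phi i j μ ν b = 0 := by
  refine (h.Phi i j μ ν).unique (g' := 0) ?_
  rw [ha]
  rcases hc with rfl | hc
  · simpa using (wtLT_zero w _).lead
  · exact (h.C_mul c).lower (by linarith)

/-- On a multiple `b` of `xᵢ ^ I xⱼ ^ J` by a polynomial in the other variables, `Φ(b)` is, up to
monomial factors, the product of `b ^ 3` and `I J (μ (1 - I - J) + ν (I + J))`. -/
lemma Phi_vertex [CharZero K] (hij : i ≠ j) {I J : ℕ} (hb : b ≠ 0) (h0 : Phi i j μ ν b = 0)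
    (hi : ∀ α, coeff α b ≠ 0 → α i = I) (hj : ∀ α, coeff α b ≠ 0 → α j = J)
    (hI : I ≠ 0) (hJ : J ≠ 0) : ((μ : ℤ) * (1 - I - J) + ν * (I + J) : ℤ) = 0 := by
  have ei := X_mul_pderiv_of_forall hi
  have ej := X_mul_pderiv_of_forall hj
  have eii := X_mul_pderiv_pderiv ei
  have ejj := X_mul_pderiv_pderiv ej
  have eij := X_mul_pderiv_pderiv_of_ne hij.symm ej
  have key : X i ^ 2 * X j ^ 2 * Phi i j μ ν b =
      b ^ 3 * ((I * J * (μ * (1 - I - J) + ν * (I + J)) : ℤ) : MvPolynomial (Fin n) K) := by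
    have eij' : X i * X j * pderiv i (pderiv j b) =
        (I : MvPolynomial (Fin n) K) * (J : MvPolynomial (Fin n) K) * b := by
      linear_combination X i * eij + (J : MvPolynomial (Fin n) K) * ei
    have e1 : X i ^ 2 * X j ^ 2 * Phi i j μ ν b =
        (μ : MvPolynomial (Fin n) K) * (b * ((X i ^ 2 * pderiv i (pderiv i b)) *
          (X j ^ 2 * pderiv j (pderiv j b)) - (X i * X j * pderiv i (pderiv j b)) ^ 2)) -
        (ν : MvPolynomial (Fin n) K) * ((X i * pderiv i b) ^ 2 * (X j ^ 2 * pderiv j (pderiv j b))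
          - 2 * ((X i * pderiv i b) * (X j * pderiv j b) * (X i * X j * pderiv i (pderiv j b)))
          + (X j * pderiv j b) ^ 2 * (X i ^ 2 * pderiv i (pderiv i b))) := by
      simp only [Phi, hess2, levelCurv]
      ring
    rw [e1, ei, ej, eii, ejj, eij']
    push_cast
    ring
  rw [h0, mul_zero] at key
  have h1 := (mul_eq_zero.1 key.symm).resolve_left (pow_ne_zero 3 hb)
  have h2 := Int.cast_eq_zero.1 h1
  have hI' : (I : ℤ) ≠ 0 := by exact_mod_cast hI
  have hJ' : (J : ℤ) ≠ 0 := by exact_mod_cast hJ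
  exact (mul_eq_zero.1 h2).resolve_left (mul_ne_zero hI' hJ')

/-- If `b` is a power of `xⱼ` and dominates `a`, then the leading part of `Φ(a)` is linear in the
leading part `U` of those terms of `a` that involve `xᵢ`; so `U` has degree at most one in `xᵢ`. -/
lemma Phi_second_order [CharZero K] {c : K} {ρ : ℚ} {U : MvPolynomial (Fin n) K} {J : ℕ}
    (ha : Phi i j μ ν a = C c * a) (h : Lead w D a b) (hb : b ≠ 0)
    (hbj : X j * pderiv j b = (J : MvPolynomial (Fin n) K) * b)
    (hU : Lead w (ρ - w i) (pderiv i a) (pderiv i U)) (hρ : ρ < D)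
    (hc : c = 0 ∨ 2 * w i + 2 * w j < D + ρ)
    (hJ : J ≠ 0) (hJ' : ((μ : ℤ) * (J - 1) - ν * J : ℤ) ≠ 0) :
    pderiv i (pderiv i U) = 0 := by
  have hij : Lead w (ρ - w i - w j) (pderiv i (pderiv j a)) (pderiv j (pderiv i U)) := by
    rw [pderiv_comm']
    exact hU.pderiv j
  have hii := hU.pderiv i
  have hj := h.pderiv j
  have hjj := hj.pderiv j
  set E := 2 * D + ρ - 2 * w i - 2 * w j with hE
  have l1 : Lead w E (a * hess2 i j a)
      (b * (pderiv i (pderiv i U) * pderiv j (pderiv j b) - 0)) := by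
    have t2 : Lead w (E - D) (pderiv i (pderiv j a) ^ 2) 0 := by
      rw [sq]
      exact (hij.mul hij).lower (by rw [hE]; linarith)
    exact (h.mul (((hii.mul hjj).cast (by rw [hE]; ring)).sub t2)).cast (by ring)
  have l2 : Lead w E (levelCurv i j a) (0 - 0 + pderiv j b ^ 2 * pderiv i (pderiv i U)) := by
    have t1 : Lead w E (pderiv i a ^ 2 * pderiv j (pderiv j a)) 0 := by
      rw [sq]
      exact ((hU.mul hU).mul hjj).lower (by rw [hE]; linarith)
    have t2 : Lead w E (2 * (pderiv i a * pderiv j a * pderiv i (pderiv j a))) 0 := by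
      have := ((hU.mul hj).mul hij).C_mul 2
      rw [map_ofNat] at this
      exact this.lower (by rw [hE]; linarith)
    refine (t1.sub t2).add ?_
    rw [sq, sq]
    exact ((hj.mul hj).mul hii).cast (by rw [hE]; ring)
  have l3 : Lead w E (Phi i j μ ν a) 0 := by
    rw [ha]
    rcases hc with rfl | hc
    · simpa using (wtLT_zero w _).lead
    · exact (h.C_mul c).lower (by rw [hE]; linarith)
  have h0 := ((l1.natCast_mul μ).sub (l2.natCast_mul ν)).unique l3
  have ejj := X_mul_pderiv_pderiv hbj
  have key : pderiv i (pderiv i U) *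
      (b ^ 2 * ((J * (μ * (J - 1) - ν * J) : ℤ) : MvPolynomial (Fin n) K)) = 0 := by
    push_cast
    linear_combination X j ^ 2 * h0 - (μ : MvPolynomial (Fin n) K) * b * pderiv i (pderiv i U) * ejj
      + (ν : MvPolynomial (Fin n) K) * pderiv i (pderiv i U) *
        (X j * pderiv j b + (J : MvPolynomial (Fin n) K) * b) * hbj
  refine (mul_eq_zero.1 key).resolve_right (mul_ne_zero (pow_ne_zero 2 hb) ?_)
  have hJ0 : (J : ℤ) ≠ 0 := by exact_mod_cast hJ
  exact Int.cast_ne_zero.2 (mul_ne_zero hJ0 hJ')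

lemma Phi_symm (i j : Fin n) (μ ν : ℕ) (a : MvPolynomial (Fin n) K) :
    Phi j i μ ν a = Phi i j μ ν a := by
  simp only [Phi, hess2, levelCurv, pderiv_comm' i j]
  ring

lemma transvection_mulVec_single_same (j i : Fin n) (θ : K) :
    (Matrix.transvection j i θ).mulVec (Pi.single i 1) = Pi.single i 1 + θ • Pi.single j 1 := by
  ext k
  simp [Matrix.transvection, Matrix.single, Pi.single_apply, Matrix.one_apply, eq_comm]

lemma transvection_mulVec_single_of_ne {j i k : Fin n} (hk : k ≠ i) (θ : K) :
    (Matrix.transvection j i θ).mulVec (Pi.single k 1) = Pi.single k 1 := by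
  ext l
  simp [Matrix.transvection, Matrix.single, Pi.single_apply, Matrix.one_apply, hk.symm]

lemma dirD_add (e e' : Fin n → K) (f : MvPolynomial (Fin n) K) :
    dirD (e + e') f = dirD e f + dirD e' f := by
  simp [dirD_apply, add_mul, Finset.sum_add_distrib]

lemma pderiv_shear_same (j i : Fin n) (θ : K) (a : MvPolynomial (Fin n) K) :
    pderiv i (linSubst a (Matrix.transvection j i θ)) =
      linSubst (pderiv i a + C θ * pderiv j a) (Matrix.transvection j i θ) := by
  rw [← dirD_single, dirD_linSubst, transvection_mulVec_single_same, dirD_add, dirD_smul,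
    dirD_single, dirD_single]

lemma pderiv_shear_of_ne {j i k : Fin n} (hk : k ≠ i) (θ : K) (a : MvPolynomial (Fin n) K) :
    pderiv k (linSubst a (Matrix.transvection j i θ)) =
      linSubst (pderiv k a) (Matrix.transvection j i θ) := by
  rw [← dirD_single, dirD_linSubst, transvection_mulVec_single_of_ne hk]

lemma Phi_shear (hij : i ≠ j) (θ : K) (a : MvPolynomial (Fin n) K) :
    Phi i j μ ν (linSubst a (Matrix.transvection j i θ)) =
      linSubst (Phi i j μ ν a) (Matrix.transvection j i θ) := by
  have hnat : ∀ m : ℕ, linSubst (m : MvPolynomial (Fin n) K) (Matrix.transvection j i θ) = m := by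
    intro m
    rw [natCast_eq_C, linSubst_C]
  have h2 : linSubst (2 : MvPolynomial (Fin n) K) (Matrix.transvection j i θ) = 2 := by
    simpa using hnat 2
  simp only [Phi, hess2, levelCurv, pderiv_shear_same, pderiv_shear_of_ne hij.symm, map_add,
    linSubst_add, linSubst_sub, linSubst_mul, pderiv_C_mul, linSubst_C, pderiv_comm' i j, sq, hnat, h2]
  ring

end Binary

section BinaryMain

variable {K : Type*} [Field K] {n : ℕ} {i j : Fin n} {μ ν : ℕ}

lemma wt_pair (i j : Fin n) (s t : ℚ) (α : Fin n →₀ ℕ) :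
    wt (Pi.single i s + Pi.single j t) α = s * α i + t * α j := by
  simp only [wt, Pi.add_apply, mul_add, Finset.sum_add_distrib]
  simp [Pi.single_apply, mul_comm]

lemma wt_pi_single (i : Fin n) (s : ℚ) (α : Fin n →₀ ℕ) : wt (Pi.single i s) α = s * α i := by
  simp [wt, Pi.single_apply, mul_comm]

lemma transvection_ne_zero {θ : K} {k l : Fin n} (h : Matrix.transvection j i θ k l ≠ 0) :
    k = l ∨ (k = j ∧ l = i) := by
  by_contra! h'
  apply h
  have : ¬ (j = k ∧ i = l) := fun h2 => h'.2 h2.1.symm h2.2.symm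
  simp [Matrix.transvection, Matrix.one_apply_ne h'.1, Matrix.single, this]

/-- A binary form `q` with `Φ(q) = 0` is a multiple of a power of a linear form: it is annihilated
by a directional derivative. The hypotheses `hv` and `hl` on `μ` and `ν` are explained at
`exists_dirD_iterate_eq_zero`. -/
lemma exists_dirD_eq_zero_of_form [CharZero K] (hij : i ≠ j) {q : MvPolynomial (Fin n) K} {κ : ℕ}
    (hq : ∀ k, k ≠ i → k ≠ j → pderiv k q = 0) (hκ : ∀ α, coeff α q ≠ 0 → α i + α j = κ)
    (hΦ : Phi i j μ ν q = 0)
    (hv : ∀ I J : ℕ, I ≠ 0 → J ≠ 0 → ((μ : ℤ) * (1 - I - J) + ν * (I + J) : ℤ) ≠ 0)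
    (hl : ∀ J : ℕ, 2 ≤ J → ((μ : ℤ) * (J - 1) - ν * J : ℤ) ≠ 0) :
    ∃ u : Fin n → K, u ≠ 0 ∧ (∀ k, k ≠ i → k ≠ j → u k = 0) ∧ dirD u q = 0 := by
  classical
  by_cases hj0 : pderiv j q = 0
  · exact ⟨Pi.single j 1, by simp, fun k _ hk => by simp [hk], by rw [dirD_single, hj0]⟩
  -- The monomials of highest degree in `xⱼ` form a vertex, so `xⱼ ^ κ` occurs in `q`.
  have hpow : (pderiv j)^[κ] q ≠ 0 := by
    have hne : q.support.Nonempty := by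
      rw [support_nonempty]
      rintro rfl
      simp at hj0
    obtain ⟨α, hα, hmax⟩ := q.support.exists_max_image (fun α => α j) hne
    have hαJ : α j ≠ 0 := by
      intro h0
      refine hj0 (pderiv_eq_zero_iff.2 fun β hβ => ?_)
      have := hmax β (mem_support_iff.2 hβ)
      omega
    by_cases hI : α i = 0
    · intro h0
      have h1 := pderiv_iterate_eq_zero_iff.1 h0 α (mem_support_iff.1 hα)
      have := hκ α (mem_support_iff.1 hα)
      omega
    · exfalso
      have hle : WtLE (Pi.single j 1) (α j) q := fun β hβ => by
        rw [wt_pi_single]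
        have := hmax β (mem_support_iff.2 hβ)
        simp only [one_mul]
        exact_mod_cast this
      have hL := hle.lead
      have hb : ∀ β, coeff β (part (fun β => wt (Pi.single j 1) β = (α j : ℚ)) q) ≠ 0 →
          coeff β q ≠ 0 ∧ β j = α j := by
        intro β hβ
        have h1 := hL.1 β hβ
        rw [wt_pi_single, one_mul] at h1
        rw [coeff_part] at hβ
        exact ⟨fun h => hβ (by simp [h]), by exact_mod_cast h1⟩
      refine hv (α i) (α j) hI hαJ (Phi_vertex hij (I := α i) (J := α j) ?_
        (Phi_lead_eq_zero hL (c := 0) (by simpa using hΦ) (Or.inl rfl)) (fun β hβ => ?_)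
        (fun β hβ => (hb β hβ).2) hI hαJ)
      · intro h0
        have := congrArg (coeff α) h0
        rw [coeff_part, if_pos (by rw [wt_pi_single, one_mul])] at this
        exact mem_support_iff.1 hα (by simpa using this)
      · have h1 := hκ β (hb β hβ).1
        have h2 := hκ α (mem_support_iff.1 hα)
        have h3 := (hb β hβ).2
        omega
  have hsingle : ∀ p : MvPolynomial (Fin n) K, (∀ k, k ≠ i → k ≠ j → pderiv k p = 0) →
      ∀ (α : Fin n →₀ ℕ), coeff α p ≠ 0 → α i = 0 → α = Finsupp.single j (α j) := by
    intro p hp α hα h0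
    ext k
    by_cases hkj : k = j
    · subst hkj; simp
    · rw [Finsupp.single_eq_of_ne hkj]
      by_cases hki : k = i
      · rw [hki, h0]
      · exact pderiv_eq_zero_iff.1 (hp k hki hkj) α hα
  have hc : coeff (Finsupp.single j κ) q ≠ 0 := by
    by_contra h0
    apply hpow
    rw [pderiv_iterate_eq_zero_iff]
    intro α hα
    by_contra h1
    have h2 := hκ α hα
    have h3 := hsingle q hq α hα (by omega)
    rw [show α j = κ by omega] at h3
    rw [h3] at hα
    exact hα h0
  have hκ0 : κ ≠ 0 := by
    rintro rfl
    refine hj0 (pderiv_eq_zero_iff.2 fun α hα => ?_)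
    have := hκ α hα
    omega
  -- A shear removes the monomial `xᵢ xⱼ ^ (κ - 1)`.
  set c₁ := coeff (Finsupp.single i 1 + Finsupp.single j (κ - 1)) q with hc₁
  set θ : K := - (c₁ / ((κ : K) * coeff (Finsupp.single j κ) q)) with hθ
  set T := Matrix.transvection j i θ with hT
  set q' := linSubst q T with hq'
  have hq'k : ∀ k, k ≠ i → k ≠ j → pderiv k q' = 0 := fun k hki hkj => by
    rw [hq', pderiv_shear_of_ne hki, hq k hki hkj, linSubst_zero]
  have hΦ' : Phi i j μ ν q' = 0 := by rw [hq', Phi_shear hij, hΦ, linSubst_zero]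
  have hκ' : ∀ α, coeff α q' ≠ 0 → α i + α j = κ := by
    have h1 : WtEq (Pi.single i 1 + Pi.single j 1) κ q := fun α hα => by
      rw [wt_pair, one_mul, one_mul]
      exact_mod_cast hκ α hα
    have h2 : WtEq (Pi.single i 1 + Pi.single j 1) κ q' := h1.linSubst fun k l hkl => by
      rcases transvection_ne_zero hkl with rfl | ⟨rfl, rfl⟩
      · rfl
      · simp [hij, hij.symm]
    intro α hα
    have := h2 α hα
    rw [wt_pair, one_mul, one_mul] at this
    exact_mod_cast this
  set p := pderiv i q + C θ * pderiv j q with hp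
  have hpi : pderiv i q' = linSubst p T := pderiv_shear_same j i θ q
  have hpw : WtLE (Pi.single i (-1)) (-1) p := by
    intro α hα
    rw [wt_pi_single]
    have h1 : α i ≠ 0 := by
      intro h0
      have hpk : ∀ k, k ≠ i → k ≠ j → pderiv k p = 0 := fun k hki hkj => by
        rw [hp, map_add, pderiv_C_mul, pderiv_comm' k i, pderiv_comm' k j, hq k hki hkj]
        simp
      have h2 := hsingle p hpk α hα h0
      have h3 : α j = κ - 1 := by
        rw [hp] at hα
        rcases coeff_add_ne hα with h | h
        · rw [coeff_pderiv] at h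
          have := hκ _ (left_ne_zero_of_mul h)
          simp [hij.symm] at this
          omega
        · rw [coeff_C_mul, coeff_pderiv] at h
          have := hκ _ (left_ne_zero_of_mul (right_ne_zero_of_mul h))
          simp [hij] at this
          omega
      rw [h3] at h2
      apply hα
      rw [h2, hp, coeff_add, coeff_C_mul, coeff_pderiv, coeff_pderiv, ← Finsupp.single_add,
        Nat.sub_add_cancel (Nat.one_le_iff_ne_zero.2 hκ0), add_comm (Finsupp.single j (κ - 1)), ← hc₁]
      have hκK : (κ : K) ≠ 0 := Nat.cast_ne_zero.2 hκ0
      have : ((κ - 1 : ℕ) : K) + 1 = κ := by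
        rw [← Nat.cast_add_one, Nat.sub_add_cancel (Nat.one_le_iff_ne_zero.2 hκ0)]
      rw [Finsupp.single_eq_of_ne hij, Finsupp.single_eq_same, this, hθ]
      field_simp
      simp
    have : (1 : ℚ) ≤ α i := by exact_mod_cast Nat.one_le_iff_ne_zero.2 h1
    linarith
  have hpw' : WtLE (Pi.single i (-1)) (-1) (pderiv i q') := by
    rw [hpi]
    refine hpw.linSubst fun k l hkl => ?_
    rcases transvection_ne_zero hkl with rfl | ⟨rfl, rfl⟩
    · rfl
    · simp [hij.symm]
  have htwo : ∀ α, coeff α q' ≠ 0 → α i ≠ 0 → 2 ≤ α i := by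
    intro α hα h0
    have := hpw' (α - Finsupp.single i 1) (by
      rw [coeff_pderiv_pred h0]
      exact mul_ne_zero hα (Nat.cast_ne_zero.2 h0))
    rw [wt_pi_single] at this
    have h2 : (1 : ℚ) ≤ ((α - Finsupp.single i 1 : Fin n →₀ ℕ) i : ℕ) := by linarith
    have h3 : 1 ≤ (α - Finsupp.single i 1 : Fin n →₀ ℕ) i := by exact_mod_cast h2
    simp at h3
    omega
  have hu : ∃ u : Fin n → K, u ≠ 0 ∧ (∀ k, k ≠ i → k ≠ j → u k = 0) ∧ dirD u q = p := by
    refine ⟨Pi.single i 1 + θ • Pi.single j 1, ?_, ?_, ?_⟩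
    · intro h
      have := congrFun h i
      simp [hij] at this
    · intro k hki hkj
      simp [hki, hkj]
    · rw [dirD_add, dirD_smul, dirD_single, dirD_single]
  obtain ⟨u, hu0, huk, hup⟩ := hu
  refine ⟨u, hu0, huk, ?_⟩
  rw [hup]
  have hinj : Function.Injective (fun f : MvPolynomial (Fin n) K => linSubst f T) :=
    linSubst_injective (S := Matrix.transvection j i (-θ)) (by
      rw [hT, Matrix.transvection_mul_transvection_same _ _ hij.symm]; simp)
  apply hinj
  simp only [linSubst_zero, ← hpi]
  -- Otherwise the lowest terms in `xᵢ`, of order at least two, contradict the equation.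
  by_contra hne
  have hSne : (q'.support.filter fun α => α i ≠ 0).Nonempty := by
    by_contra hemp
    rw [Finset.not_nonempty_iff_eq_empty] at hemp
    refine hne (pderiv_eq_zero_iff.2 fun α hα => ?_)
    by_contra h0
    have : α ∈ q'.support.filter fun α => α i ≠ 0 :=
      Finset.mem_filter.2 ⟨mem_support_iff.2 hα, h0⟩
    simp [hemp] at this
  obtain ⟨α₀, hα₀, hmin⟩ := Finset.exists_min_image _ (fun α => α i) hSne
  rw [Finset.mem_filter, mem_support_iff] at hα₀
  have hI2 := htwo α₀ hα₀.1 hα₀.2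
  have hlow : ∀ α, coeff α q' ≠ 0 → α i ≠ 0 → α₀ i ≤ α i := fun α hα h0 =>
    hmin α (Finset.mem_filter.2 ⟨mem_support_iff.2 hα, h0⟩)
  set w : Fin n → ℚ := Pi.single i (-1) with hw
  have hwt : ∀ α, wt w α = - α i := fun α => by rw [hw, wt_pi_single]; ring
  have hLE : WtLE w 0 q' := fun α _ => by rw [hwt]; simp
  have hL := hLE.lead
  set b := part (fun α => wt w α = 0) q' with hb
  have hbi : ∀ α, coeff α b ≠ 0 → α i = 0 := fun α hα => by
    have := hL.1 α hα
    rw [hwt] at this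
    simpa using this
  have hbq : ∀ α, coeff α b ≠ 0 → coeff α q' ≠ 0 := fun α hα h => by
    rw [hb, coeff_part, h] at hα
    simp at hα
  have hbj : ∀ α, coeff α b ≠ 0 → α j = κ := fun α hα => by
    have h1 := hbi α hα
    have h2 := hκ' α (hbq α hα)
    omega
  have hb0 : b ≠ 0 := by
    intro hb0
    have h1 : (pderiv j)^[κ] q' ≠ 0 := by
      rw [← dirD_single, hq', dirD_iterate_linSubst, transvection_mulVec_single_of_ne hij.symm,
        dirD_single]
      intro h
      exact hpow (hinj (by simpa using h))
    apply h1
    rw [pderiv_iterate_eq_zero_iff]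
    intro α hα
    have h2 := hκ' α hα
    by_contra h3
    have h4 : coeff α b = 0 := by rw [hb0]; simp
    rw [hb, coeff_part, hwt, if_pos (by simp; omega)] at h4
    exact hα h4
  set U := part (fun α => wt w α = - (α₀ i : ℚ)) q' with hU
  have hUL : Lead w (-(α₀ i : ℚ) - w i) (pderiv i q') (pderiv i U) := by
    refine lead_pderiv_of_coeff (fun α hα h0 => ?_) (fun α hα => ?_) fun α _ hα => ?_
    · rw [hwt]
      have : (α₀ i : ℚ) ≤ α i := by exact_mod_cast hlow α hα h0
      linarith
    · rw [hU, coeff_part] at hα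
      by_contra h
      simp [h] at hα
    · rw [hU, coeff_part, if_pos hα]
  have hα₀Q : (2 : ℚ) ≤ α₀ i := by exact_mod_cast hI2
  have hκ2 : 2 ≤ κ := by
    have := hκ' α₀ hα₀.1
    omega
  have h0 := Phi_second_order (c := 0) (by simpa using hΦ') hL hb0
    (X_mul_pderiv_of_forall hbj) hUL (by linarith) (Or.inl rfl) hκ0 (hl κ hκ2)
  rw [show pderiv i (pderiv i U) = (pderiv i)^[2] U from rfl, pderiv_iterate_eq_zero_iff] at h0
  have := h0 α₀ (by rw [hU, coeff_part, if_pos (hwt α₀)]; exact hα₀.1)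
  omega

/-- If the top form of `a` is a multiple of `xᵢ ^ κ`, then `Φ(a) = c a` bounds the degree of `a` in
`xⱼ`. Indeed, the highest power `xⱼ ^ J` occurs with a constant coefficient, and `J < κ` yields a
weight for which `xⱼ ^ J` dominates, followed by terms of degree at least two in `xᵢ`. -/
lemma pderiv_iterate_eq_zero_of_top [CharZero K] (hij : i ≠ j) {a : MvPolynomial (Fin n) K} {c : K}
    {J₀ κ : ℕ} (hΦ : Phi i j μ ν a = C c * a)
    (hJ₀ : 1 ≤ J₀) (hc : c = 0 ∨ 2 ≤ J₀)
    (hv : ∀ I J : ℕ, I ≠ 0 → J ≠ 0 → ((μ : ℤ) * (1 - I - J) + ν * (I + J) : ℤ) ≠ 0)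
    (hl : ∀ J : ℕ, J₀ ≤ J → ((μ : ℤ) * (J - 1) - ν * J : ℤ) ≠ 0)
    (hle : ∀ α, coeff α a ≠ 0 → α i + α j ≤ κ)
    (hex : ∃ α, coeff α a ≠ 0 ∧ α i + α j = κ)
    (htop : ∀ α, coeff α a ≠ 0 → α i + α j = κ → α j = 0) : (pderiv j)^[J₀] a = 0 := by
  classical
  rw [pderiv_iterate_eq_zero_iff]
  by_contra! hcon
  obtain ⟨α₁, hα₁, hα₁J⟩ := hcon
  obtain ⟨α₂, hα₂, hmax⟩ := a.support.exists_max_image (fun α => α j)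
    ⟨α₁, mem_support_iff.2 hα₁⟩
  rw [mem_support_iff] at hα₂
  set J := α₂ j with hJ
  have hJJ : J₀ ≤ J := hα₁J.trans (hmax α₁ (mem_support_iff.2 hα₁))
  have hmax' : ∀ α, coeff α a ≠ 0 → α j ≤ J := fun α hα => hmax α (mem_support_iff.2 hα)
  -- The coefficient of `xⱼ ^ J` is constant, as otherwise a vertex appears.
  have hconst : ∀ α, coeff α a ≠ 0 → α j = J → α i = 0 := by
    have hLE : WtLE (Pi.single j 1) J a := fun α hα => by
      rw [wt_pi_single, one_mul]
      exact_mod_cast hmax' α hα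
    have hL := hLE.lead
    set b := part (fun α => wt (Pi.single j 1) α = (J : ℚ)) a with hb
    have hbc : ∀ α, coeff α b = if α j = J then coeff α a else 0 := fun α => by
      rw [hb, coeff_part, wt_pi_single, one_mul]
      simp
    have hΦb : Phi i j μ ν b = 0 := by
      refine Phi_lead_eq_zero hL hΦ (hc.imp id fun h => ?_)
      have : (2 : ℚ) ≤ J := by exact_mod_cast h.trans hJJ
      simp [hij]
      linarith
    intro α hα hαJ
    have hne : b.support.Nonempty := ⟨α, mem_support_iff.2 (by rw [hbc, if_pos hαJ]; exact hα)⟩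
    obtain ⟨β, hβ, hβmax⟩ := b.support.exists_max_image (fun α => α i) hne
    have hβle := hβmax α (mem_support_iff.2 (by rw [hbc, if_pos hαJ]; exact hα))
    by_contra hα0
    have hLE' : WtLE (Pi.single i 1) (β i) b := fun α hα => by
      rw [wt_pi_single, one_mul]
      exact_mod_cast hβmax α (mem_support_iff.2 hα)
    have hL' := hLE'.lead
    have hcf : ∀ γ, coeff γ (part (fun α => wt (Pi.single i 1) α = (β i : ℚ)) b) =
        if γ i = β i then coeff γ b else 0 := fun γ => by
      rw [coeff_part, wt_pi_single, one_mul]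
      simp
    refine hv (β i) J (by omega) (by omega) (Phi_vertex hij (I := β i) (J := J) ?_
        (Phi_lead_eq_zero hL' (c := 0) (by simpa using hΦb) (Or.inl rfl)) (fun γ hγ => ?_)
        (fun γ hγ => ?_) (by omega) (by omega))
    · intro h0
      have := congrArg (coeff β) h0
      rw [hcf, if_pos rfl] at this
      exact mem_support_iff.1 hβ (by simpa using this)
    · rw [hcf] at hγ
      by_contra h
      simp [h] at hγ
    · rw [hcf, hbc] at hγ
      by_contra h
      simp [h] at hγ
  obtain ⟨α₃, hα₃, hα₃κ⟩ := hex
  have hα₃j := htop α₃ hα₃ hα₃κ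
  have hJκ : J < κ := by
    have h1 := hle α₂ hα₂
    have h2 := hconst α₂ hα₂ rfl
    by_contra h
    have := htop α₂ hα₂ (by omega)
    omega
  obtain ⟨σ, ρ, hσ0, hσ1, hρ, ⟨α₀, hα₀, hα₀ρ⟩, hρ1, hρ2⟩ := exists_slope
    (a.support.filter fun α => α i ≠ 0) (fun α => α i) (fun α => α j) J (fun α hα => by
      rw [Finset.mem_filter, mem_support_iff] at hα
      refine ⟨Nat.one_le_iff_ne_zero.2 hα.2, lt_of_le_of_ne (hmax' α hα.1) fun h => ?_⟩
      exact hα.2 (hconst α hα.1 h))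
    ⟨α₃, by
      rw [Finset.mem_filter, mem_support_iff]
      exact ⟨hα₃, by omega⟩, by omega⟩
  rw [Finset.mem_filter, mem_support_iff] at hα₀
  set w : Fin n → ℚ := Pi.single i σ + Pi.single j 1 with hw
  have hwt : ∀ α, wt w α = σ * α i + α j := fun α => by rw [hw, wt_pair, one_mul]
  have hρ' : ∀ α, coeff α a ≠ 0 → α i ≠ 0 → wt w α ≤ ρ := fun α hα h0 => by
    rw [hwt]
    exact hρ α (Finset.mem_filter.2 ⟨mem_support_iff.2 hα, h0⟩)
  have hLE : WtLE w J a := fun α hα => by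
    by_cases h0 : α i = 0
    · rw [hwt, h0]
      have : (α j : ℚ) ≤ J := by exact_mod_cast hmax' α hα
      simpa using this
    · exact (hρ' α hα h0).trans hρ2.le
  have hL := hLE.lead
  set b := part (fun α => wt w α = (J : ℚ)) a with hb
  have hbj : ∀ α, coeff α b ≠ 0 → α j = J := by
    intro α hα
    have h1 := hL.1 α hα
    have h2 : coeff α a ≠ 0 := fun h => by
      rw [hb, coeff_part, h] at hα
      simp at hα
    by_cases h0 : α i = 0
    · rw [hwt, h0] at h1
      have h3 : (α j : ℚ) = J := by simpa using h1
      exact_mod_cast h3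
    · have := hρ' α h2 h0
      linarith
  have hb0 : b ≠ 0 := by
    intro h
    have := congrArg (coeff α₂) h
    rw [hb, coeff_part, if_pos (by rw [hwt, hconst α₂ hα₂ rfl]; simp [hJ])] at this
    exact hα₂ (by simpa using this)
  set U := part (fun α => wt w α = ρ) a with hU
  have hUL : Lead w (ρ - w i) (pderiv i a) (pderiv i U) := by
    refine lead_pderiv_of_coeff hρ' (fun α hα => ?_) fun α _ hα => by rw [hU, coeff_part, if_pos hα]
    by_contra h
    rw [hU, coeff_part, if_neg h] at hα
    exact hα rfl
  have h0 := Phi_second_order hΦ hL hb0 (X_mul_pderiv_of_forall hbj) hUL hρ2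
    (hc.imp id fun h => by
      have : (2 : ℚ) ≤ J := by exact_mod_cast h.trans hJJ
      simp [hw, hij, hij.symm]
      linarith) (by omega) (hl J hJJ)
  rw [show pderiv i (pderiv i U) = (pderiv i)^[2] U from rfl, pderiv_iterate_eq_zero_iff] at h0
  have h1 := h0 α₀ (by rw [hU, coeff_part, if_pos (by rw [hwt, hα₀ρ])]; exact hα₀.1)
  have h2 : α₀ i = 1 := by omega
  have h3 : α₀ j < J := lt_of_le_of_ne (hmax' α₀ hα₀.1) fun h => hα₀.2 (hconst α₀ hα₀.1 h)
  have h4 : (α₀ j : ℚ) + 1 ≤ J := by exact_mod_cast h3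
  simp only [h2] at hα₀ρ
  push_cast at hα₀ρ
  linarith

/-- A polynomial `a` in two variables `xᵢ, xⱼ` with `Φ(a) = c a` has degree less than `J₀` along
the lines of some direction in the `(xᵢ, xⱼ)`-plane.

By `hv`, the operator `Φ` does not vanish on monomials in both variables; by `hl`, a power `xⱼ ^ J`
that dominates `a` contributes with a nonzero factor to the leading form of `Φ(a)`. The pairs
`(μ, ν)` that occur are `(1, 0)` for the Hessian determinant, `(m - 1, m)` for the Hessian
determinant of `a z ^ m`, and `(0, 1)` for the curvature of the level curves. -/
lemma exists_dirD_iterate_eq_zero [CharZero K] (hij : i ≠ j) {a : MvPolynomial (Fin n) K} {c : K}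
    {J₀ : ℕ} (ha : ∀ k, k ≠ i → k ≠ j → pderiv k a = 0) (hΦ : Phi i j μ ν a = C c * a)
    (hJ₀ : 1 ≤ J₀) (hJ₀' : J₀ ≤ 2) (hc : c = 0 ∨ (2 ≤ J₀ ∧ ∃ α, coeff α a ≠ 0 ∧ 3 ≤ α i + α j))
    (hv : ∀ I J : ℕ, I ≠ 0 → J ≠ 0 → ((μ : ℤ) * (1 - I - J) + ν * (I + J) : ℤ) ≠ 0)
    (hl : ∀ J : ℕ, J₀ ≤ J → ((μ : ℤ) * (J - 1) - ν * J : ℤ) ≠ 0) :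
    ∃ u : Fin n → K, u ≠ 0 ∧ (∀ k, k ≠ i → k ≠ j → u k = 0) ∧ (dirD u)^[J₀] a = 0 := by
  classical
  have hsupp : ∀ k : Fin n, k ≠ i → k ≠ j → (Pi.single j (1 : K) : Fin n → K) k = 0 :=
    fun k _ hk => by simp [hk]
  by_cases ha0 : a = 0
  · exact ⟨Pi.single j 1, by simp, hsupp, by rw [ha0, iterate_map_zero]⟩
  obtain ⟨α₁, hα₁, hmax⟩ := a.support.exists_max_image (fun α => α i + α j) (support_nonempty.2 ha0)
  rw [mem_support_iff] at hα₁
  set κ := α₁ i + α₁ j with hκ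
  have hle : ∀ α, coeff α a ≠ 0 → α i + α j ≤ κ := fun α hα => hmax α (mem_support_iff.2 hα)
  set w : Fin n → ℚ := Pi.single i 1 + Pi.single j 1 with hw
  have hwt : ∀ α, wt w α = ((α i + α j : ℕ) : ℚ) := fun α => by
    rw [hw, wt_pair, one_mul, one_mul]
    push_cast
    rfl
  have hLE : WtLE w κ a := fun α hα => by
    rw [hwt]
    exact_mod_cast hle α hα
  have hL := hLE.lead
  set q := part (fun α => wt w α = (κ : ℚ)) a with hq
  have hqc : ∀ α, coeff α q = if α i + α j = κ then coeff α a else 0 := fun α => by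
    rw [hq, coeff_part, hwt]
    simp only [Nat.cast_inj]
  have hΦq : Phi i j μ ν q = 0 := by
    refine Phi_lead_eq_zero hL hΦ (hc.imp id ?_)
    rintro ⟨-, α, hα, hα3⟩
    have : (3 : ℚ) ≤ κ := by exact_mod_cast hα3.trans (hle α hα)
    simp [hw, hij, hij.symm]
    linarith
  obtain ⟨u, hu0, huk, hu⟩ := exists_dirD_eq_zero_of_form (κ := κ) hij (q := q) (fun k hki hkj => by
      rw [pderiv_eq_zero_iff]
      intro α hα
      refine pderiv_eq_zero_iff.1 (ha k hki hkj) α fun h => hα ?_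
      rw [hqc, h, ite_self]) (fun α hα => by
      by_contra h
      rw [hqc, if_neg h] at hα
      exact hα rfl) hΦq hv fun J hJ => hl J (by omega)
  have hc' : c = 0 ∨ 2 ≤ J₀ := hc.imp id fun h => h.1
  by_cases hui : u i = 0
  · have huj : u = u j • Pi.single j 1 := by
      ext k
      by_cases hkj : k = j
      · subst hkj; simp
      · by_cases hki : k = i
        · subst hki; simp [hui, hij]
        · simp [huk k hki hkj, hkj]
    have huj0 : u j ≠ 0 := fun h => hu0 (by rw [huj, h, zero_smul])
    rw [huj, dirD_smul, dirD_single] at hu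
    have hqj : pderiv j q = 0 := (mul_eq_zero.1 hu).resolve_left (by simpa using huj0)
    refine ⟨Pi.single j 1, by simp, hsupp, ?_⟩
    rw [dirD_single]
    refine pderiv_iterate_eq_zero_of_top hij hΦ hJ₀ hc' hv hl hle ⟨α₁, hα₁, rfl⟩
      fun α hα hακ => pderiv_eq_zero_iff.1 hqj α ?_
    rwa [hqc, if_pos hακ]
  · -- A shear turns `u` into a multiple of the `i`-th coordinate direction.
    set θ := u j / u i with hθ
    set T := Matrix.transvection j i θ with hT
    have hTe : T.mulVec (Pi.single i 1) = (u i)⁻¹ • u := by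
      rw [hT, transvection_mulVec_single_same]
      ext k
      by_cases hki : k = i
      · subst hki; simp [hij, hui]
      · by_cases hkj : k = j
        · subst hkj; simp [hki, hθ]; field_simp
        · simp [hki, hkj, huk k hki hkj]
    refine ⟨(u i)⁻¹ • u, smul_ne_zero (inv_ne_zero hui) hu0, fun k hki hkj => by
      simp [huk k hki hkj], ?_⟩
    have hTw : ∀ k l, T k l ≠ 0 → w k = w l := fun k l hkl => by
      rcases transvection_ne_zero hkl with rfl | ⟨rfl, rfl⟩
      · rfl
      · simp [hw, hij, hij.symm]
    have hL' := hL.linSubst hTw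
    have hinj : Function.Injective (fun f : MvPolynomial (Fin n) K => linSubst f T) :=
      linSubst_injective (S := Matrix.transvection j i (-θ)) (by
        rw [hT, Matrix.transvection_mul_transvection_same _ _ hij.symm]; simp)
    have hqi : pderiv i (linSubst q T) = 0 := by
      rw [← dirD_single, dirD_linSubst, hTe, dirD_smul, hu]
      simp
    apply hinj
    simp only [linSubst_zero]
    rw [← hTe, ← dirD_iterate_linSubst, dirD_single]
    refine pderiv_iterate_eq_zero_of_top (μ := μ) (ν := ν) (c := c) (κ := κ) hij.symm ?_ hJ₀ hc'
      (fun I J hI hJ => by have := hv J I hJ hI; intro h; apply this; linarith) hl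
      (fun α hα => ?_) ?_ fun α hα hακ => ?_
    · rw [Phi_symm, Phi_shear hij, hΦ]
      simp [hT]
    · have := hL'.le α hα
      rw [hwt] at this
      rw [add_comm]
      exact_mod_cast this
    · by_contra! hcon
      have : linSubst q T = 0 := by
        ext α
        rw [coeff_zero]
        by_contra hα
        have h1 := hL'.1 α hα
        rw [hL'.coeff_eq h1] at hα
        rw [hwt] at h1
        exact hcon α hα (by rw [add_comm]; exact_mod_cast h1)
      have h2 : q = 0 := hinj (by simpa using this)
      have h3 := congrArg (coeff α₁) h2
      rw [hqc, if_pos rfl] at h3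
      exact hα₁ (by simpa using h3)
    · refine pderiv_eq_zero_iff.1 hqi α ?_
      rw [hL'.coeff_eq (by rw [hwt, add_comm, hακ])]
      exact hα

/-- A solution of `a_uu = 0` with vanishing Hessian determinant has a constant derivative in the
direction `u`. -/
lemma pderiv_dirD_eq_zero_of_hess2 {a : MvPolynomial (Fin n) K} {u : Fin n → K} (hij : i ≠ j)
    (huk : ∀ k, k ≠ i → k ≠ j → u k = 0) (ha : ∀ k, k ≠ i → k ≠ j → pderiv k a = 0)
    (h0 : hess2 i j a = 0) (hu : dirD u (dirD u a) = 0) (k : Fin n) :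
    pderiv k (dirD u a) = 0 := by
  have hD : ∀ p, dirD u p = C (u i) * pderiv i p + C (u j) * pderiv j p := by
    intro p
    rw [dirD_apply, ← Finset.sum_subset (Finset.subset_univ {i, j}), Finset.sum_pair hij]
    intro k _ hk
    simp only [Finset.mem_insert, Finset.mem_singleton, not_or] at hk
    simp [huk k hk.1 hk.2]
  simp only [hD, map_add, pderiv_C_mul, hess2] at hu h0 ⊢
  rw [pderiv_comm' j i] at hu
  by_cases hki : k = i
  · subst hki
    refine pow_eq_zero_iff (two_ne_zero) |>.1 ?_
    linear_combination pderiv k (pderiv k a) * hu - C (u j) ^ 2 * h0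
  by_cases hkj : k = j
  · subst hkj
    rw [pderiv_comm' k i]
    refine pow_eq_zero_iff (two_ne_zero) |>.1 ?_
    linear_combination pderiv k (pderiv k a) * hu - C (u i) ^ 2 * h0
  · rw [pderiv_comm' k i, pderiv_comm' k j, ha k hki hkj]
    simp

end BinaryMain

/-! ### Lines along which the gradient is constant -/

section Translate

variable {ι : Type*} {K : Type*} [Field K]

/-- The polynomial `g(x + tV(x))` in `t`, for a vector `V` of polynomials. -/
def translate (V : ι → MvPolynomial ι K) :
    MvPolynomial ι K →ₐ[K] Polynomial (MvPolynomial ι K) :=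
  aeval fun i => Polynomial.C (X i) + Polynomial.C (V i) * Polynomial.X

variable (V : ι → MvPolynomial ι K)

lemma translate_X (i : ι) :
    translate V (X i) = Polynomial.C (X i) + Polynomial.C (V i) * Polynomial.X := aeval_X _ _

lemma translate_C (c : K) : translate V (C c) = Polynomial.C (C c) := by
  simp [translate]

lemma translate_coeff_zero (g : MvPolynomial ι K) : (translate V g).coeff 0 = g := by
  induction g using MvPolynomial.induction_on with
  | C a => simp
  | add p q hp hq => simp [hp, hq]
  | mul_X p i hp => simp [hp, translate_X, Polynomial.mul_coeff_zero]

variable [Fintype ι]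

lemma translate_derivative (g : MvPolynomial ι K) :
    Polynomial.derivative (translate V g) =
      ∑ i, Polynomial.C (V i) * translate V (pderiv i g) := by
  classical
  induction g using MvPolynomial.induction_on with
  | C a => simp
  | add p q hp hq => simp [hp, hq, mul_add, Finset.sum_add_distrib]
  | mul_X p i hp =>
    have hX : Polynomial.derivative (translate V (X i)) = Polynomial.C (V i) := by
      simp [translate_X]
    simp only [map_mul, Polynomial.derivative_mul, hp, hX, Derivation.leibniz, smul_eq_mul,
      map_add, mul_add, Finset.sum_add_distrib]
    rw [add_comm]
    congr 1
    · simp only [pderiv_X, Pi.single_apply, apply_ite (translate V), map_one, map_zero, mul_ite,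
        mul_one, mul_zero]
      simp [mul_comm]
    · rw [Finset.sum_mul]
      exact Finset.sum_congr rfl fun k _ => by ring

/-- The coefficientwise partial derivative of `g(x + tV(x))`. -/
lemma translate_pderiv_coeff (g : MvPolynomial ι K) (k : ι) (r : ℕ) :
    pderiv k ((translate V g).coeff r) = (translate V (pderiv k g)).coeff r +
      (∑ i, Polynomial.C (pderiv k (V i)) * (translate V (pderiv i g) * Polynomial.X)).coeff r := by
  classical
  induction g using MvPolynomial.induction_on generalizing r with
  | C a =>
    simp only [translate_C, pderiv_C, map_zero, zero_mul, mul_zero, Finset.sum_const_zero,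
      Polynomial.coeff_zero, add_zero, Polynomial.coeff_C]
    split_ifs <;> simp
  | add p q hp hq =>
    simp only [map_add, Polynomial.coeff_add, hp, hq, mul_add, add_mul, Finset.sum_add_distrib]
    ring
  | mul_X p i hp =>
    have e1 : ∑ l, Polynomial.C (pderiv k (V l)) *
        (translate V (pderiv l (p * X i)) * Polynomial.X) =
        (∑ l, Polynomial.C (pderiv k (V l)) * (translate V (pderiv l p) * Polynomial.X)) *
          translate V (X i) +
        translate V p * (Polynomial.C (pderiv k (V i)) * Polynomial.X) := by
      simp only [Derivation.leibniz, smul_eq_mul, map_add, map_mul, mul_add, add_mul,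
        Finset.sum_add_distrib]
      rw [add_comm]
      congr 1
      · rw [Finset.sum_mul]
        exact Finset.sum_congr rfl fun l _ => by ring
      · simp [pderiv_X, Pi.single_apply, apply_ite (translate V)]
        ring
    have e2 : translate V (pderiv k (p * X i)) =
        translate V (pderiv k p) * translate V (X i) +
          translate V p * Polynomial.C (if i = k then 1 else 0) := by
      rw [Derivation.leibniz, smul_eq_mul, smul_eq_mul, map_add, map_mul, map_mul, add_comm,
        mul_comm (translate V (X i))]
      congr 2
      simp [pderiv_X, Pi.single_apply, apply_ite (translate V)]
    rw [e1, e2, map_mul, translate_X]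
    have hX : pderiv k (X i : MvPolynomial ι K) = if i = k then 1 else 0 := by
      rw [pderiv_X, Pi.single_apply]
    rcases r with _ | r
    · have := hp 0
      simp only [mul_add, Polynomial.coeff_add, Polynomial.mul_coeff_zero, ← mul_assoc,
        Polynomial.coeff_X_zero, mul_zero, add_zero, Polynomial.coeff_C_zero,
        Polynomial.finsetSum_coeff, Finset.sum_const_zero, Derivation.leibniz, smul_eq_mul, zero_mul,
        hX] at this ⊢
      rw [this]
      ring
    · have h1 := hp (r + 1)
      have h2 := hp r
      simp only [mul_add, Polynomial.coeff_add, Polynomial.coeff_mul_C, ← mul_assoc, add_mul,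
        Polynomial.coeff_mul_X, Derivation.leibniz, smul_eq_mul, map_add, hX, h1, h2] at *
      ring

lemma coeff_translate_succ (g : MvPolynomial ι K) (r : ℕ) :
    (translate V g).coeff (r + 1) * ((r : MvPolynomial ι K) + 1) =
      ∑ i, V i * (translate V (pderiv i g)).coeff r := by
  have := congrArg (fun p => Polynomial.coeff p r) (translate_derivative V g)
  simpa [Polynomial.coeff_derivative, Polynomial.finsetSum_coeff, Polynomial.coeff_C_mul] using this

variable {V}

lemma coeff_sum_C_mul_X (a : ι → MvPolynomial ι K) (p : ι → Polynomial (MvPolynomial ι K)) (r : ℕ) :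
    (∑ i, Polynomial.C (a i) * (p i * Polynomial.X)).coeff (r + 1) =
      ∑ i, a i * (p i).coeff r := by
  simp [Polynomial.finsetSum_coeff, Polynomial.coeff_C_mul, Polynomial.coeff_mul_X]

lemma sum_mul_neg_sum {R : Type*} [CommRing R] (v a : ι → R) (b : ι → ι → R) :
    ∑ j, v j * -∑ i, a i * b i j = -∑ i, a i * ∑ j, v j * b i j := by
  simp only [mul_neg, Finset.sum_neg_distrib, Finset.mul_sum]
  rw [Finset.sum_comm]
  exact congrArg Neg.neg
    (Finset.sum_congr rfl fun i _ => Finset.sum_congr rfl fun j _ => mul_left_comm _ _ _)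

/-- If `V` is annihilated by the Hessian matrix of `f`, then the gradient of `f` is constant along
the lines `x + tV(x)`. -/
lemma translate_pderiv_eq [CharZero K] {f : MvPolynomial ι K}
    (hV : ∀ j, ∑ i, V i * pderiv i (pderiv j f) = 0) (r : ℕ) :
    ∀ j, (translate V (pderiv j f)).coeff (r + 1) = 0 := by
  have hne : ∀ r : ℕ, ((r : MvPolynomial ι K) + 1) ≠ 0 := fun r => Nat.cast_add_one_ne_zero r
  induction r with
  | zero =>
    intro j
    have h := coeff_translate_succ V (pderiv j f) 0
    simp only [translate_coeff_zero, hV, mul_eq_zero] at h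
    exact h.resolve_right (hne 0)
  | succ r ih =>
    intro k
    have h := coeff_translate_succ V (pderiv k f) (r + 1)
    have h1 : ∀ j, (translate V (pderiv j (pderiv k f))).coeff (r + 1) =
        - ∑ i, pderiv k (V i) * (translate V (pderiv j (pderiv i f))).coeff r := by
      intro j
      have h2 := translate_pderiv_coeff V (pderiv j f) k (r + 1)
      rw [ih j, map_zero, coeff_sum_C_mul_X] at h2
      have e3 : ∑ i, pderiv k (V i) * (translate V (pderiv j (pderiv i f))).coeff r =
          ∑ i, pderiv k (V i) * (translate V (pderiv i (pderiv j f))).coeff r :=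
        Finset.sum_congr rfl fun i _ =>
          congrArg (fun p => pderiv k (V i) * (translate V p).coeff r) (pderiv_comm' j i f)
      have e4 := congrArg (fun p => (translate V p).coeff (r + 1)) (pderiv_comm' j k f)
      refine Eq.trans e4 (eq_neg_of_add_eq_zero_left ?_)
      rw [e3]
      exact h2.symm
    have h3 : ∑ j, V j * (translate V (pderiv j (pderiv k f))).coeff (r + 1) = 0 := by
      have e : ∑ j, V j * (translate V (pderiv j (pderiv k f))).coeff (r + 1) =
          - ∑ i, pderiv k (V i) * ∑ j, V j * (translate V (pderiv j (pderiv i f))).coeff r := by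
        rw [Finset.sum_congr rfl fun j _ => congrArg (V j * ·) (h1 j)]
        exact sum_mul_neg_sum _ _ _
      rw [e]
      simp only [← coeff_translate_succ, ih, zero_mul, mul_zero, Finset.sum_const_zero, neg_zero]
    rw [h3] at h
    exact (mul_eq_zero.1 h).resolve_right (hne _)

/-- The coefficient of `t ^ N` in `g(x + tV)` is the value at `V` of the part of degree `N`. -/
lemma coeff_translate_of_lead {g G : MvPolynomial ι K} {N : ℕ}
    (h : Lead (fun _ => 1) N g G) : (translate V g).coeff N = aeval V G := by
  have hmon : ∀ (α : ι →₀ ℕ) (c : K),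
      translate V (monomial α c) = Polynomial.C (C c) *
        ∏ i, (Polynomial.C (X i) + Polynomial.C (V i) * Polynomial.X) ^ α i := by
    intro α c
    rw [translate, aeval_monomial, Finsupp.prod_fintype _ _ (by simp)]
    simp [Polynomial.algebraMap_apply, algebraMap_eq]
  have hdeg : ∀ i, (Polynomial.C (X i) + Polynomial.C (V i) * Polynomial.X).natDegree ≤ 1 := by
    intro i
    rw [add_comm]
    exact Polynomial.natDegree_linear_le
  have hpow : ∀ (α : ι →₀ ℕ) i, ((Polynomial.C (X i) + Polynomial.C (V i) * Polynomial.X) ^ α i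
      : Polynomial (MvPolynomial ι K)).natDegree ≤ α i := fun α i =>
    Polynomial.natDegree_pow_le.trans ((Nat.mul_le_mul_left _ (hdeg i)).trans (by simp))
  have hwt : ∀ α : ι →₀ ℕ, wt (fun _ => 1) α = ((∑ i, α i : ℕ) : ℚ) := by
    intro α
    simp [wt]
  have hle : ∀ α : ι →₀ ℕ, (∏ i, (Polynomial.C (X i) + Polynomial.C (V i) * Polynomial.X) ^ α i
      : Polynomial (MvPolynomial ι K)).natDegree ≤ ∑ i, α i := by
    intro α
    exact (Polynomial.natDegree_prod_le _ _).trans (Finset.sum_le_sum fun i _ => hpow α i)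
  have hcoeff : ∀ α : ι →₀ ℕ, (∏ i, (Polynomial.C (X i) + Polynomial.C (V i) * Polynomial.X) ^ α i
      : Polynomial (MvPolynomial ι K)).coeff (∑ i, α i) = ∏ i, V i ^ α i := by
    intro α
    classical
    refine Finset.induction_on Finset.univ (by simp) fun i s his ih => ?_
    rw [Finset.prod_insert his, Finset.sum_insert his, Finset.prod_insert his,
      Polynomial.coeff_mul_add_eq_of_natDegree_le (hpow α i)
        ((Polynomial.natDegree_prod_le _ _).trans (Finset.sum_le_sum fun i _ => hpow α i)), ih]
    have h := Polynomial.coeff_pow_of_natDegree_le (hdeg i) (m := α i)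
    rw [mul_one] at h
    rw [h]
    simp
  have h1 : ∀ p : MvPolynomial ι K, WtLT (fun _ => 1) N p → (translate V p).coeff N = 0 := by
    intro p hp
    rw [p.as_sum, map_sum, Polynomial.finsetSum_coeff]
    refine Finset.sum_eq_zero fun α hα => ?_
    rw [hmon, Polynomial.coeff_C_mul, Polynomial.coeff_eq_zero_of_natDegree_lt, mul_zero]
    have := hp α (mem_support_iff.1 hα)
    rw [hwt] at this
    exact (hle α).trans_lt (by exact_mod_cast this)
  have h2 : (translate V G).coeff N = aeval V G := by
    conv_lhs => rw [G.as_sum]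
    conv_rhs => rw [G.as_sum]
    rw [map_sum, map_sum, Polynomial.finsetSum_coeff]
    refine Finset.sum_congr rfl fun α hα => ?_
    have h3 := h.1 α (mem_support_iff.1 hα)
    rw [hwt] at h3
    have h4 : N = ∑ i, α i := by exact_mod_cast h3.symm
    rw [hmon, Polynomial.coeff_C_mul, aeval_monomial, Finsupp.prod_fintype _ _ (by simp), h4,
      hcoeff]
    simp [algebraMap_eq]
  have h3 := h1 _ h.2
  rw [map_sub, Polynomial.coeff_sub, h2] at h3
  exact sub_eq_zero.1 h3

end Translate

/-! ### Zeros of leading forms of the partial derivatives -/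

section ZerosOfLead

variable {ι : Type*} [Fintype ι] {K : Type*} [Field K]

/-- A vector `V` annihilated by the Hessian matrix of `f` is a zero of the form of highest degree of
every partial derivative of `f` of positive degree. -/
lemma aeval_lead_pderiv_eq_zero [CharZero K] {f G : MvPolynomial ι K} {V : ι → MvPolynomial ι K}
    (hV : ∀ j, ∑ i, V i * pderiv i (pderiv j f) = 0) {j : ι} {N : ℕ} (hN : N ≠ 0)
    (hG : Lead (fun _ => 1) N (pderiv j f) G) : aeval V G = 0 := by
  obtain ⟨r, rfl⟩ := Nat.exists_eq_succ_of_ne_zero hN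
  rw [← coeff_translate_of_lead hG]
  exact translate_pderiv_eq hV r j

/-- The `N`-th derivative in the direction `e` of a polynomial of degree `N` is `N!` times the value
of its top form at `e`. -/
lemma dirD_iterate_eq_of_lead {n : ℕ} {f G : MvPolynomial (Fin n) K} {N : ℕ}
    (hG : Lead (fun _ => 1) N f G) (e : Fin n → K) :
    (dirD e)^[N] f = C (N.factorial * eval e G) := by
  have key : ∀ (r : ℕ) (g : MvPolynomial (Fin n) K),
      (dirD e)^[r] g = r.factorial * (translate (fun i => C (e i)) g).coeff r := by
    intro r
    induction r with
    | zero => intro g; simp [translate_coeff_zero]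
    | succ r ih =>
      intro g
      have h := coeff_translate_succ (fun i => C (e i)) g r
      have h2 : (translate (fun i => C (e i)) (dirD e g)).coeff r =
          ∑ i, C (e i) * (translate (fun i => C (e i)) (pderiv i g)).coeff r := by
        rw [dirD_apply, map_sum, Polynomial.finsetSum_coeff]
        simp only [map_mul, translate_C, Polynomial.coeff_C_mul]
      rw [Function.iterate_succ_apply, ih, h2, ← h, Nat.factorial_succ]
      push_cast
      ring
  rw [key, coeff_translate_of_lead hG, natCast_eq_C, map_mul]
  congr 1
  clear hG
  induction G using MvPolynomial.induction_on with
  | C a => simp [algebraMap_eq]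
  | add p q hp hq => simp_all
  | mul_X p i hp => simp_all

end ZerosOfLead

/-! ### Coordinate changes and dehomogenization -/

section Coordinates

variable {K : Type*} [Field K] {n : ℕ}

/-- An invertible matrix with prescribed `j`-th column that only mixes the coordinates in `s`. -/
lemma exists_matrix_mulVec_single {e : Fin n → K} (he : e ≠ 0) {s : Set (Fin n)} {j : Fin n}
    (hj : j ∈ s) (hs : ∀ k, k ∉ s → e k = 0) :
    ∃ T S : Matrix (Fin n) (Fin n) K, T * S = 1 ∧ T.mulVec (Pi.single j 1) = e ∧
      (∀ k, k ∉ s → T.mulVec (Pi.single k 1) = Pi.single k 1) ∧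
      ∀ a b, T a b ≠ 0 → a = b ∨ (a ∈ s ∧ b ∈ s) := by
  obtain ⟨k, hk⟩ := Function.ne_iff.1 he
  have hks : k ∈ s := by
    by_contra h
    exact hk (hs k h)
  set M : Matrix (Fin n) (Fin n) K := (1 : Matrix (Fin n) (Fin n) K).updateCol k e with hM
  have hdetM : M.det = e k := by
    rw [hM, ← Matrix.cramer_apply, Matrix.cramer_one]
    rfl
  have hMa : ∀ a b, M a b = if b = k then e a else (1 : Matrix (Fin n) (Fin n) K) a b := by
    intro a b
    rw [hM, Matrix.updateCol_apply]
  have hcol : ∀ b, (M.submatrix id (Equiv.swap k j)).mulVec (Pi.single b 1) =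
      fun a => M a (Equiv.swap k j b) := by
    intro b
    ext a
    simp
  refine ⟨M.submatrix id (Equiv.swap k j), (M.submatrix id (Equiv.swap k j))⁻¹, ?_, ?_, ?_, ?_⟩
  · refine Matrix.mul_nonsing_inv _ ?_
    rw [Matrix.det_permute', hdetM, isUnit_iff_ne_zero]
    refine mul_ne_zero ?_ hk
    rcases Int.units_eq_one_or (Equiv.Perm.sign (Equiv.swap k j)) with h | h <;> rw [h] <;> simp
  · rw [hcol]
    ext a
    simp [hMa]
  · intro b hb
    have h1 : b ≠ k := fun h => hb (h ▸ hks)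
    have h2 : b ≠ j := fun h => hb (h ▸ hj)
    rw [hcol]
    ext a
    rw [Equiv.swap_apply_of_ne_of_ne h1 h2, hMa, if_neg h1, Matrix.one_apply, Pi.single_apply]
  · intro a b hab
    rw [Matrix.submatrix_apply, hMa] at hab
    by_cases hb : b ∈ s
    · by_cases ha : a ∈ s
      · exact Or.inr ⟨ha, hb⟩
      · exfalso
        split_ifs at hab with h
        · exact hab (hs a ha)
        · have h3 : a = Equiv.swap k j b := by
            by_contra h3
            exact hab (by rw [id_eq, Matrix.one_apply_ne h3])
          apply ha
          rw [h3]
          rcases eq_or_ne b k with rfl | h4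
          · simpa using hj
          rcases eq_or_ne b j with rfl | h5
          · simpa using hks
          rwa [Equiv.swap_apply_of_ne_of_ne h4 h5]
    · have h1 : b ≠ k := fun h => hb (h ▸ hks)
      have h2 : b ≠ j := fun h => hb (h ▸ hj)
      rw [Equiv.swap_apply_of_ne_of_ne h1 h2, if_neg h1] at hab
      left
      by_contra h3
      exact hab (by rw [id_eq, Matrix.one_apply_ne h3])

end Coordinates

section SetOne

variable {K : Type*} [Field K] {n : ℕ}

/-- Dehomogenization: the substitution `x_k = 1`. -/
def setOne (k : Fin n) : MvPolynomial (Fin n) K →ₐ[K] MvPolynomial (Fin n) K :=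
  aeval (Function.update X k 1)

variable {k : Fin n} {w : Fin n → ℚ} {D : ℚ} {f : MvPolynomial (Fin n) K}

lemma setOne_eq_sum (k : Fin n) (f : MvPolynomial (Fin n) K) :
    setOne k f = ∑ α ∈ f.support, monomial (α.erase k) (coeff α f) := by
  conv_lhs => rw [f.as_sum]
  rw [map_sum]
  refine Finset.sum_congr rfl fun α _ => ?_
  rw [setOne, aeval_monomial, Finsupp.prod_fintype _ _ (by simp), monomial_eq,
    Finsupp.prod_fintype _ _ (by simp), algebraMap_eq]
  congr 1
  refine Finset.prod_congr rfl fun i _ => ?_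
  rcases eq_or_ne i k with rfl | h
  · simp
  · simp [h]

lemma exists_of_coeff_setOne_ne {β : Fin n →₀ ℕ} (h : coeff β (setOne k f) ≠ 0) :
    ∃ α, coeff α f ≠ 0 ∧ α.erase k = β := by
  classical
  rw [setOne_eq_sum, coeff_sum] at h
  obtain ⟨α, hα, h1⟩ := Finset.exists_ne_zero_of_sum_ne_zero h
  rw [coeff_monomial] at h1
  refine ⟨α, mem_support_iff.1 hα, ?_⟩
  by_contra h2
  simp [h2] at h1

lemma coeff_setOne (hf : WtEq w D f) (hw : w k ≠ 0) {α : Fin n →₀ ℕ} (hα : wt w α = D) :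
    coeff (α.erase k) (setOne k f) = coeff α f := by
  classical
  rw [setOne_eq_sum, coeff_sum, Finset.sum_eq_single α]
  · simp
  · intro β hβ hne
    rw [coeff_monomial, if_neg]
    intro h
    apply hne
    have h1 : ∀ i, i ≠ k → β i = α i := fun i hi => by
      have := DFunLike.congr_fun h i
      rwa [Finsupp.erase_ne hi, Finsupp.erase_ne hi] at this
    have h2 := (hf β (mem_support_iff.1 hβ)).trans hα.symm
    rw [wt, wt, ← Finset.add_sum_erase _ _ (Finset.mem_univ k),
      ← Finset.add_sum_erase _ (fun i => (α i : ℚ) * w i) (Finset.mem_univ k),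
      Finset.sum_congr rfl fun i hi => by rw [h1 i (Finset.ne_of_mem_erase hi)]] at h2
    have h3 : (β k : ℚ) = α k := mul_right_cancel₀ hw (add_right_cancel h2)
    ext i
    rcases eq_or_ne i k with rfl | hi
    · exact_mod_cast h3
    · exact h1 i hi
  · intro h
    simp [notMem_support_iff.1 h]

lemma eq_zero_of_setOne_eq_zero (hf : WtEq w D f) (hw : w k ≠ 0) (h : setOne k f = 0) :
    f = 0 := by
  ext α
  by_contra hα
  rw [coeff_zero] at hα
  apply hα
  rw [← coeff_setOne hf hw (hf α hα), h, coeff_zero]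

lemma pderiv_setOne {i : Fin n} (hi : i ≠ k) (f : MvPolynomial (Fin n) K) :
    pderiv i (setOne k f) = setOne k (pderiv i f) := by
  induction f using MvPolynomial.induction_on with
  | C a => simp [setOne, algebraMap_eq]
  | add p q hp hq => simp [hp, hq]
  | mul_X p l hp =>
    have hX : pderiv i (setOne k (X l) : MvPolynomial (Fin n) K) = setOne k (pderiv i (X l)) := by
      rcases eq_or_ne l k with rfl | hl
      · simp [setOne, pderiv_X, hi]
      · rcases eq_or_ne l i with rfl | hli
        · simp [setOne, hl]
        · simp [setOne, hl, pderiv_X, hli]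
    rw [map_mul, Derivation.leibniz, Derivation.leibniz, hp, hX]
    simp

lemma pderiv_setOne_self (f : MvPolynomial (Fin n) K) : pderiv k (setOne k f) = 0 := by
  induction f using MvPolynomial.induction_on with
  | C a => simp [setOne, algebraMap_eq]
  | add p q hp hq => simp [hp, hq]
  | mul_X p l hp =>
    have hX : pderiv k (setOne k (X l) : MvPolynomial (Fin n) K) = 0 := by
      rcases eq_or_ne l k with rfl | hl
      · simp [setOne]
      · simp [setOne, hl, pderiv_X]
    rw [map_mul, Derivation.leibniz, hp, hX]
    simp

lemma dirD_setOne {u : Fin n → K} (hu : u k = 0) (f : MvPolynomial (Fin n) K) :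
    dirD u (setOne k f) = setOne k (dirD u f) := by
  rw [dirD_apply, dirD_apply, map_sum]
  refine Finset.sum_congr rfl fun i _ => ?_
  rcases eq_or_ne i k with rfl | hi
  · simp [hu]
  · rw [pderiv_setOne hi, map_mul]
    congr 1
    simp [setOne, algebraMap_eq]

lemma Phi_setOne {i j : Fin n} (hi : i ≠ k) (hj : j ≠ k) (μ ν : ℕ) (f : MvPolynomial (Fin n) K) :
    Phi i j μ ν (setOne k f) = setOne k (Phi i j μ ν f) := by
  simp only [Phi, hess2, levelCurv, pderiv_setOne hi, pderiv_setOne hj, map_sub, map_mul, map_add,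
    map_pow, map_natCast, map_ofNat]

lemma hess2_setOne {i j : Fin n} (hi : i ≠ k) (hj : j ≠ k) (f : MvPolynomial (Fin n) K) :
    hess2 i j (setOne k f) = setOne k (hess2 i j f) := by
  simp only [hess2, pderiv_setOne hi, pderiv_setOne hj, map_sub, map_mul, map_pow]

end SetOne

/-! ### Hessian determinants in three variables -/

section ThreeVariables

variable {K : Type*} [Field K] {w : Fin 3 → ℚ} {D ρ : ℚ} {f A U : MvPolynomial (Fin 3) K}

lemma det_hessian_eq (f : MvPolynomial (Fin 3) K) : (hessian f).det =
    pderiv 0 (pderiv 0 f) * pderiv 1 (pderiv 1 f) * pderiv 2 (pderiv 2 f)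
    - pderiv 0 (pderiv 0 f) * pderiv 1 (pderiv 2 f) ^ 2
    - pderiv 1 (pderiv 1 f) * pderiv 0 (pderiv 2 f) ^ 2
    - pderiv 2 (pderiv 2 f) * pderiv 0 (pderiv 1 f) ^ 2
    + 2 * (pderiv 0 (pderiv 1 f) * pderiv 1 (pderiv 2 f) * pderiv 0 (pderiv 2 f)) := by
  rw [Matrix.det_fin_three]
  simp only [hessian_apply]
  rw [pderiv_comm' 1 0 f, pderiv_comm' 2 0 f, pderiv_comm' 2 1 f]
  ring

lemma lead_det_hessian (h : Lead w D f A) :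
    Lead w (3 * D - 2 * w 0 - 2 * w 1 - 2 * w 2) (hessian f).det (hessian A).det := by
  have H : ∀ i j, Lead w (D - w j - w i) (pderiv i (pderiv j f)) (pderiv i (pderiv j A)) :=
    fun i j => (h.pderiv j).pderiv i
  set E := 3 * D - 2 * w 0 - 2 * w 1 - 2 * w 2 with hE
  rw [det_hessian_eq, det_hessian_eq]
  simp only [sq]
  have h1 := ((H 0 0).mul (H 1 1)).mul (H 2 2)
  have h2 := (H 0 0).mul ((H 1 2).mul (H 1 2))
  have h3 := (H 1 1).mul ((H 0 2).mul (H 0 2))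
  have h4 := (H 2 2).mul ((H 0 1).mul (H 0 1))
  have h5 := (((H 0 1).mul (H 1 2)).mul (H 0 2)).natCast_mul 2
  have := ((((h1.cast (E := E) (by ring)).sub (h2.cast (by ring))).sub (h3.cast (by ring))).sub
    (h4.cast (by ring))).add (h5.cast (by ring))
  simpa only [Nat.cast_ofNat] using this

lemma det_hessian_lead_eq_zero {c : K} (hdet : (hessian f).det = C c) (h : Lead w D f A)
    (hpos : 0 < 3 * D - 2 * w 0 - 2 * w 1 - 2 * w 2) : (hessian A).det = 0 := by
  have := lead_det_hessian h
  rw [hdet] at this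
  exact this.eq_zero_of_C hpos

/-- If the leading form `A` of `f` does not contribute to the derivatives with respect to `x` and
`y`, whose leading forms come from a lower part `U`, then the leading form of the Hessian determinant
is `A_zz (U_xx U_yy - U_xy ^ 2)`. -/
lemma hess2_eq_zero_of_lead {c : K} (hdet : (hessian f).det = C c) (hA : Lead w D f A)
    (hU0 : Lead w (ρ - w 0) (pderiv 0 f) (pderiv 0 U))
    (hU1 : Lead w (ρ - w 1) (pderiv 1 f) (pderiv 1 U)) (hρ : ρ < D)
    (hpos : 0 < D + 2 * ρ - 2 * w 0 - 2 * w 1 - 2 * w 2)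
    (hA0 : pderiv 2 (pderiv 2 A) ≠ 0) : hess2 0 1 U = 0 := by
  set E := D + 2 * ρ - 2 * w 0 - 2 * w 1 - 2 * w 2 with hE
  have H22 := (hA.pderiv 2).pderiv 2
  have H02 : Lead w (ρ - w 0 - w 2) (pderiv 0 (pderiv 2 f)) (pderiv 0 (pderiv 2 U)) := by
    rw [pderiv_comm' 0 2 f, pderiv_comm' 0 2 U]
    exact hU0.pderiv 2
  have H12 : Lead w (ρ - w 1 - w 2) (pderiv 1 (pderiv 2 f)) (pderiv 1 (pderiv 2 U)) := by
    rw [pderiv_comm' 1 2 f, pderiv_comm' 1 2 U]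
    exact hU1.pderiv 2
  have H00 := hU0.pderiv 0
  have H01 := hU1.pderiv 0
  have H11 := hU1.pderiv 1
  have h1 := ((H00.mul H11).mul H22).cast (E := E) (by ring)
  have h2 := (H00.mul (H12.mul H12)).lower (E := E) (by linarith)
  have h3 := (H11.mul (H02.mul H02)).lower (E := E) (by linarith)
  have h4 := (H22.mul (H01.mul H01)).cast (E := E) (by ring)
  have h5 := (((H01.mul H12).mul H02).natCast_mul 2).lower (E := E) (by linarith)
  have h6 := (((h1.sub h2).sub h3).sub h4).add h5
  rw [show pderiv 0 (pderiv 0 f) * pderiv 1 (pderiv 1 f) * pderiv 2 (pderiv 2 f)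
      - pderiv 0 (pderiv 0 f) * (pderiv 1 (pderiv 2 f) * pderiv 1 (pderiv 2 f))
      - pderiv 1 (pderiv 1 f) * (pderiv 0 (pderiv 2 f) * pderiv 0 (pderiv 2 f))
      - pderiv 2 (pderiv 2 f) * (pderiv 0 (pderiv 1 f) * pderiv 0 (pderiv 1 f))
      + ((2 : ℕ) : MvPolynomial (Fin 3) K) *
        (pderiv 0 (pderiv 1 f) * pderiv 1 (pderiv 2 f) * pderiv 0 (pderiv 2 f)) = C c by
    rw [← hdet, det_hessian_eq]; push_cast; ring] at h6
  have h7 := h6.eq_zero_of_C hpos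
  refine (mul_eq_zero (a := pderiv 2 (pderiv 2 A)) |>.1 ?_).resolve_left hA0
  rw [hess2]
  linear_combination h7

/-- If the leading form `A` of `f` does not contribute to the derivative with respect to `y`, whose
leading form comes from a lower part `U`, then the leading form of the Hessian determinant is
`(A_xx A_zz - A_xz ^ 2) U_yy`. -/
lemma pderiv_pderiv_eq_zero_of_lead {c : K} (hdet : (hessian f).det = C c) (hA : Lead w D f A)
    (hU : Lead w (ρ - w 1) (pderiv 1 f) (pderiv 1 U)) (hρ : ρ < D)
    (hpos : 0 < 2 * D + ρ - 2 * w 0 - 2 * w 1 - 2 * w 2)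
    (hA0 : hess2 0 2 A ≠ 0) : pderiv 1 (pderiv 1 U) = 0 := by
  set E := 2 * D + ρ - 2 * w 0 - 2 * w 1 - 2 * w 2 with hE
  have H22 := (hA.pderiv 2).pderiv 2
  have H02 := (hA.pderiv 2).pderiv 0
  have H00 := (hA.pderiv 0).pderiv 0
  have H12 : Lead w (ρ - w 1 - w 2) (pderiv 1 (pderiv 2 f)) (pderiv 1 (pderiv 2 U)) := by
    rw [pderiv_comm' 1 2 f, pderiv_comm' 1 2 U]
    exact hU.pderiv 2
  have H01 := hU.pderiv 0
  have H11 := hU.pderiv 1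
  have h1 := ((H00.mul H11).mul H22).cast (E := E) (by ring)
  have h2 := (H00.mul (H12.mul H12)).lower (E := E) (by linarith)
  have h3 := (H11.mul (H02.mul H02)).cast (E := E) (by ring)
  have h4 := (H22.mul (H01.mul H01)).lower (E := E) (by linarith)
  have h5 := (((H01.mul H12).mul H02).natCast_mul 2).lower (E := E) (by linarith)
  have h6 := (((h1.sub h2).sub h3).sub h4).add h5
  rw [show pderiv 0 (pderiv 0 f) * pderiv 1 (pderiv 1 f) * pderiv 2 (pderiv 2 f)
      - pderiv 0 (pderiv 0 f) * (pderiv 1 (pderiv 2 f) * pderiv 1 (pderiv 2 f))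
      - pderiv 1 (pderiv 1 f) * (pderiv 0 (pderiv 2 f) * pderiv 0 (pderiv 2 f))
      - pderiv 2 (pderiv 2 f) * (pderiv 0 (pderiv 1 f) * pderiv 0 (pderiv 1 f))
      + ((2 : ℕ) : MvPolynomial (Fin 3) K) *
        (pderiv 0 (pderiv 1 f) * pderiv 1 (pderiv 2 f) * pderiv 0 (pderiv 2 f)) = C c by
    rw [← hdet, det_hessian_eq]; push_cast; ring] at h6
  have h7 := h6.eq_zero_of_C hpos
  refine (mul_eq_zero (a := hess2 0 2 A) |>.1 ?_).resolve_left hA0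
  rw [hess2]
  linear_combination h7

/-- For a polynomial `a(x, y) z ^ m`, the Hessian determinant is `Φ(a)` up to the nonzero factor
`m z ^ (3m-2)`. -/
lemma Phi_eq_zero_of_det [CharZero K] {i j k : Fin 3} {m : ℕ}
    (hij : i ≠ j) (hik : i ≠ k) (hjk : j ≠ k) (hm : 1 ≤ m) (hA : ∀ α, coeff α A ≠ 0 → α k = m)
    (hdet : (hessian A).det = 0) : Phi i j (m - 1) m A = 0 := by
  have h1 := X_mul_pderiv_of_forall hA
  have hkk := X_mul_pderiv_pderiv h1
  have hki := X_mul_pderiv_pderiv_of_ne hik.symm h1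
  have hkj := X_mul_pderiv_pderiv_of_ne hjk.symm h1
  have hdet' : pderiv i (pderiv i A) * pderiv j (pderiv j A) * pderiv k (pderiv k A)
    - pderiv i (pderiv i A) * pderiv j (pderiv k A) ^ 2
    - pderiv j (pderiv j A) * pderiv i (pderiv k A) ^ 2
    - pderiv k (pderiv k A) * pderiv i (pderiv j A) ^ 2
    + 2 * (pderiv i (pderiv j A) * pderiv j (pderiv k A) * pderiv i (pderiv k A)) = 0 := by
    rw [det_hessian_eq] at hdet
    have c1 := pderiv_comm' 0 1 A
    have c2 := pderiv_comm' 0 2 A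
    have c3 := pderiv_comm' 1 2 A
    fin_cases i <;> fin_cases j <;> fin_cases k <;> simp_all <;> linear_combination hdet
  have hm0 : (m : MvPolynomial (Fin 3) K) ≠ 0 := Nat.cast_ne_zero.2 (by omega)
  refine (mul_eq_zero (a := (m : MvPolynomial (Fin 3) K)) |>.1 ?_).resolve_left hm0
  rw [Phi, hess2, levelCurv, Nat.cast_sub hm, Nat.cast_one]
  linear_combination (-(pderiv i (pderiv i A) * pderiv j (pderiv j A)) +
      pderiv i (pderiv j A) ^ 2) * hkk +
    (pderiv i (pderiv i A)) * (X k * pderiv j (pderiv k A) + m * pderiv j A) * hkj +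
    (pderiv j (pderiv j A)) * (X k * pderiv i (pderiv k A) + m * pderiv i A) * hki -
    2 * pderiv i (pderiv j A) * (X k * pderiv i (pderiv k A) * hkj + m * pderiv j A * hki) +
    X k ^ 2 * hdet'

/-- If the Hessian determinant of `a(x, y) z ^ m` vanishes, then some directional derivative of `a`
is zero. -/
lemma exists_dirD_eq_zero_of_det [CharZero K] {i j k : Fin 3} {m : ℕ}
    (hij : i ≠ j) (hik : i ≠ k) (hjk : j ≠ k) (hm : 1 ≤ m) (hA : ∀ α, coeff α A ≠ 0 → α k = m)
    (hdet : (hessian A).det = 0) : ∃ u : Fin 3 → K, u ≠ 0 ∧ u k = 0 ∧ dirD u A = 0 := by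
  have hk : ∀ l, l ≠ i → l ≠ j → l = k := fun l _ _ => by omega
  have hP := Phi_eq_zero_of_det hij hik hjk hm hA hdet
  obtain ⟨u, hu0, hu, hD⟩ := exists_dirD_iterate_eq_zero (a := setOne k A) (c := 0) (J₀ := 1)
    (μ := m - 1) (ν := m) hij
    (fun l hi hj => by rw [hk l hi hj]; exact pderiv_setOne_self A)
    (by rw [Phi_setOne hik hjk, hP]; simp) le_rfl (by norm_num) (Or.inl rfl)
    (fun I J hI hJ => by rw [Nat.cast_sub hm]; push_cast; intro h; nlinarith [Nat.pos_of_ne_zero hI])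
    (fun J hJ => by rw [Nat.cast_sub hm]; push_cast; intro h; nlinarith)
  have huk : u k = 0 := hu k hik.symm hjk.symm
  refine ⟨u, hu0, huk, eq_zero_of_setOne_eq_zero (k := k) (w := Pi.single k 1) (D := m)
    (fun α hα => ?_) (by simp) ?_⟩
  · rw [wt_pi_single, one_mul]
    rw [dirD_apply, coeff_sum] at hα
    obtain ⟨l, _, hl⟩ := Finset.exists_ne_zero_of_sum_ne_zero hα
    rw [coeff_C_mul] at hl
    have h1 := left_ne_zero_of_mul hl
    have hlk : l ≠ k := fun h => h1 (h ▸ huk)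
    have h2 := (wt_sub_of_coeff_pderiv (w := 0) (right_ne_zero_of_mul hl)).1
    have h3 := hA _ h2
    rw [Finsupp.add_apply, Finsupp.single_apply, if_neg hlk] at h3
    exact_mod_cast h3
  · rw [← dirD_setOne huk]
    simpa using hD

end ThreeVariables

/-! ### Descent on the degree along lines -/

section Descent

variable {K : Type*} [Field K]

lemma wt_fin_three (w : Fin 3 → ℚ) (α : Fin 3 →₀ ℕ) :
    wt w α = α 0 * w 0 + α 1 * w 1 + α 2 * w 2 := by
  rw [wt, Fin.sum_univ_three]

lemma dirD_fin_three (e : Fin 3 → K) (f : MvPolynomial (Fin 3) K) :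
    dirD e f = C (e 0) * pderiv 0 f + C (e 1) * pderiv 1 f + C (e 2) * pderiv 2 f := by
  rw [dirD_apply, Fin.sum_univ_three]

lemma linSubst_eq_zero_iff {n : ℕ} {f : MvPolynomial (Fin n) K} {T S : Matrix (Fin n) (Fin n) K}
    (h : T * S = 1) : linSubst f T = 0 ↔ f = 0 :=
  ⟨fun h0 => linSubst_injective h (by simpa using h0), fun h0 => by rw [h0, linSubst_zero]⟩

lemma coeff_pderiv_iterate_ne [CharZero K] {ι : Type*} {k : ι} {r : ℕ} {β : ι →₀ ℕ}
    {f : MvPolynomial ι K} (h : coeff (β + Finsupp.single k r) f ≠ 0) :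
    coeff β ((pderiv k)^[r] f) ≠ 0 := by
  induction r generalizing f with
  | zero => simpa using h
  | succ r ih =>
    rw [Function.iterate_succ_apply]
    apply ih
    rw [Finsupp.single_add, ← add_assoc] at h
    rw [coeff_pderiv]
    refine mul_ne_zero h ?_
    exact Nat.cast_add_one_ne_zero _

lemma pderiv_pderiv_iterate {ι : Type*} (i k : ι) (r : ℕ) (f : MvPolynomial ι K) :
    pderiv i ((pderiv k)^[r] f) = (pderiv k)^[r] (pderiv i f) :=
  ((Function.Commute.iterate_right (f := pderiv i) (g := pderiv k)
    (fun p => pderiv_comm' i k p) r) f)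

lemma pderiv_linSubst_single {n : ℕ} {T : Matrix (Fin n) (Fin n) K} {i : Fin n} {u : Fin n → K}
    (h : T.mulVec (Pi.single i 1) = u) (f : MvPolynomial (Fin n) K) :
    pderiv i (linSubst f T) = linSubst (dirD u f) T := by
  rw [← dirD_single, dirD_linSubst, h]

lemma pderiv_iterate_linSubst {n : ℕ} {T : Matrix (Fin n) (Fin n) K} {i : Fin n} {u : Fin n → K}
    (h : T.mulVec (Pi.single i 1) = u) (r : ℕ) (f : MvPolynomial (Fin n) K) :
    (pderiv i)^[r] (linSubst f T) = linSubst ((dirD u)^[r] f) T := by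
  rw [← dirD_single, dirD_iterate_linSubst, h]

/-- A polynomial that is homogeneous of degree `m ≥ 1` in `xⱼ` and involves `xᵢ` has nonzero Hessian
determinant with respect to `xᵢ, xⱼ`. -/
lemma hess2_ne_zero [CharZero K] {n : ℕ} {i j : Fin n} (hij : i ≠ j) {m : ℕ} (hm : m ≠ 0)
    {B : MvPolynomial (Fin n) K} (hB : ∀ α, coeff α B ≠ 0 → α j = m)
    (hex : ∃ α, coeff α B ≠ 0 ∧ α i ≠ 0) : hess2 i j B ≠ 0 := by
  intro h0
  obtain ⟨α₀, hα₀, hα₀i⟩ := hex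
  obtain ⟨β, hβ, hmax⟩ := B.support.exists_max_image (fun α => α i)
    ⟨α₀, mem_support_iff.2 hα₀⟩
  have hβi : β i ≠ 0 := by
    have := hmax α₀ (mem_support_iff.2 hα₀)
    omega
  have hLE : WtLE (Pi.single i 1) (β i) B := fun α hα => by
    rw [wt_pi_single, one_mul]
    exact_mod_cast hmax α (mem_support_iff.2 hα)
  have hcf : ∀ γ, coeff γ (part (fun α => wt (Pi.single i 1) α = (β i : ℚ)) B) =
      if γ i = β i then coeff γ B else 0 := fun γ => by
    rw [coeff_part, wt_pi_single, one_mul]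
    simp
  have hP : Phi i j 1 0 B = C 0 * B := by simp [Phi, h0]
  have := Phi_vertex hij (μ := 1) (ν := 0) (I := β i) (J := m) ?_
    (Phi_lead_eq_zero hLE.lead hP (Or.inl rfl)) (fun γ hγ => ?_) (fun γ hγ => ?_) hβi hm
  · push_cast at this
    omega
  · intro h
    have h1 := congrArg (coeff β) h
    rw [hcf, if_pos rfl] at h1
    exact mem_support_iff.1 hβ (by simpa using h1)
  · rw [hcf] at hγ
    by_contra h
    simp [h] at hγ
  · rw [hcf] at hγ
    exact hB γ fun h => by simp [h] at hγ

/-- If `W_xx W_yy = W_xy ^ 2`, then `W(x, y, 1)` has a constant derivative along some direction in the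
`(x, y)`-plane. -/
lemma exists_pderiv_dirD_setOne_eq_zero [CharZero K] {W : MvPolynomial (Fin 3) K}
    (h : hess2 0 1 W = 0) : ∃ u : Fin 3 → K, u ≠ 0 ∧ u 2 = 0 ∧
      ∀ k, pderiv k (dirD u (setOne 2 W)) = 0 := by
  have hk : ∀ l : Fin 3, l ≠ 0 → l ≠ 1 → l = 2 := fun l _ _ => by omega
  have h0 : hess2 0 1 (setOne 2 W) = 0 := by
    rw [hess2_setOne (by decide) (by decide), h, map_zero]
  have hd : ∀ l : Fin 3, l ≠ 0 → l ≠ 1 → pderiv l (setOne 2 W) = 0 := fun l hi hj => by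
    rw [hk l hi hj]; exact pderiv_setOne_self W
  obtain ⟨u, hu0, hu, hD⟩ := exists_dirD_iterate_eq_zero (a := setOne 2 W) (c := 0) (J₀ := 2)
    (i := 0) (j := 1) (μ := 1) (ν := 0) (by decide) hd (by simp [Phi, h0])
    (by norm_num) le_rfl (Or.inl rfl)
    (fun I J hI hJ => by push_cast; omega) (fun J hJ => by push_cast; omega)
  exact ⟨u, hu0, hu 2 (by decide) (by decide),
    pderiv_dirD_eq_zero_of_hess2 (by decide) hu hd h0 hD⟩

/-- A polynomial in three variables with constant Hessian determinant and of degree greater than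
`m`, which does not have degree less than `m` along the lines of any direction. -/
structure NoLowDirection (m : ℕ) (f : MvPolynomial (Fin 3) K) : Prop where
  det : ∃ c, (hessian f).det = C c
  iter : ∀ e, e ≠ 0 → (dirD e)^[m] f ≠ 0
  deg : ¬ WtLE (fun _ => 1) m f

lemma NoLowDirection.comp {m : ℕ} {f : MvPolynomial (Fin 3) K} (h : NoLowDirection m f)
    {T S : Matrix (Fin 3) (Fin 3) K} (hTS : T * S = 1) : NoLowDirection m (linSubst f T) where
  det := by
    obtain ⟨c, hc⟩ := h.det
    exact ⟨T.det ^ 2 * c, by rw [det_hessian_linSubst, hc, linSubst_C, map_mul]⟩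
  iter e he := by
    rw [dirD_iterate_linSubst, Ne, linSubst_eq_zero_iff hTS]
    refine h.iter _ fun h0 => he ?_
    have := congrArg S.mulVec h0
    rwa [Matrix.mulVec_mulVec, mul_eq_one_comm.1 hTS, Matrix.one_mulVec, Matrix.mulVec_zero] at this
  deg h0 := h.deg <| by
    have := h0.linSubst (T := S) (fun _ _ _ => le_rfl)
    rwa [linSubst_linSubst, hTS, linSubst_one] at this

end Descent

section Descent

variable {K : Type*} [Field K] {f Q : MvPolynomial (Fin 3) K} {m : ℕ} {σ ρ : ℚ}

/-- If the `m`-th derivative of `f` in `z` is constant, then `f` is the sum of a multiple of `z ^ m` and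
of terms of lower degree in `z`. -/
lemma coeff_of_pderiv_iterate_const [CharZero K] (hz : ∀ i, pderiv i ((pderiv 2)^[m] f) = 0)
    {α : Fin 3 →₀ ℕ} (hα : coeff α f ≠ 0) : α 2 < m ∨ (α 2 = m ∧ α 0 = 0 ∧ α 1 = 0) := by
  have h1 : (pderiv 2)^[m + 1] f = 0 := by rw [Function.iterate_succ_apply']; exact hz 2
  have h2 := pderiv_iterate_eq_zero_iff.1 h1 α hα
  rcases Nat.lt_or_ge (α 2) m with h3 | h3
  · exact Or.inl h3
  have h4 : α 2 = m := by omega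
  have h5 : α = α.erase 2 + Finsupp.single 2 m := by rw [← h4, Finsupp.erase_add_single]
  have h6 := coeff_pderiv_iterate_ne (k := 2) (r := m) (β := α.erase 2) (f := f) (by rwa [← h5])
  have h7 := fun i => pderiv_eq_zero_iff.1 (hz i) _ h6
  refine Or.inr ⟨h4, ?_, ?_⟩
  · simpa using h7 0
  · simpa using h7 1

/-- The leading form of `f` is a multiple of `z ^ m` for weights `w` with `w_z = 1`, when the coefficient of `z ^ m` is
constant and all other terms have weight less than `m`. -/
lemma lead_of_const_top [CharZero K] (hz : ∀ i, pderiv i ((pderiv 2)^[m] f) = 0)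
    {w : Fin 3 → ℚ} (hw : w 2 = 1) (hρ : ρ < m)
    (hle : ∀ α, coeff α f ≠ 0 → 1 ≤ α 0 + α 1 → wt w α ≤ ρ) :
    Lead w m f (part (fun α => α 2 = m) f) := by
  constructor
  · intro α hα
    rw [coeff_part] at hα
    split_ifs at hα with h
    · rcases coeff_of_pderiv_iterate_const hz hα with h1 | ⟨-, h1, h2⟩
      · omega
      · rw [wt_fin_three, h, h1, h2, hw]
        simp
    · exact absurd rfl hα
  · intro α hα
    rw [coeff_sub, coeff_part] at hα
    split_ifs at hα with h
    · simp at hα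
    · rw [sub_zero] at hα
      rcases coeff_of_pderiv_iterate_const hz hα with h1 | ⟨h1, -⟩
      · rcases Nat.eq_zero_or_pos (α 0 + α 1) with h2 | h2
        · rw [wt_fin_three, hw, show α 0 = 0 by omega, show α 1 = 0 by omega]
          simpa using h1
        · exact (hle α hα h2).trans_lt hρ
      · exact absurd h1 h

lemma pderiv_pderiv_const_top_ne_zero [CharZero K] (h : NoLowDirection m f) (hm : 2 ≤ m)
    (hz : ∀ i, pderiv i ((pderiv 2)^[m] f) = 0) :
    pderiv 2 (pderiv 2 (part (fun α => α 2 = m) f)) ≠ 0 := by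
  intro hcon
  apply h.iter (Pi.single 2 1) (by simp)
  rw [dirD_single, pderiv_iterate_eq_zero_iff]
  intro α hα
  rcases coeff_of_pderiv_iterate_const hz hα with h1 | ⟨h1, -⟩
  · exact h1
  · have h2 := (pderiv_iterate_eq_zero_iff (m := 2)).1 hcon α (by rwa [coeff_part, if_pos h1])
    omega

/-- If the terms of `f` off the `z`-axis have weight at most `ρ < m`, then their part `U` of weight `ρ`
satisfies `U_xx U_yy = U_xy ^ 2`, provided `ρ` is large enough for the leading form of the Hessian
determinant to have positive weight. -/
lemma part_off_axis [CharZero K] (h : NoLowDirection m f) (hm : 2 ≤ m)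
    (hz : ∀ i, pderiv i ((pderiv 2)^[m] f) = 0) {w : Fin 3 → ℚ} (hw : w 2 = 1) (hρ : ρ < m)
    (hle : ∀ α, coeff α f ≠ 0 → 1 ≤ α 0 + α 1 → wt w α ≤ ρ)
    (hpos : 0 < m + 2 * ρ - 2 * w 0 - 2 * w 1 - 2) :
    hess2 0 1 (part (fun α => 1 ≤ α 0 + α 1 ∧ wt w α = ρ) f) = 0 ∧
    (∀ i, i ≠ 2 → Lead w (ρ - w i) (pderiv i f)
      (pderiv i (part (fun α => 1 ≤ α 0 + α 1 ∧ wt w α = ρ) f))) := by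
  have hU : ∀ i, i ≠ 2 → Lead w (ρ - w i) (pderiv i f)
      (pderiv i (part (fun α => 1 ≤ α 0 + α 1 ∧ wt w α = ρ) f)) := by
    intro i hi
    have hi' : ∀ α : Fin 3 →₀ ℕ, α i ≠ 0 → 1 ≤ α 0 + α 1 := by
      intro α hα
      have : i = 0 ∨ i = 1 := by omega
      rcases this with rfl | rfl <;> omega
    refine lead_pderiv_of_coeff (fun α hα h0 => hle α hα (hi' α h0)) (fun α hα => ?_)
      fun α h0 hα => by rw [coeff_part, if_pos ⟨hi' α h0, hα⟩]
    rw [coeff_part] at hα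
    split_ifs at hα with h1
    · exact h1.2
    · exact absurd rfl hα
  refine ⟨?_, hU⟩
  obtain ⟨c, hc⟩ := h.det
  refine hess2_eq_zero_of_lead hc (lead_of_const_top hz hw hρ hle) (hU 0 (by decide))
    (hU 1 (by decide)) hρ (by rw [hw]; linarith)
    (pderiv_pderiv_const_top_ne_zero h hm hz)

/-- The contradiction in the case where the leading form `Q` of the terms off the `z`-axis, for a
weight `(σ, σ, 1)`, is independent of `y`. Increasing the weight of `y` until a monomial in `y`
reaches the supporting line yields a weight `(σ, t, 1)` with `σ < t < 1`. The leading form for this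
weight has a vanishing `(x, y)`-Hessian as well, and the resulting linear relation between its
derivatives is incompatible with the weights. -/
lemma NoLowDirection.false_of_lead [CharZero K] (h : NoLowDirection m f) (hm : 2 ≤ m)
    (hz : ∀ i, pderiv i ((pderiv 2)^[m] f) = 0)
    (hk : coeff 0 (pderiv 1 ((pderiv 2)^[m - 1] f)) = 0)
    (hσ0 : 0 < σ) (hρ1 : m - 1 + σ < ρ) (hρm : ρ < m)
    (hQ : WtEq ![σ, σ, 1] ρ Q) (hQ0 : Q ≠ 0) (hQ1 : pderiv 1 Q = 0)
    (hL0 : Lead ![σ, σ, 1] (ρ - σ) (pderiv 0 f) (pderiv 0 Q))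
    (hL1 : WtLT ![σ, σ, 1] (ρ - σ) (pderiv 1 f)) : False := by
  have hmQ : (2 : ℚ) ≤ m := by exact_mod_cast hm
  have hwt : ∀ (t : ℚ) (α : Fin 3 →₀ ℕ), wt ![σ, t, 1] α = σ * α 0 + t * α 1 + α 2 := by
    intro t α
    rw [wt_fin_three]
    simp
    ring
  have hlow : ∀ α, coeff α f ≠ 0 → 1 ≤ α 0 + α 1 → (α 2 : ℚ) ≤ m - 1 := by
    intro α hα h1
    rcases coeff_of_pderiv_iterate_const hz hα with h2 | ⟨h2, h3, h4⟩
    · have : (α 2 : ℚ) + 1 ≤ m := by exact_mod_cast h2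
      linarith
    · omega
  have hsub : ∀ (i : Fin 3) (α : Fin 3 →₀ ℕ), α i ≠ 0 →
      α - Finsupp.single i 1 + Finsupp.single i 1 = α := fun i α hi =>
    tsub_add_cancel_of_le (Finsupp.single_le_iff.2 (Nat.one_le_iff_ne_zero.2 hi))
  -- Monomials involving `y` lie strictly below the supporting line, those in `x`, `z` on or below.
  have hy : ∀ α, coeff α f ≠ 0 → α 1 ≠ 0 → σ * α 0 + σ * α 1 + α 2 < ρ := by
    intro α hα h1
    have h2 := hL1 (α - Finsupp.single 1 1) (by
      rw [coeff_pderiv_pred h1]; exact mul_ne_zero hα (Nat.cast_ne_zero.2 h1))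
    have h3 := wt_add ![σ, σ, 1] (α - Finsupp.single 1 1) (Finsupp.single 1 1)
    rw [hsub 1 α h1, wt_single, hwt] at h3
    simp at h3
    linarith
  have hx : ∀ α, coeff α f ≠ 0 → α 0 ≠ 0 → σ * α 0 + σ * α 1 + α 2 ≤ ρ := by
    intro α hα h1
    have h2 := hL0.le (α - Finsupp.single 0 1) (by
      rw [coeff_pderiv_pred h1]; exact mul_ne_zero hα (Nat.cast_ne_zero.2 h1))
    have h3 := wt_add ![σ, σ, 1] (α - Finsupp.single 0 1) (Finsupp.single 0 1)
    rw [hsub 0 α h1, wt_single, hwt] at h3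
    simp at h3
    linarith
  -- The weight `t` of `y` is the least one for which such a monomial reaches the line.
  have hne : ((f.support.filter fun α => α 1 ≠ 0)).Nonempty ∧ ∃ α, coeff α f ≠ 0 ∧ m ≤ α 1 := by
    have h1 := h.iter (Pi.single 1 1) (by simp)
    rw [dirD_single, Ne, pderiv_iterate_eq_zero_iff] at h1
    push Not at h1
    obtain ⟨α, hα, h2⟩ := h1
    exact ⟨⟨α, Finset.mem_filter.2 ⟨mem_support_iff.2 hα, by omega⟩⟩, α, hα, h2⟩
  obtain ⟨αs, hαs, hmin⟩ := (f.support.filter fun α => α 1 ≠ 0).exists_min_image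
    (fun α => (ρ - α 2 - σ * α 0) / (α 1 : ℚ)) hne.1
  obtain ⟨αm, hαm, hαm1⟩ := hne.2
  set t : ℚ := (ρ - αs 2 - σ * αs 0) / (αs 1 : ℚ) with ht
  rw [Finset.mem_filter, mem_support_iff] at hαs
  have hposy : ∀ α : Fin 3 →₀ ℕ, α 1 ≠ 0 → (0 : ℚ) < α 1 := fun α h1 => by
    exact_mod_cast Nat.pos_of_ne_zero h1
  have htle : ∀ α, coeff α f ≠ 0 → α 1 ≠ 0 → σ * α 0 + t * α 1 + α 2 ≤ ρ := by
    intro α hα h1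
    have h2 := hmin α (Finset.mem_filter.2 ⟨mem_support_iff.2 hα, h1⟩)
    rw [le_div_iff₀ (hposy α h1)] at h2
    linarith
  have hts : σ * αs 0 + t * αs 1 + αs 2 = ρ := by
    have := hposy αs hαs.2
    rw [ht]
    field_simp
    ring
  have hσt : σ < t := by
    rw [ht, lt_div_iff₀ (hposy αs hαs.2)]
    linarith [hy αs hαs.1 hαs.2]
  have ht1 : t < 1 := by
    have h1 := htle αm hαm (by omega)
    have h2 : (m : ℚ) ≤ αm 1 := by exact_mod_cast hαm1
    have h3 : (0 : ℚ) ≤ αm 0 := Nat.cast_nonneg _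
    have h4 : (0 : ℚ) ≤ αm 2 := Nat.cast_nonneg _
    by_contra! h5
    nlinarith
  have hle : ∀ α, coeff α f ≠ 0 → 1 ≤ α 0 + α 1 → wt ![σ, t, 1] α ≤ ρ := by
    intro α hα h1
    rw [hwt]
    by_cases h2 : α 1 = 0
    · have := hx α hα (by omega)
      rw [h2] at this ⊢
      simpa using this
    · exact htle α hα h2
  obtain ⟨hW, -⟩ := part_off_axis h hm hz (w := ![σ, t, 1]) (by simp) hρm hle
    (by simp; linarith)
  set W := part (fun α => 1 ≤ α 0 + α 1 ∧ wt ![σ, t, 1] α = ρ) f with hWdef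
  have hWf : ∀ α, coeff α W ≠ 0 → coeff α f ≠ 0 ∧ 1 ≤ α 0 + α 1 ∧
      σ * α 0 + t * α 1 + α 2 = ρ := by
    intro α hα
    rw [hWdef, coeff_part] at hα
    split_ifs at hα with h1
    · exact ⟨hα, h1.1, by rw [← hwt]; exact h1.2⟩
    · exact absurd rfl hα
  have hWeq : WtEq ![σ, t, 1] ρ W := fun α hα => by rw [hwt]; exact (hWf α hα).2.2
  have hWmem : ∀ α, coeff α f ≠ 0 → 1 ≤ α 0 + α 1 → σ * α 0 + t * α 1 + α 2 = ρ →
      coeff (α.erase 2) (setOne 2 W) ≠ 0 := by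
    intro α hα h1 h2
    rw [coeff_setOne hWeq (by simp) (by rw [hwt]; exact h2), hWdef, coeff_part,
      if_pos ⟨h1, by rw [hwt]; exact h2⟩]
    exact hα
  have hWex : ∀ β, coeff β (setOne 2 W) ≠ 0 → ∃ α, coeff α f ≠ 0 ∧ 1 ≤ α 0 + α 1 ∧
      σ * α 0 + t * α 1 + α 2 = ρ ∧ α 0 = β 0 ∧ α 1 = β 1 := by
    intro β hβ
    obtain ⟨α, hα, rfl⟩ := exists_of_coeff_setOne_ne hβ
    obtain ⟨h1, h2, h3⟩ := hWf α hα
    exact ⟨α, h1, h2, h3, by simp, by simp⟩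
  -- `Q` contributes a monomial `x ^ i` with `i ≥ 2` to `W(x, y, 1)`.
  obtain ⟨α₀, hα₀⟩ := ne_zero_iff.1 hQ0
  have h01 : α₀ 1 = 0 := pderiv_eq_zero_iff.1 hQ1 α₀ hα₀
  have hwα₀ : σ * α₀ 0 + α₀ 2 = ρ := by
    have := hQ α₀ hα₀
    rw [hwt, h01] at this
    simpa using this
  have h00 : α₀ 0 ≠ 0 := by
    intro h1
    rw [h1] at hwα₀
    simp only [Nat.cast_zero, mul_zero, zero_add] at hwα₀
    have h2 : (α₀ 2 : ℚ) < m := by linarith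
    have h3 : α₀ 2 + 1 ≤ m := by exact_mod_cast h2
    have h4 : (α₀ 2 : ℚ) + 1 ≤ m := by exact_mod_cast h3
    linarith
  have hα₀f : coeff α₀ f ≠ 0 := by
    have h1 := hL0.coeff_eq (α := α₀ - Finsupp.single 0 1) (by
      have h3 := wt_add ![σ, σ, 1] (α₀ - Finsupp.single 0 1) (Finsupp.single 0 1)
      rw [hsub 0 α₀ h00, wt_single, hwt, h01] at h3
      simp at h3
      linarith)
    rw [coeff_pderiv_pred h00, coeff_pderiv_pred h00] at h1
    intro h2
    rw [h2, zero_mul] at h1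
    exact mul_ne_zero hα₀ (Nat.cast_ne_zero.2 h00) h1
  have hα₀2 := hlow α₀ hα₀f (by omega)
  have h02 : 2 ≤ α₀ 0 := by
    by_contra h1
    have h2 : α₀ 0 = 1 := by omega
    rw [h2] at hwα₀
    simp only [Nat.cast_one, mul_one] at hwα₀
    linarith
  have hγ := hWmem α₀ hα₀f (by omega) (by rw [h01]; simpa using hwα₀)
  obtain ⟨u, hu0, hu2, hD⟩ := exists_pderiv_dirD_setOne_eq_zero hW
  have hDc : ∀ β : Fin 3 →₀ ℕ, β ≠ 0 → coeff β (dirD u (setOne 2 W)) = 0 := by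
    intro β hβ
    by_contra h1
    exact hβ (Finsupp.ext fun i => pderiv_eq_zero_iff.1 (hD i) β h1)
  have hDe : ∀ β : Fin 3 →₀ ℕ, coeff β (dirD u (setOne 2 W)) =
      u 0 * (coeff (β + Finsupp.single 0 1) (setOne 2 W) * (β 0 + 1)) +
      u 1 * (coeff (β + Finsupp.single 1 1) (setOne 2 W) * (β 1 + 1)) := by
    intro β
    rw [dirD_fin_three, hu2]
    simp only [coeff_add, coeff_C_mul, coeff_pderiv, zero_mul, add_zero]
  by_cases hu : u 0 = 0
  · -- `∂W/∂y` is constant at `z = 1`, so that the only monomial in `y` is `y z ^ l`.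
    have hu1 : u 1 ≠ 0 := by
      intro h1
      apply hu0
      ext i
      fin_cases i
      · exact hu
      · exact h1
      · exact hu2
    have h1 := hWmem αs hαs.1 (by omega) hts
    have hs : (αs.erase 2) 1 ≠ 0 := by simpa using hαs.2
    have h2 : αs.erase 2 - Finsupp.single 1 1 = 0 := by
      by_contra h3
      have h4 := hDc _ h3
      rw [hDe, hu, zero_mul, zero_add, hsub 1 _ hs] at h4
      exact mul_ne_zero hu1 (mul_ne_zero h1 (Nat.cast_add_one_ne_zero _)) h4
    have h3 := hsub 1 _ hs
    rw [h2, zero_add] at h3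
    have h4 : αs 0 = 0 := by simpa using (DFunLike.congr_fun h3 0).symm
    have h5 : αs 1 = 1 := by simpa using (DFunLike.congr_fun h3 1).symm
    have h6 : αs 2 ≠ m - 1 := by
      intro h6
      refine coeff_pderiv_iterate_ne (k := 2) (r := m - 1) (β := 0) (f := pderiv 1 f) ?_
        (by rw [← pderiv_pderiv_iterate]; exact hk)
      rw [coeff_pderiv]
      have h7 : 0 + Finsupp.single 2 (m - 1) + Finsupp.single 1 1 = αs := by
        ext i
        fin_cases i
        · simp [h4]
        · simp [h5]
        · simp [h6]
      rw [h7]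
      exact mul_ne_zero hαs.1 (Nat.cast_add_one_ne_zero _)
    have h7 := hlow αs hαs.1 (by omega)
    have h8 : αs 2 + 1 ≤ m := by
      have : (αs 2 : ℚ) + 1 ≤ m := by linarith
      exact_mod_cast this
    have h9 : (αs 2 : ℚ) + 2 ≤ m := by
      have : αs 2 + 2 ≤ m := by omega
      exact_mod_cast this
    rw [h4, h5] at hts
    simp only [Nat.cast_zero, Nat.cast_one, mul_zero, mul_one, zero_add] at hts
    linarith
  · -- Comparing `x ^ (i - 1)` with `x ^ (i - 1) y` shows that `t - σ` would be an integer.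
    have hs : (α₀.erase 2) 0 ≠ 0 := by simpa using h00
    have h1 := hDc (α₀.erase 2 - Finsupp.single 0 1) (by
      intro h1
      have := DFunLike.congr_fun h1 0
      simp at this
      omega)
    rw [hDe, hsub 0 _ hs] at h1
    have h2 : coeff (α₀.erase 2 - Finsupp.single 0 1 + Finsupp.single 1 1) (setOne 2 W) ≠ 0 := by
      intro h2
      rw [h2, zero_mul, mul_zero, add_zero] at h1
      exact mul_ne_zero hu (mul_ne_zero hγ (Nat.cast_add_one_ne_zero _)) h1
    obtain ⟨α, hα, h3, h4, h5, h6⟩ := hWex _ h2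
    simp at h5 h6
    rw [h01, zero_add] at h6
    have h7 : (α 0 : ℚ) = α₀ 0 - 1 := by
      rw [h5, Nat.cast_sub (by omega)]
      simp
    rw [h6, h7] at h4
    simp only [Nat.cast_one, mul_one] at h4
    have h8 : t - σ = α₀ 2 - α 2 := by linarith
    have h9 : (α 2 : ℚ) < α₀ 2 := by linarith
    have h10 : α 2 + 1 ≤ α₀ 2 := by exact_mod_cast h9
    have h11 : (α 2 : ℚ) + 1 ≤ α₀ 2 := by exact_mod_cast h10
    linarith

end Descent

section Descent

variable {K : Type*} [Field K] {f Q : MvPolynomial (Fin 3) K} {m : ℕ} {σ ρ : ℚ}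

lemma coeff_zero_linSubst {n : ℕ} (p : MvPolynomial (Fin n) K) (T : Matrix (Fin n) (Fin n) K) :
    coeff 0 (linSubst p T) = coeff 0 p := by
  simp only [← constantCoeff_eq]
  induction p using MvPolynomial.induction_on with
  | C a => simp
  | add p q hp hq => simp [hp, hq]
  | mul_X p i hp => simp [linSubst_eq_aeval] at *

lemma pderiv_linSubst_eq_zero {n : ℕ} {p : MvPolynomial (Fin n) K}
    {T : Matrix (Fin n) (Fin n) K} (h : ∀ i, pderiv i p = 0) (i : Fin n) :
    pderiv i (linSubst p T) = 0 := by
  rw [pderiv_linSubst]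
  exact Finset.sum_eq_zero fun k _ => by rw [h k, linSubst_zero, mul_zero]

lemma transvection_mul_neg {n : ℕ} {i j : Fin n} (hij : i ≠ j) (θ : K) :
    Matrix.transvection i j θ * Matrix.transvection i j (-θ) = 1 := by
  rw [Matrix.transvection_mul_transvection_same _ _ hij, add_neg_cancel,
    Matrix.transvection_zero]

/-- The contradiction in the case where the coefficient of `z ^ m` is constant and the monomials
`x z ^ (m-1)`, `y z ^ (m-1)` do not occur. As the degree of `f` exceeds `m`, there is a weight
`(σ, σ, 1)` with `σ < 1` for which `z ^ m` dominates and all leading terms off the `z`-axis have degree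
at least two in `x, y`. These leading terms have a vanishing `(x, y)`-Hessian, so they are independent
of `y` after a rotation in the `(x, y)`-plane. -/
lemma NoLowDirection.false_of_normalized [CharZero K] (h : NoLowDirection m f) (hm : 2 ≤ m)
    (hz : ∀ i, pderiv i ((pderiv 2)^[m] f) = 0)
    (hk : ∀ i, i ≠ 2 → coeff 0 (pderiv i ((pderiv 2)^[m - 1] f)) = 0) : False := by
  have hmQ : (2 : ℚ) ≤ m := by exact_mod_cast hm
  have hlow : ∀ α, coeff α f ≠ 0 → 1 ≤ α 0 + α 1 → α 2 < m := by
    intro α hα h1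
    rcases coeff_of_pderiv_iterate_const hz hα with h2 | ⟨h2, h3, h4⟩
    · exact h2
    · omega
  obtain ⟨σ, ρ, hσ0, hσ1, hle, hex, hρ1, hρm⟩ := exists_slope
    (f.support.filter fun α => 1 ≤ α 0 + α 1) (fun α => α 0 + α 1) (fun α => α 2) m
    (fun α hα => by
      rw [Finset.mem_filter, mem_support_iff] at hα
      exact ⟨hα.2, hlow α hα.1 hα.2⟩)
    (by
      have h1 := h.deg
      simp only [WtLE] at h1
      push Not at h1
      obtain ⟨α, hα, h2⟩ := h1
      rw [wt_fin_three, mul_one, mul_one, mul_one] at h2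
      have h3 : m < α 0 + α 1 + α 2 := by exact_mod_cast h2
      have h4 : 1 ≤ α 0 + α 1 := by
        rcases coeff_of_pderiv_iterate_const hz hα with h5 | ⟨h5, -⟩ <;> omega
      exact ⟨α, Finset.mem_filter.2 ⟨mem_support_iff.2 hα, h4⟩, h3⟩)
  set w : Fin 3 → ℚ := ![σ, σ, 1] with hw
  have hwt : ∀ α, wt w α = σ * ((α 0 + α 1 : ℕ) : ℚ) + α 2 := fun α => by
    rw [wt_fin_three, hw]
    simp
    ring
  have hw2 : w 2 = 1 := by simp [hw]
  have hwi : ∀ i, i ≠ 2 → w i = σ := fun i hi => by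
    have : i = 0 ∨ i = 1 := by omega
    rcases this with rfl | rfl <;> simp [hw]
  have hle' : ∀ α, coeff α f ≠ 0 → 1 ≤ α 0 + α 1 → wt w α ≤ ρ := fun α hα h1 => by
    rw [hwt]
    exact hle α (Finset.mem_filter.2 ⟨mem_support_iff.2 hα, h1⟩)
  obtain ⟨hQ2, hL⟩ := part_off_axis h hm hz hw2 hρm hle'
    (by rw [hwi 0 (by decide), hwi 1 (by decide)]; linarith)
  set Q := part (fun α => 1 ≤ α 0 + α 1 ∧ wt w α = ρ) f with hQdef
  have hQf : ∀ α, coeff α Q ≠ 0 → coeff α f ≠ 0 ∧ 1 ≤ α 0 + α 1 ∧ wt w α = ρ := by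
    intro α hα
    rw [hQdef, coeff_part] at hα
    split_ifs at hα with h1
    · exact ⟨hα, h1⟩
    · exact absurd rfl hα
  have hQeq : WtEq w ρ Q := fun α hα => (hQf α hα).2.2
  have hQ0 : Q ≠ 0 := by
    obtain ⟨α, hα, h1⟩ := hex
    rw [Finset.mem_filter, mem_support_iff] at hα
    intro h2
    have h3 := congrArg (coeff α) h2
    rw [hQdef, coeff_part, if_pos ⟨hα.2, by rw [hwt]; exact h1⟩] at h3
    exact hα.1 (by simpa using h3)
  obtain ⟨u, hu0, hu2, hD⟩ := exists_pderiv_dirD_setOne_eq_zero hQ2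
  -- All monomials of `Q` have degree at least two in `x, y`, so the constant derivative vanishes.
  have hD0 : dirD u (setOne 2 Q) = 0 := by
    ext β
    rw [coeff_zero]
    by_contra hβ
    have hβ0 : β = 0 := Finsupp.ext fun i => pderiv_eq_zero_iff.1 (hD i) β hβ
    subst hβ0
    have h1 : ∀ i : Fin 3, i ≠ 2 → coeff 0 (pderiv i (setOne 2 Q)) = 0 := by
      intro i hi
      rw [coeff_pderiv]
      by_contra h2
      obtain ⟨α, hα, h3⟩ := exists_of_coeff_setOne_ne (left_ne_zero_of_mul h2)
      obtain ⟨h4, h5, h6⟩ := hQf α hα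
      have h7 : α 0 + α 1 = 1 := by
        have h8 := DFunLike.congr_fun h3 0
        have h9 := DFunLike.congr_fun h3 1
        have : i = 0 ∨ i = 1 := by omega
        rcases this with rfl | rfl <;> simp at h8 h9 <;> omega
      rw [hwt, h7] at h6
      have h8 : (α 2 : ℚ) + 1 ≤ m := by exact_mod_cast hlow α h4 h5
      simp only [Nat.cast_one, mul_one] at h6
      linarith
    rw [dirD_fin_three, hu2, coeff_add, coeff_add, coeff_C_mul, coeff_C_mul, coeff_C_mul,
      h1 0 (by decide), h1 1 (by decide)] at hβ
    simp at hβ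
  have hLu : Lead w (ρ - σ) (dirD u f) (dirD u Q) := by
    have h0 := (hL 0 (by decide)).C_mul (u 0)
    have h1 := (hL 1 (by decide)).C_mul (u 1)
    rw [hwi 0 (by decide)] at h0
    rw [hwi 1 (by decide)] at h1
    have := h0.add h1
    rw [dirD_fin_three, dirD_fin_three, hu2]
    simpa using this
  have hDQ : dirD u Q = 0 := eq_zero_of_setOne_eq_zero (k := 2) hLu.1 (by simp [hw2])
    (by rw [← dirD_setOne hu2, hD0])
  obtain ⟨T, S, hTS, hT1, hT2, hTs⟩ := exists_matrix_mulVec_single hu0 (s := {k | k ≠ 2}) (j := 1)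
    (by simp) (by simpa using hu2)
  have hTw : ∀ a b, T a b ≠ 0 → w a = w b := fun a b hab => by
    rcases hTs a b hab with rfl | ⟨h1, h2⟩
    · rfl
    · rw [hwi a h1, hwi b h2]
  have hT22 := hT2 2 (by simp)
  have hz' : ∀ i, pderiv i ((pderiv 2)^[m] (linSubst f T)) = 0 := by
    rw [pderiv_iterate_linSubst hT22, dirD_single]
    exact pderiv_linSubst_eq_zero hz
  have hLi : ∀ i, i ≠ 2 →
      Lead w (ρ - σ) (pderiv i (linSubst f T)) (pderiv i (linSubst Q T)) := by
    intro i hi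
    have hTi : T 2 i = 0 := by
      by_contra h1
      rcases hTs 2 i h1 with h2 | ⟨h2, -⟩
      · exact hi h2.symm
      · exact h2 rfl
    have h0 := ((hL 0 (by decide)).linSubst hTw).C_mul (T 0 i)
    have h1 := ((hL 1 (by decide)).linSubst hTw).C_mul (T 1 i)
    rw [hwi 0 (by decide)] at h0
    rw [hwi 1 (by decide)] at h1
    rw [pderiv_linSubst, pderiv_linSubst, Fin.sum_univ_three, Fin.sum_univ_three, hTi]
    simpa using h0.add h1
  have hQ'1 : pderiv 1 (linSubst Q T) = 0 := by
    rw [pderiv_linSubst_single hT1, hDQ, linSubst_zero]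
  refine (h.comp hTS).false_of_lead hm hz' ?_ hσ0 hρ1 hρm
    (Q := linSubst Q T) (hQeq.linSubst hTw)
    (fun h0 => hQ0 ((linSubst_eq_zero_iff hTS).1 h0)) hQ'1 (hLi 0 (by decide)) ?_
  · rw [pderiv_iterate_linSubst hT22, dirD_single, pderiv_linSubst_single hT1,
      coeff_zero_linSubst, dirD_fin_three, hu2, coeff_add, coeff_add, coeff_C_mul, coeff_C_mul,
      hk 0 (by decide), hk 1 (by decide)]
    simp
  · have := hLi 1 (by decide)
    rw [hQ'1] at this
    exact this.lt

/-- The case where the coefficient of the highest power of `z` is constant. -/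
lemma NoLowDirection.false_of_const_top [CharZero K] (h : NoLowDirection m f) (hm : 2 ≤ m)
    (hz : ∀ i, pderiv i ((pderiv 2)^[m] f) = 0) : False := by
  -- Kill the monomials `x z ^ (m-1)` and `y z ^ (m-1)` by adding multiples of `x` and `y` to `z`.
  have step : ∀ (g : MvPolynomial (Fin 3) K), NoLowDirection m g → (∀ i, pderiv i ((pderiv 2)^[m] g) = 0) →
      ∀ j : Fin 3, j ≠ 2 → ∃ g' : MvPolynomial (Fin 3) K, NoLowDirection m g' ∧
        (∀ i, pderiv i ((pderiv 2)^[m] g') = 0) ∧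
        coeff 0 (pderiv j ((pderiv 2)^[m - 1] g')) = 0 ∧
        ∀ i, i ≠ j → coeff 0 (pderiv i ((pderiv 2)^[m - 1] g')) =
          coeff 0 (pderiv i ((pderiv 2)^[m - 1] g)) := by
    intro g hg hgz j hj
    have hiter : pderiv 2 ((pderiv 2)^[m - 1] g) = (pderiv 2)^[m] g := by
      rw [← Function.iterate_succ_apply' (pderiv 2) (m - 1) g]
      congr 1
      omega
    have hne : coeff 0 ((pderiv 2)^[m] g) ≠ 0 := by
      intro h0
      apply hg.iter (Pi.single 2 1) (by simp)
      rw [dirD_single]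
      ext β
      by_contra hβ
      rw [coeff_zero] at hβ
      have : β = 0 := Finsupp.ext fun i => pderiv_eq_zero_iff.1 (hgz i) β hβ
      rw [this] at hβ
      exact hβ h0
    set θ := -coeff 0 (pderiv j ((pderiv 2)^[m - 1] g)) / coeff 0 ((pderiv 2)^[m] g) with hθ
    have hT2 : (Matrix.transvection 2 j θ).mulVec (Pi.single 2 1) = Pi.single 2 1 :=
      transvection_mulVec_single_of_ne hj.symm θ
    refine ⟨linSubst g (Matrix.transvection 2 j θ),
      hg.comp (transvection_mul_neg hj.symm θ), ?_, ?_, ?_⟩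
    · rw [pderiv_iterate_linSubst hT2, dirD_single]
      exact pderiv_linSubst_eq_zero hgz
    · rw [pderiv_iterate_linSubst hT2, dirD_single, pderiv_shear_same, coeff_zero_linSubst,
        hiter, coeff_add, coeff_C_mul, hθ, div_mul_cancel₀ _ hne, add_neg_cancel]
    · intro i hi
      rw [pderiv_iterate_linSubst hT2, dirD_single, pderiv_shear_of_ne hi, coeff_zero_linSubst]
  obtain ⟨g, hg, hgz, hg0, -⟩ := step f h hz 0 (by decide)
  obtain ⟨g', hg', hgz', hg1', hi⟩ := step g hg hgz 1 (by decide)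
  refine hg'.false_of_normalized hm hgz' fun i hi2 => ?_
  have : i = 0 ∨ i = 1 := by omega
  rcases this with rfl | rfl
  · rw [hi 0 (by decide), hg0]
  · exact hg1'

end Descent

section Descent

variable {K : Type*} [Field K] {f F A : MvPolynomial (Fin 3) K} {m d : ℕ}

/-- A polynomial `F` that is homogeneous of degree `m` in `(y, z)`, has vanishing Hessian
determinant, and whose part `A` of highest degree in `x` does not involve `z`. Then the coefficient
of `z ^ m` in `F` is constant. -/
lemma pderiv_iterate_const_of_lead [CharZero K] (hm : 2 ≤ m) (hd : d ≠ 0)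
    (hF : ∀ α, coeff α F ≠ 0 → α 1 + α 2 = m) (hdet : (hessian F).det = 0)
    (hA : Lead (Pi.single 0 1) d F A) (hA0 : A ≠ 0) (hA2 : pderiv 2 A = 0) :
    pderiv 0 ((pderiv 2)^[m] F) = 0 := by
  by_contra hcon
  have hdK : (d : MvPolynomial (Fin 3) K) ≠ 0 := Nat.cast_ne_zero.2 hd
  have hmK : (m : MvPolynomial (Fin 3) K) ≠ 0 := Nat.cast_ne_zero.2 (by omega)
  have hm1K : (m : MvPolynomial (Fin 3) K) - 1 ≠ 0 := by
    rw [← Nat.cast_one, ← Nat.cast_sub (by omega)]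
    exact Nat.cast_ne_zero.2 (by omega)
  have hwt0 : ∀ α : Fin 3 →₀ ℕ, wt (Pi.single 0 1) α = (α 0 : ℚ) := fun α => by
    rw [wt_pi_single, one_mul]
  have hFd : ∀ α, coeff α F ≠ 0 → α 0 ≤ d := fun α hα => by
    have := hA.le α hα
    rw [hwt0] at this
    exact_mod_cast this
  have hA00 : ∀ α, coeff α A ≠ 0 → α 0 = d := fun α hα => by
    have := hA.1 α hα
    rw [hwt0] at this
    exact_mod_cast this
  have hAc : ∀ α, α 0 = d → coeff α A = coeff α F := fun α hα => hA.coeff_eq (by rw [hwt0, hα])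
  have hA02 : ∀ α, coeff α A ≠ 0 → α 2 = 0 := pderiv_eq_zero_iff.1 hA2
  have hA01 : ∀ α, coeff α A ≠ 0 → α 1 = m := fun α hα => by
    have h1 := hF α (by rwa [← hAc α (hA00 α hα)])
    have h2 := hA02 α hα
    omega
  have hF2 : ∀ α, coeff α F ≠ 0 → α 2 ≠ 0 → α 0 < d := fun α hα h2 =>
    lt_of_le_of_ne (hFd α hα) fun h => h2 (hA02 α (by rwa [hAc α h]))
  have hAX0 := X_mul_pderiv_of_forall hA00
  have hAX1 := X_mul_pderiv_of_forall hA01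
  -- A nonconstant monomial `x ^ k z ^ m` of `F`.
  obtain ⟨β, hβ, hβ2, hβ0⟩ : ∃ β, coeff β F ≠ 0 ∧ β 2 = m ∧ β 0 ≠ 0 := by
    rw [pderiv_pderiv_iterate, pderiv_iterate_eq_zero_iff] at hcon
    push Not at hcon
    obtain ⟨α, hα, h2⟩ := hcon
    have h1 := (wt_sub_of_coeff_pderiv (w := 0) hα).1
    have h3 := hF _ h1
    refine ⟨_, h1, ?_, by simp⟩
    simp at h3 ⊢
    omega
  have hD : pderiv 0 (pderiv 0 F) * pderiv 1 (pderiv 1 F) * pderiv 2 (pderiv 2 F)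
    - pderiv 0 (pderiv 0 F) * pderiv 1 (pderiv 2 F) ^ 2
    - pderiv 1 (pderiv 1 F) * pderiv 0 (pderiv 2 F) ^ 2
    - pderiv 2 (pderiv 2 F) * pderiv 0 (pderiv 1 F) ^ 2
    + 2 * (pderiv 0 (pderiv 1 F) * pderiv 1 (pderiv 2 F) * pderiv 0 (pderiv 2 F)) = 0 := by
    rw [← det_hessian_eq, hdet]
  by_cases h12 : hess2 1 2 F = 0
  · -- The lowest terms in `z` have the form `x ^ k y ^ (m-1) z` with `k < d`; they contradict the
    -- vanishing of the minor of the Hessian matrix in the rows `x, y` and columns `y, z`.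
    obtain ⟨γ, hγ, hmax⟩ := (F.support.filter fun α => α 2 ≠ 0).exists_max_image
      (fun α => (α 0 : ℚ) - (d + 1) * α 2)
      ⟨β, Finset.mem_filter.2 ⟨mem_support_iff.2 hβ, by omega⟩⟩
    rw [Finset.mem_filter, mem_support_iff] at hγ
    set ρ : ℚ := (γ 0 : ℚ) - (d + 1) * γ 2 with hρ
    set w : Fin 3 → ℚ := ![1, 0, -(d + 1)] with hw
    have hwt : ∀ α, wt w α = (α 0 : ℚ) - (d + 1) * α 2 := fun α => by
      rw [wt_fin_three, hw]
      simp
      ring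
    have hneg : ∀ α, coeff α F ≠ 0 → α 2 ≠ 0 → (α 0 : ℚ) - (d + 1) * α 2 < 0 := by
      intro α hα h2
      have h3 : (α 0 : ℚ) ≤ d := by exact_mod_cast hFd α hα
      have h4 : (1 : ℚ) ≤ α 2 := by exact_mod_cast Nat.one_le_iff_ne_zero.2 h2
      have h5 : (0 : ℚ) ≤ d := Nat.cast_nonneg d
      nlinarith
    have hρ0 : ρ < 0 := hneg γ hγ.1 hγ.2
    have hd0 : (0 : ℚ) ≤ d := Nat.cast_nonneg d
    have hLA : Lead w d F A := by
      constructor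
      · intro α hα
        rw [hwt, hA00 α hα, hA02 α hα]
        simp
      · intro α hα
        rw [hwt]
        rcases coeff_sub_ne hα with h1 | h1
        · by_cases h2 : α 2 = 0
          · rw [h2]
            have h3 : α 0 ≠ d := by
              intro h3
              rw [coeff_sub, hAc α h3, sub_self] at hα
              exact hα rfl
            have h4 : α 0 < d := lt_of_le_of_ne (hFd α h1) h3
            simpa using h4
          · exact (hneg α h1 h2).trans_le hd0
        · rw [coeff_sub, hAc α (hA00 α h1), sub_self] at hα
          exact absurd rfl hα
    set U := part (fun α => α 2 ≠ 0 ∧ wt w α = ρ) F with hU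
    have hUF : ∀ α, coeff α U ≠ 0 → coeff α F ≠ 0 ∧ α 2 ≠ 0 ∧ wt w α = ρ := by
      intro α hα
      rw [hU, coeff_part] at hα
      split_ifs at hα with h1
      · exact ⟨hα, h1⟩
      · exact absurd rfl hα
    have hUL : Lead w (ρ - w 2) (pderiv 2 F) (pderiv 2 U) := by
      refine lead_pderiv_of_coeff (fun α hα h0 => ?_) (fun α hα => (hUF α hα).2.2)
        fun α h0 hα => by rw [hU, coeff_part, if_pos ⟨h0, hα⟩]
      rw [hwt]
      exact hmax α (Finset.mem_filter.2 ⟨mem_support_iff.2 hα, h0⟩)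
    have hUzz := Phi_second_order (i := 2) (j := 1) (μ := 1) (ν := 0) (c := 0) (J := m)
      (by rw [Phi_symm]; simp [Phi, h12]) hLA hA0 hAX1 hUL (by linarith) (Or.inl rfl) (by omega)
      (by push_cast; omega)
    have hU1 : ∀ α, coeff α U ≠ 0 → α 2 = 1 ∧ α 0 = γ 0 ∧ α 1 = m - 1 := by
      intro α hα
      have h1 : ∀ α, coeff α U ≠ 0 → α 2 = 1 := fun α hα => by
        have h2 := (pderiv_iterate_eq_zero_iff (m := 2)).1 hUzz α hα
        have h3 := (hUF α hα).2.1
        omega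
      have h2 := h1 α hα
      have h3 := h1 γ (by rw [hU, coeff_part, if_pos ⟨hγ.2, hwt γ⟩]; exact hγ.1)
      have h4 := (hUF α hα).2.2
      rw [hwt, hρ, h2, h3] at h4
      refine ⟨h2, ?_, ?_⟩
      · exact_mod_cast sub_left_inj.1 h4
      · have := hF α (hUF α hα).1
        omega
    set G := pderiv 2 U with hG
    have hG0 : G ≠ 0 := by
      intro h0
      exact hγ.2 (pderiv_eq_zero_iff.1 h0 γ
        (by rw [hU, coeff_part, if_pos ⟨hγ.2, hwt γ⟩]; exact hγ.1))
    have hGX : X 0 * pderiv 0 G = ((γ 0 : ℕ) : MvPolynomial (Fin 3) K) * G ∧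
        X 1 * pderiv 1 G = ((m - 1 : ℕ) : MvPolynomial (Fin 3) K) * G := by
      constructor <;> refine X_mul_pderiv_of_forall fun α hα => ?_
      · have h1 := (hU1 _ (wt_sub_of_coeff_pderiv (w := 0) hα).1).2.1
        simpa using h1
      · have h1 := (hU1 _ (wt_sub_of_coeff_pderiv (w := 0) hα).1).2.2
        simpa using h1
    have hw0 : w 0 = 1 := by simp [hw]
    have hw1 : w 1 = 0 := by simp [hw]
    have hminor : pderiv 0 (pderiv 1 F) * pderiv 1 (pderiv 2 F) -
        pderiv 0 (pderiv 2 F) * pderiv 1 (pderiv 1 F) = 0 := by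
      refine pow_eq_zero_iff (two_ne_zero) |>.1 ?_
      rw [hess2] at h12
      linear_combination (pderiv 0 (pderiv 0 F) * pderiv 1 (pderiv 1 F) -
        pderiv 0 (pderiv 1 F) ^ 2) * h12 - pderiv 1 (pderiv 1 F) * hD
    have hlead := (((hLA.pderiv 1).pderiv 0).mul (hUL.pderiv 1)).sub
      (((hUL.pderiv 0).mul ((hLA.pderiv 1).pderiv 1)).cast (by rw [hw0, hw1]; ring))
    rw [hminor] at hlead
    have h0 := hlead.unique (wtLT_zero _ _).lead
    have e1 := X_mul_pderiv_pderiv hAX1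
    have e2 := X_mul_pderiv_pderiv_of_ne (k := (0 : Fin 3)) (l := 1) (by decide) hAX0
    rw [pderiv_comm' 1 0 A] at e2
    have hγd : ((γ 0 : ℕ) : MvPolynomial (Fin 3) K) ≠ d := by
      have := hF2 γ hγ.1 hγ.2
      exact_mod_cast this.ne
    obtain ⟨g1, g2⟩ := hGX
    rw [Nat.cast_sub (by omega), Nat.cast_one] at g2
    have hfin : (m : MvPolynomial (Fin 3) K) * (m - 1) * (d - (γ 0 : ℕ)) * (A * G) = 0 := by
      linear_combination X 0 * X 1 ^ 2 * h0 - (X 1 ^ 2 * pderiv 1 G) * e2 -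
        (d * X 1 * pderiv 1 A) * g2 - (d * (m - 1) * G) * hAX1 +
        (X 1 ^ 2 * pderiv 1 (pderiv 1 A)) * g1 + ((γ 0 : ℕ) * G) * e1
    exact mul_ne_zero (mul_ne_zero (mul_ne_zero hmK hm1K) (sub_ne_zero.2 hγd.symm))
      (mul_ne_zero hA0 hG0) hfin
  · -- The first row `V` of the adjugate matrix is annihilated by the Hessian matrix, so that it is a
    -- zero of the top form of `∂F/∂y`, which is a monomial in `x, y`.
    set V : Fin 3 → MvPolynomial (Fin 3) K := ![hess2 1 2 F,
      pderiv 0 (pderiv 2 F) * pderiv 1 (pderiv 2 F) - pderiv 0 (pderiv 1 F) * pderiv 2 (pderiv 2 F),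
      pderiv 0 (pderiv 1 F) * pderiv 1 (pderiv 2 F) - pderiv 0 (pderiv 2 F) * pderiv 1 (pderiv 1 F)]
      with hV
    have hVH : ∀ j, ∑ i, V i * pderiv i (pderiv j F) = 0 := by
      intro j
      rw [Fin.sum_univ_three]
      have c1 := pderiv_comm' 1 0 F
      have c2 := pderiv_comm' 2 0 F
      have c3 := pderiv_comm' 2 1 F
      fin_cases j
      · simp [hV, hess2, c1, c2]
        linear_combination hD
      · simp [hV, hess2, c3]
        ring
      · simp [hV, hess2]
        ring
    have hLA : Lead (fun _ => 1) ((d + m : ℕ) : ℚ) F A := by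
      have hwt : ∀ α : Fin 3 →₀ ℕ, wt (fun _ => 1) α = ((α 0 + (α 1 + α 2) : ℕ) : ℚ) :=
        fun α => by rw [wt_fin_three]; push_cast; ring
      constructor
      · intro α hα
        rw [hwt, hA00 α hα, hA01 α hα, hA02 α hα, add_zero]
      · intro α hα
        rw [hwt]
        have h1 : coeff α F ≠ 0 := fun h1 => by
          rcases coeff_sub_ne hα with h2 | h2
          · exact h2 h1
          · rw [hAc α (hA00 α h2)] at h2
            exact h2 h1
        have h3 : α 0 ≠ d := by
          intro h3
          rw [coeff_sub, hAc α h3, sub_self] at hα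
          exact hα rfl
        have h4 : α 0 < d := lt_of_le_of_ne (hFd α h1) h3
        have h5 := hF α h1
        exact_mod_cast (by omega : α 0 + (α 1 + α 2) < d + m)
    have hval := aeval_lead_pderiv_eq_zero hVH (j := 1) (N := d + m - 1) (by omega)
      ((hLA.pderiv 1).cast (by rw [Nat.cast_sub (by omega)]; simp))
    have hvalA : aeval V A = 0 := by
      have := congrArg (aeval V) hAX1
      rw [map_mul, map_mul, hval, mul_zero, map_natCast] at this
      exact (mul_eq_zero.1 this.symm).resolve_left hmK
    obtain ⟨α, hα⟩ := ne_zero_iff.1 hA0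
    have hAmon : A = monomial α (coeff α A) := by
      ext δ
      rw [coeff_monomial]
      split_ifs with h1
      · rw [h1]
      · by_contra hδ
        apply h1
        ext i
        fin_cases i
        · exact (hA00 α hα).trans (hA00 δ hδ).symm
        · exact (hA01 α hα).trans (hA01 δ hδ).symm
        · exact (hA02 α hα).trans (hA02 δ hδ).symm
    rw [hAmon, aeval_monomial, Finsupp.prod_fintype _ _ (by simp), Fin.prod_univ_three,
      hA02 α hα, pow_zero, mul_one, algebraMap_eq, mul_eq_zero, mul_eq_zero] at hvalA
    have hV0 : V 0 ≠ 0 := h12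
    have hV1 : V 1 = 0 := by
      rcases hvalA with h1 | h1 | h1
      · exact absurd (C_eq_zero.1 h1) hα
      · exact absurd h1 (pow_ne_zero _ hV0)
      · exact pow_eq_zero_iff (by rw [hA01 α hα]; omega) |>.1 h1
    have hV1' : pderiv 0 (pderiv 2 F) * pderiv 1 (pderiv 2 F) -
      pderiv 0 (pderiv 1 F) * pderiv 2 (pderiv 2 F) = 0 := hV1
    have h02 : hess2 0 2 F = 0 := by
      refine (mul_eq_zero (a := hess2 1 2 F) |>.1 ?_).resolve_left h12
      rw [hess2, hess2]
      linear_combination (pderiv 0 (pderiv 2 F) * pderiv 1 (pderiv 2 F) -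
        pderiv 0 (pderiv 1 F) * pderiv 2 (pderiv 2 F)) * hV1' + pderiv 2 (pderiv 2 F) * hD
    have hB : Lead (Pi.single 2 1) m F (part (fun α => wt (Pi.single 2 1) α = (m : ℚ)) F) := by
      refine WtLE.lead fun α hα => ?_
      rw [wt_pi_single, one_mul]
      have := hF α hα
      exact_mod_cast (by omega : α 2 ≤ m)
    have hwt2 : ∀ α : Fin 3 →₀ ℕ, wt (Pi.single 2 1) α = (m : ℚ) ↔ α 2 = m := fun α => by
      rw [wt_pi_single, one_mul]
      exact Nat.cast_inj
    refine hess2_ne_zero (i := 0) (j := 2) (by decide) (m := m) (by omega)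
      (fun α hα => ?_) ⟨β, ?_, hβ0⟩ ((hB.hess2 0 2).unique (by
        rw [h02]; exact (wtLT_zero _ _).lead))
    · rw [coeff_part] at hα
      by_contra h
      simp only [hwt2, h, if_false, ne_eq, not_true] at hα
    · rwa [coeff_part, if_pos ((hwt2 β).2 hβ2)]

end Descent

section Descent

variable {K : Type*} [Field K] {f F A : MvPolynomial (Fin 3) K} {m d : ℕ}

/-- Let `F` be homogeneous of degree `m` in `(y, z)` with coefficients in `K[x]`, with vanishing
Hessian determinant. Then the value of `F` at some direction of the `(y, z)`-plane is independent
of `x`. -/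
lemma exists_direction_of_homogeneous [CharZero K] (hm : 2 ≤ m)
    (hF : ∀ α, coeff α F ≠ 0 → α 1 + α 2 = m) (hdet : (hessian F).det = 0) (hF0 : F ≠ 0) :
    ∃ e : Fin 3 → K, e ≠ 0 ∧ e 0 = 0 ∧ pderiv 0 ((dirD e)^[m] F) = 0 := by
  obtain ⟨β, hβ, hmax⟩ := F.support.exists_max_image (fun α => α 0) (support_nonempty.2 hF0)
  rw [mem_support_iff] at hβ
  rcases Nat.eq_zero_or_pos (β 0) with h0 | hpos
  · refine ⟨Pi.single 2 1, by simp, by simp, ?_⟩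
    rw [dirD_single, pderiv_pderiv_iterate, pderiv_eq_zero_iff.2, iterate_map_zero]
    intro α hα
    have := hmax α (mem_support_iff.2 hα)
    omega
  have hLE : WtLE (Pi.single 0 1) (β 0) F := fun α hα => by
    rw [wt_pi_single, one_mul]
    exact_mod_cast hmax α (mem_support_iff.2 hα)
  have hL := hLE.lead
  set A := part (fun α => wt (Pi.single 0 1) α = (β 0 : ℚ)) F with hA
  have hA0 : A ≠ 0 := by
    intro h
    have := congrArg (coeff β) h
    rw [hA, coeff_part, if_pos (by rw [wt_pi_single, one_mul])] at this
    exact hβ (by simpa using this)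
  have hAd : ∀ α, coeff α A ≠ 0 → α 0 = β 0 := fun α hα => by
    have := hL.1 α hα
    rw [wt_pi_single, one_mul] at this
    exact_mod_cast this
  have h1 : (1 : ℚ) ≤ β 0 := by exact_mod_cast hpos
  obtain ⟨u, hu0, hu00, hDA⟩ := exists_dirD_eq_zero_of_det (i := 1) (j := 2) (k := 0) (by decide)
    (by decide) (by decide) hpos hAd
    (det_hessian_lead_eq_zero (c := 0) (by simpa using hdet) hL (by simp; linarith))
  obtain ⟨T, S, hTS, hT2, hT0, hTs⟩ := exists_matrix_mulVec_single hu0 (s := {k | k ≠ 0}) (j := 2)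
    (by simp) (by simpa using hu00)
  have hTw : ∀ s t : ℚ, ∀ a b, T a b ≠ 0 → (![s, t, t] : Fin 3 → ℚ) a = (![s, t, t] : Fin 3 → ℚ) b := by
    intro s t a b hab
    have hi : ∀ i : Fin 3, i ≠ 0 → (![s, t, t] : Fin 3 → ℚ) i = t := fun i hi => by
      have : i = 1 ∨ i = 2 := by omega
      rcases this with rfl | rfl <;> simp
    rcases hTs a b hab with rfl | ⟨h1, h2⟩
    · rfl
    · rw [hi a h1, hi b h2]
  have hsing : (Pi.single 0 1 : Fin 3 → ℚ) = ![1, 0, 0] := by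
    ext i; fin_cases i <;> simp
  have hFeq : WtEq ![0, 1, 1] m F := fun α hα => by
    rw [wt_fin_three]
    have := hF α hα
    simp
    exact_mod_cast this
  refine ⟨u, hu0, hu00, ?_⟩
  have h2 := pderiv_iterate_const_of_lead (F := linSubst F T) (A := linSubst A T) (d := β 0) hm
    hpos.ne' (fun α hα => ?_) ?_ (hL.linSubst (by rw [hsing]; exact hTw 1 0))
    (fun h => hA0 ((linSubst_eq_zero_iff hTS).1 h))
    (by rw [pderiv_linSubst_single hT2, hDA, linSubst_zero])
  · rw [pderiv_iterate_linSubst hT2, pderiv_linSubst_single (hT0 0 (by simp)), dirD_single,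
      linSubst_eq_zero_iff hTS] at h2
    exact h2
  · have := hFeq.linSubst (hTw 0 1) α hα
    rw [wt_fin_three] at this
    simp at this
    exact_mod_cast this
  · rw [det_hessian_linSubst, hdet, linSubst_zero, mul_zero]

lemma WtLE.dirD_iterate {w : Fin 3 → ℚ} {s D : ℚ} {e : Fin 3 → K} (hF : WtLE w D F)
    (hw : ∀ i, e i ≠ 0 → w i = s) (r : ℕ) : WtLE w (D - r * s) ((dirD e)^[r] F) := by
  induction r with
  | zero => simpa using hF
  | succ r ih =>
    rw [Function.iterate_succ_apply', dirD_apply]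
    intro α hα
    rw [coeff_sum] at hα
    obtain ⟨i, _, hi⟩ := Finset.exists_ne_zero_of_sum_ne_zero hα
    rw [coeff_C_mul] at hi
    have h1 := ih.pderiv i α (right_ne_zero_of_mul hi)
    rw [hw i (left_ne_zero_of_mul hi)] at h1
    push_cast
    linarith

/-- The case where the coefficient `A` of the highest power of `z` depends on `x` only. -/
lemma NoLowDirection.false_of_top [CharZero K] (h : NoLowDirection m f) (hm : 2 ≤ m)
    (hA : Lead (Pi.single 2 1) m f A) (hA1 : pderiv 1 A = 0) : False := by
  have hmQ : (2 : ℚ) ≤ m := by exact_mod_cast hm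
  obtain ⟨c, hc⟩ := h.det
  have hf2 : ∀ α, coeff α f ≠ 0 → α 2 ≤ m := fun α hα => by
    have := hA.le α hα
    rw [wt_pi_single, one_mul] at this
    exact_mod_cast this
  have hAm : ∀ α, coeff α A ≠ 0 → α 2 = m := fun α hα => by
    have := hA.1 α hα
    rw [wt_pi_single, one_mul] at this
    exact_mod_cast this
  have hAc : ∀ α, α 2 = m → coeff α A = coeff α f := fun α hα =>
    hA.coeff_eq (by rw [wt_pi_single, one_mul, hα])
  have hA1' := pderiv_eq_zero_iff.1 hA1
  have hf1 : ∀ α, coeff α f ≠ 0 → 1 ≤ α 1 → α 2 < m := fun α hα h1 =>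
    lt_of_le_of_ne (hf2 α hα) fun h2 => by
      have := hA1' α (by rwa [hAc α h2])
      omega
  -- The degree of `f` in `(y, z)` is `m`, unless the coefficient of `z ^ m` is constant.
  have hyz : pderiv 0 A ≠ 0 → ∀ α, coeff α f ≠ 0 → α 1 + α 2 ≤ m := by
    intro hA0
    by_contra! hcon
    obtain ⟨α₁, hα₁, hlt⟩ := hcon
    obtain ⟨σ, ρ, hσ0, hσ1, hle, hex, hρ1, hρm⟩ := exists_slope
      (f.support.filter fun α => 1 ≤ α 1) (fun α => α 1) (fun α => α 2) m
      (fun α hα => by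
        rw [Finset.mem_filter, mem_support_iff] at hα
        exact ⟨hα.2, hf1 α hα.1 hα.2⟩)
      ⟨α₁, Finset.mem_filter.2 ⟨mem_support_iff.2 hα₁, by
        have := hf2 α₁ hα₁
        omega⟩, hlt⟩
    set w : Fin 3 → ℚ := ![0, σ, 1] with hw
    have hwt : ∀ α, wt w α = σ * α 1 + α 2 := fun α => by
      rw [wt_fin_three, hw]
      simp
      ring
    have hLA : Lead w m f A := by
      constructor
      · intro α hα
        rw [hwt, hA1' α hα, hAm α hα]
        simp
      · intro α hα
        have h1 : coeff α f ≠ 0 := fun h1 => by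
          rcases coeff_sub_ne hα with h2 | h2
          · exact h2 h1
          · rw [hAc α (hAm α h2)] at h2
            exact h2 h1
        rw [hwt]
        rcases Nat.eq_zero_or_pos (α 1) with h2 | h2
        · have h3 : α 2 ≠ m := by
            intro h3
            rw [coeff_sub, hAc α h3, sub_self] at hα
            exact hα rfl
          have h4 : α 2 < m := lt_of_le_of_ne (hf2 α h1) h3
          rw [h2]
          simpa using h4
        · exact (hle α (Finset.mem_filter.2 ⟨mem_support_iff.2 h1, h2⟩)).trans_lt hρm
    set U := part (fun α => 1 ≤ α 1 ∧ wt w α = ρ) f with hU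
    have hUL : Lead w (ρ - w 1) (pderiv 1 f) (pderiv 1 U) := by
      refine lead_pderiv_of_coeff (fun α hα h0 => ?_) (fun α hα => ?_)
        fun α h0 hα => by rw [hU, coeff_part, if_pos ⟨Nat.one_le_iff_ne_zero.2 h0, hα⟩]
      · rw [hwt]
        exact hle α (Finset.mem_filter.2 ⟨mem_support_iff.2 hα, Nat.one_le_iff_ne_zero.2 h0⟩)
      · rw [hU, coeff_part] at hα
        split_ifs at hα with h1
        · exact h1.2
        · exact absurd rfl hα
    have hAexist : ∃ α, coeff α A ≠ 0 ∧ α 0 ≠ 0 := by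
      by_contra! h1
      exact hA0 (pderiv_eq_zero_iff.2 h1)
    have hUyy := pderiv_pderiv_eq_zero_of_lead hc hLA hUL hρm (by simp [hw]; linarith)
      (hess2_ne_zero (i := 0) (j := 2) (by decide) (m := m) (by omega) hAm hAexist)
    obtain ⟨α, hα, h1⟩ := hex
    rw [Finset.mem_filter, mem_support_iff] at hα
    have h2 := (pderiv_iterate_eq_zero_iff (m := 2)).1 hUyy α
      (by rw [hU, coeff_part, if_pos ⟨hα.2, by rw [hwt]; exact h1⟩]; exact hα.1)
    have h3 : α 1 = 1 := by omega
    have h4 : (α 2 : ℚ) + 1 ≤ m := by exact_mod_cast hf1 α hα.1 hα.2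
    rw [h3] at h1
    simp only [Nat.cast_one, mul_one] at h1
    linarith
  -- In both cases some direction has a constant `m`-th derivative.
  obtain ⟨e, he0, hez⟩ : ∃ e : Fin 3 → K, e ≠ 0 ∧ ∀ i, pderiv i ((dirD e)^[m] f) = 0 := by
    by_cases hA0 : pderiv 0 A = 0
    · refine ⟨Pi.single 2 1, by simp, fun i => ?_⟩
      rw [dirD_single, pderiv_eq_zero_iff]
      have hA0' := pderiv_eq_zero_iff.1 hA0
      suffices ∀ α, coeff α ((pderiv 2)^[m] f) ≠ 0 → α = 0 from
        fun α hα => by rw [this α hα]; rfl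
      intro α hα
      have h1 : ∀ (r : ℕ) (g : MvPolynomial (Fin 3) K), coeff α ((pderiv 2)^[r] g) ≠ 0 →
          coeff (α + Finsupp.single 2 r) g ≠ 0 := by
        intro r
        induction r with
        | zero => intro g; simp
        | succ r ih =>
          intro g hg
          rw [Function.iterate_succ_apply] at hg
          have := (wt_sub_of_coeff_pderiv (w := 0) (ih _ hg)).1
          rwa [add_assoc, ← Finsupp.single_add] at this
      have h2 := h1 m f hα
      have h3 := hf2 _ h2
      simp at h3
      have h4 : coeff (α + Finsupp.single 2 m) A ≠ 0 := by
        rwa [hAc _ (by simp [h3])]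
      have h5 := hA0' _ h4
      have h6 := hA1' _ h4
      simp at h5 h6
      ext i
      fin_cases i
      · exact h5
      · exact h6
      · exact h3
    · have hLE : WtLE ![0, 1, 1] m f := fun α hα => by
        rw [wt_fin_three]
        have := hyz hA0 α hα
        simp
        exact_mod_cast this
      have hL := hLE.lead
      set F := part (fun α => wt ![0, 1, 1] α = (m : ℚ)) f with hF
      have hF0 : F ≠ 0 := by
        intro h0
        apply hA0
        have : A = 0 := by
          ext α
          by_contra hα
          rw [coeff_zero] at hα
          have h1 := hL.coeff_eq (α := α) (by
            rw [wt_fin_three, hA1' α hα, hAm α hα]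
            simp)
          rw [h0, coeff_zero, ← hAc α (hAm α hα)] at h1
          exact hα h1.symm
        rw [this, map_zero]
      obtain ⟨e, he0, he00, heF⟩ := exists_direction_of_homogeneous (F := F) hm
        (fun α hα => by
          have := hL.1 α hα
          rw [wt_fin_three] at this
          simp at this
          exact_mod_cast this)
        (det_hessian_lead_eq_zero hc hL (by simp; linarith)) hF0
      have hwe : ∀ i, e i ≠ 0 → (![0, 1, 1] : Fin 3 → ℚ) i = 1 := fun i hi => by
        have : i ≠ 0 := fun h => hi (h ▸ he00)
        have : i = 1 ∨ i = 2 := by omega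
        rcases this with rfl | rfl <;> simp
      have hnn : ∀ α : Fin 3 →₀ ℕ, (0 : ℚ) ≤ wt ![0, 1, 1] α := fun α => by
        rw [wt_fin_three]
        simp
        positivity
      have hlow : (dirD e)^[m] (f - F) = 0 := by
        have h1 : WtLE ![0, 1, 1] (m - 1 : ℚ) (f - F) := fun α hα => by
          have h2 := hL.2 α hα
          rw [wt_fin_three] at h2 ⊢
          simp at h2 ⊢
          have h3 : α 1 + α 2 + 1 ≤ m := by exact_mod_cast h2
          have h4 : (α 1 + α 2 + 1 : ℚ) ≤ m := by exact_mod_cast h3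
          linarith
        refine ((h1.dirD_iterate hwe m).lt (E := 0) (by linarith)).eq_zero_of_forall hnn
      have hfF : (dirD e)^[m] f = (dirD e)^[m] F := by
        rw [iterate_map_sub, sub_eq_zero] at hlow
        exact hlow
      refine ⟨e, he0, fun i => ?_⟩
      rcases eq_or_ne i 0 with rfl | hi
      · rw [hfF, heF]
      · have hi1 : (![0, 1, 1] : Fin 3 → ℚ) i = 1 := by
          have : i = 1 ∨ i = 2 := by omega
          rcases this with rfl | rfl <;> simp
        have h1 := (hLE.dirD_iterate hwe m).pderiv i
        rw [hi1] at h1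
        exact (h1.lt (E := 0) (by linarith)).eq_zero_of_forall hnn
  obtain ⟨T, S, hTS, hT2, -, -⟩ := exists_matrix_mulVec_single he0 (s := Set.univ) (j := 2)
    (by simp) (by simp)
  refine (h.comp hTS).false_of_const_top hm ?_
  rw [pderiv_iterate_linSubst hT2]
  exact pderiv_linSubst_eq_zero hez

/-- If `f` has degree greater than `m ≥ 2` and constant Hessian determinant, and if `f` has degree
at most `m` along some direction, then it has degree less than `m` along some direction. -/
lemma exists_dirD_iterate_eq_zero_pred [CharZero K] (hm : 2 ≤ m)
    (hdet : ∃ c, (hessian f).det = C c) (hdeg : ¬ WtLE (fun _ => 1) m f)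
    (he : ∃ e, e ≠ 0 ∧ (dirD e)^[m + 1] f = 0) : ∃ e, e ≠ 0 ∧ (dirD e)^[m] f = 0 := by
  by_contra! hcon
  have h : NoLowDirection m f := ⟨hdet, hcon, hdeg⟩
  obtain ⟨e, he0, hem⟩ := he
  have hmQ : (2 : ℚ) ≤ m := by exact_mod_cast hm
  obtain ⟨T, S, hTS, hT2, -, -⟩ := exists_matrix_mulVec_single he0 (s := Set.univ) (j := 2)
    (by simp) (by simp)
  have h1 := h.comp hTS
  have hz : (pderiv 2)^[m + 1] (linSubst f T) = 0 := by
    rw [pderiv_iterate_linSubst hT2, hem, linSubst_zero]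
  have hLE : WtLE (Pi.single 2 1) m (linSubst f T) := fun α hα => by
    have := pderiv_iterate_eq_zero_iff.1 hz α hα
    rw [wt_pi_single, one_mul]
    exact_mod_cast Nat.lt_succ_iff.1 this
  have hL := hLE.lead
  set A := part (fun α => wt (Pi.single 2 1) α = (m : ℚ)) (linSubst f T) with hA
  obtain ⟨c, hc⟩ := h1.det
  obtain ⟨u, hu0, hu2, hDA⟩ := exists_dirD_eq_zero_of_det (i := 0) (j := 1) (k := 2) (m := m)
    (by decide) (by decide) (by decide) (by omega)
    (fun α hα => by
      have := hL.1 α hα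
      rw [wt_pi_single, one_mul] at this
      exact_mod_cast this)
    (det_hessian_lead_eq_zero hc hL (by simp; linarith))
  obtain ⟨T', S', hTS', hT1', -, hTs'⟩ := exists_matrix_mulVec_single hu0 (s := {k | k ≠ 2})
    (j := 1) (by simp) (by simpa using hu2)
  refine (h1.comp hTS').false_of_top hm (A := linSubst A T') (hL.linSubst fun a b hab => ?_)
    (by rw [pderiv_linSubst_single hT1', hDA, linSubst_zero])
  rcases hTs' a b hab with rfl | ⟨h2, h3⟩
  · rfl
  · rw [Pi.single_eq_of_ne h2, Pi.single_eq_of_ne h3]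

/-- If `f` has degree at least `m`, but less than `m` along some direction, and constant Hessian
determinant, then it is affine along some direction. -/
lemma exists_dirD_dirD_eq_zero [CharZero K] (hdet : ∃ c, (hessian f).det = C c)
    (hm : 2 ≤ m) (hdeg : ∀ k < m, ¬ WtLE (fun _ => 1) k f)
    (he : ∃ e, e ≠ 0 ∧ (dirD e)^[m] f = 0) : ∃ e, e ≠ 0 ∧ dirD e (dirD e f) = 0 := by
  induction m, hm using Nat.le_induction with
  | base => exact he
  | succ m hm ih =>
    exact ih (fun k hk => hdeg k (by omega))
      (exists_dirD_iterate_eq_zero_pred hm hdet (hdeg m (by omega)) he)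

end Descent

/-! ### Polynomials that are affine along a direction -/

section Reduction

variable {K : Type*} [Field K]

lemma mulVec_ne_zero {n : ℕ} {T S : Matrix (Fin n) (Fin n) K} (hTS : T * S = 1) {v : Fin n → K}
    (hv : v ≠ 0) : T.mulVec v ≠ 0 := fun h0 => hv <| by
  have := congrArg S.mulVec h0
  rwa [Matrix.mulVec_mulVec, mul_eq_one_comm.1 hTS, Matrix.one_mulVec, Matrix.mulVec_zero] at this

/-- If `f` is affine along some direction, then the Hessian matrix of `f` has zeros below the
anti-diagonal in suitable coordinates: the derivative `a` in that direction has straight level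
curves, because the derivative of the Hessian determinant in that direction vanishes. -/
lemma exists_antitriangular_of_dirD_dirD [CharZero K] {f : MvPolynomial (Fin 3) K}
    (hdet : ∃ c, (hessian f).det = C c) {e : Fin 3 → K} (he : e ≠ 0)
    (hD : dirD e (dirD e f) = 0) :
    ∃ T S : Matrix (Fin 3) (Fin 3) K, T * S = 1 ∧ pderiv 2 (pderiv 2 (linSubst f T)) = 0 ∧
      pderiv 1 (pderiv 2 (linSubst f T)) = 0 := by
  obtain ⟨T, S, hTS, hT2, -, -⟩ := exists_matrix_mulVec_single he (s := Set.univ) (j := 2)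
    (by simp) (by simp)
  set g := linSubst f T with hg
  have hgzz : pderiv 2 (pderiv 2 g) = 0 := by
    rw [hg, pderiv_linSubst_single hT2, pderiv_linSubst_single hT2, hD, linSubst_zero]
  obtain ⟨c, hc⟩ : ∃ c, (hessian g).det = C c := by
    obtain ⟨c, hc⟩ := hdet
    exact ⟨T.det ^ 2 * c, by rw [hg, det_hessian_linSubst, hc, linSubst_C, map_mul]⟩
  have hcurv : levelCurv 0 1 (pderiv 2 g) = 0 := by
    rw [det_hessian_eq, hgzz] at hc
    have h1 := congrArg (pderiv 2) hc
    have e1 : pderiv 2 (pderiv 0 (pderiv 0 g)) = pderiv 0 (pderiv 0 (pderiv 2 g)) := by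
      rw [pderiv_comm' 2 0, pderiv_comm' 2 0]
    have e2 : pderiv 2 (pderiv 1 (pderiv 1 g)) = pderiv 1 (pderiv 1 (pderiv 2 g)) := by
      rw [pderiv_comm' 2 1, pderiv_comm' 2 1]
    have e3 : pderiv 2 (pderiv 0 (pderiv 1 g)) = pderiv 0 (pderiv 1 (pderiv 2 g)) := by
      rw [pderiv_comm' 2 0, pderiv_comm' 2 1]
    have e4 : ∀ i, pderiv 2 (pderiv i (pderiv 2 g)) = 0 := fun i => by
      rw [pderiv_comm' 2 i, hgzz, map_zero]
    have e5 : pderiv 2 (2 : MvPolynomial (Fin 3) K) = 0 := by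
      rw [← map_ofNat (C : K →+* MvPolynomial (Fin 3) K) 2, pderiv_C]
    simp only [map_add, map_sub, map_neg, Derivation.leibniz, Derivation.leibniz_pow, smul_eq_mul,
      e1, e2, e3, e4, e5, pderiv_C, mul_zero, zero_mul, smul_zero, add_zero, sub_zero,
      zero_add, zero_sub] at h1
    rw [levelCurv]
    linear_combination -h1
  obtain ⟨u, hu0, hu, hDu⟩ := exists_dirD_iterate_eq_zero (a := pderiv 2 g) (c := 0) (J₀ := 1)
    (i := (0 : Fin 3)) (j := 1) (μ := 0) (ν := 1) (by decide)
    (fun l h0 h1 => by rw [show l = 2 by omega]; exact hgzz) (by simp [Phi, hcurv]) le_rfl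
    (by norm_num) (Or.inl rfl) (fun I J hI hJ => by push_cast; omega)
    (fun J hJ => by push_cast; omega)
  obtain ⟨T', S', hTS', hT1', hT2', -⟩ := exists_matrix_mulVec_single hu0 (s := {k | k ≠ 2})
    (j := 1) (by simp) (fun k hk => by
      rw [show k = 2 by simpa using hk]
      exact hu 2 (by decide) (by decide))
  refine ⟨T * T', S' * S, ?_, ?_, ?_⟩
  · rw [mul_assoc, ← mul_assoc T', hTS', one_mul, hTS]
  · rw [← linSubst_linSubst, ← hg, pderiv_linSubst_single (hT2' 2 (by simp)),
      pderiv_linSubst_single (hT2' 2 (by simp)), dirD_single, hgzz, linSubst_zero]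
  · rw [← linSubst_linSubst, ← hg, pderiv_linSubst_single (hT2' 2 (by simp)),
      pderiv_linSubst_single hT1', dirD_single]
    have : dirD u (pderiv 2 g) = 0 := hDu
    rw [this, linSubst_zero]

lemma eq_zero_of_pderiv_eq_zero [CharZero K] {ι : Type*} [Fintype ι] {p : MvPolynomial ι K} {D : ℚ}
    (hp : WtEq (fun _ => 1) D p) (hD : D ≠ 0) (h : ∀ i, pderiv i p = 0) : p = 0 := by
  ext α
  by_contra hα
  rw [coeff_zero] at hα
  have h0 : α = 0 := Finsupp.ext fun i => pderiv_eq_zero_iff.1 (h i) α hα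
  have := hp α hα
  rw [h0] at this
  exact hD (by simpa [wt] using this.symm)

/-- A form with vanishing Hessian determinant that is affine along some direction has linearly
dependent partial derivatives. -/
lemma exists_dirD_eq_zero_of_homogeneous [CharZero K] {h : MvPolynomial (Fin 3) K} {d : ℕ}
    (hd : 2 ≤ d) (hh : WtEq (fun _ => 1) d h) (hdet : (hessian h).det = 0) {e : Fin 3 → K}
    (he : e ≠ 0) (hD : dirD e (dirD e h) = 0) : ∃ e', e' ≠ 0 ∧ dirD e' h = 0 := by
  obtain ⟨T, S, hTS, h22, h12⟩ := exists_antitriangular_of_dirD_dirD ⟨0, by simpa using hdet⟩ he hD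
  set g := linSubst h T with hg
  have hgh : WtEq (fun _ => 1) (d : ℚ) g := hh.linSubst fun _ _ _ => rfl
  have hd1 : (d : ℚ) - 1 ≠ 0 := by
    have : (2 : ℚ) ≤ d := by exact_mod_cast hd
    linarith
  have hdet' : pderiv 1 (pderiv 1 g) * pderiv 0 (pderiv 2 g) ^ 2 = 0 := by
    have h1 := det_hessian_eq g
    rw [hg, det_hessian_linSubst, hdet, linSubst_zero, mul_zero, ← hg, h22, h12] at h1
    linear_combination h1
  -- It suffices to find a direction that annihilates `g`.
  suffices ∃ v, v ≠ 0 ∧ dirD v g = 0 by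
    obtain ⟨v, hv, hvg⟩ := this
    rw [hg, dirD_linSubst, linSubst_eq_zero_iff hTS] at hvg
    exact ⟨_, mulVec_ne_zero hTS hv, hvg⟩
  rcases mul_eq_zero.1 hdet' with h11 | h02
  · have hmem : ∀ j : Fin 3, j ≠ 0 → ∀ α, coeff α (pderiv j g) ≠ 0 →
        α = Finsupp.single 0 (d - 1) := by
      intro j hj α hα
      have h1 : pderiv 1 (pderiv j g) = 0 ∧ pderiv 2 (pderiv j g) = 0 := by
        have : j = 1 ∨ j = 2 := by omega
        rcases this with rfl | rfl
        · exact ⟨h11, by rw [pderiv_comm' 2 1, h12]⟩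
        · exact ⟨h12, h22⟩
      have h2 := pderiv_eq_zero_iff.1 h1.1 α hα
      have h3 := pderiv_eq_zero_iff.1 h1.2 α hα
      have h4 := hgh.pderiv j α hα
      rw [wt_fin_three, h2, h3] at h4
      simp at h4
      have h5 : α 0 + 1 = d := by
        have : (α 0 : ℚ) + 1 = d := by linarith
        exact_mod_cast this
      ext i
      fin_cases i
      · simp
        omega
      · simpa using h2
      · simpa using h3
    set b := coeff (Finsupp.single 0 (d - 1)) (pderiv 1 g) with hb
    set c := coeff (Finsupp.single 0 (d - 1)) (pderiv 2 g) with hc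
    by_cases hbc : b = 0
    · refine ⟨Pi.single 1 1, by simp, ?_⟩
      rw [dirD_single]
      ext α
      by_contra hα
      rw [coeff_zero] at hα
      rw [hmem 1 (by decide) α hα] at hα
      exact hα hbc
    · refine ⟨![0, c, -b], fun h0 => hbc (by simpa using congrFun h0 2), ?_⟩
      rw [dirD_fin_three]
      ext α
      simp only [coeff_add, coeff_C_mul, coeff_zero, Matrix.cons_val_zero, Matrix.cons_val_one,
        Matrix.cons_val, zero_mul, zero_add]
      by_cases hα : α = Finsupp.single 0 (d - 1)
      · rw [hα, ← hb, ← hc]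
        ring
      · have h1 : coeff α (pderiv 1 g) = 0 := by
          by_contra h1
          exact hα (hmem 1 (by decide) α h1)
        have h2 : coeff α (pderiv 2 g) = 0 := by
          by_contra h2
          exact hα (hmem 2 (by decide) α h2)
        rw [h1, h2]
        simp
  · have h02' := pow_eq_zero_iff (two_ne_zero) |>.1 h02
    refine ⟨Pi.single 2 1, by simp, ?_⟩
    rw [dirD_single]
    refine eq_zero_of_pderiv_eq_zero (hgh.pderiv 2) hd1 fun i => ?_
    fin_cases i
    · exact h02'
    · exact h12
    · exact h22

end Reduction

/-! ### Forms with vanishing Hessian determinant -/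

section TopForm

lemma hessian_det_map {K L : Type*} [Field K] [Field L] (φ : K →+* L) (f : MvPolynomial (Fin 3) K) :
    (hessian (map φ f)).det = map φ (hessian f).det := by
  simp only [det_hessian_eq, pderiv_map, map_add, map_sub, map_mul, map_pow, map_ofNat]

variable {K : Type*} [Field K]

lemma eval_smul_of_wtEq {n d : ℕ} {h : MvPolynomial (Fin n) K} (hh : WtEq (fun _ => 1) d h)
    (t : K) (v : Fin n → K) : eval (t • v) h = t ^ d * eval v h := by
  rw [eval_eq', eval_eq', Finset.mul_sum]
  refine Finset.sum_congr rfl fun α hα => ?_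
  have h1 := hh α (mem_support_iff.1 hα)
  have h2 : ∑ i, α i = d := by
    have : ((∑ i, α i : ℕ) : ℚ) = d := by simpa [wt] using h1
    exact_mod_cast this
  simp only [Pi.smul_apply, smul_eq_mul, mul_pow, Finset.prod_mul_distrib]
  rw [Finset.prod_pow_eq_pow_sum, h2]
  ring

lemma eval_aeval {n : ℕ} (x : Fin n → Polynomial K) (h : MvPolynomial (Fin n) K) (t : K) :
    Polynomial.eval t (aeval x h) = eval (fun i => Polynomial.eval t (x i)) h := by
  induction h using MvPolynomial.induction_on with
  | C a => simp
  | add p q hp hq => simp [hp, hq]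
  | mul_X p i hp => simp [hp]

/-- Over an algebraically closed field, a form of positive degree has a nontrivial zero. -/
lemma exists_eval_eq_zero [IsAlgClosed K] [CharZero K] {d : ℕ} (hd : d ≠ 0)
    {h : MvPolynomial (Fin 3) K} (hh : WtEq (fun _ => 1) d h) :
    ∃ v : Fin 3 → K, v ≠ 0 ∧ eval v h = 0 := by
  by_contra! hcon
  -- A polynomial without zeros is constant.
  have key : ∀ x : Fin 3 → Polynomial K, (∀ t, (fun i => Polynomial.eval t (x i)) ≠ 0) →
      ∃ c, ∀ t, eval (fun i => Polynomial.eval t (x i)) h = c := by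
    intro x hx
    by_cases hdeg : (aeval x h).degree = 0
    · obtain ⟨c, hc⟩ : ∃ c, aeval x h = Polynomial.C c :=
        ⟨_, Polynomial.eq_C_of_degree_eq_zero hdeg⟩
      exact ⟨c, fun t => by rw [← eval_aeval, hc, Polynomial.eval_C]⟩
    · obtain ⟨t, ht⟩ := IsAlgClosed.exists_root _ hdeg
      exact absurd ((eval_aeval _ _ _).symm.trans ht) (hcon _ (hx t))
  obtain ⟨c, hc⟩ := key ![1, Polynomial.X, 0] (fun t h0 => by simpa using congrFun h0 0)
  obtain ⟨c', hc'⟩ := key ![Polynomial.X, 1, 0] (fun t h0 => by simpa using congrFun h0 1)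
  have hc1 : ∀ t, eval ![1, t, 0] h = c := fun t => by
    rw [← hc t]
    congr 2
    ext i; fin_cases i <;> simp
  have hc1' : ∀ t, eval ![t, 1, 0] h = c' := fun t => by
    rw [← hc' t]
    congr 2
    ext i; fin_cases i <;> simp
  have hs : ∀ t : K, t ≠ 0 → c = t ^ d * c' := by
    intro t ht
    rw [← hc1 t, ← hc1' t⁻¹, ← eval_smul_of_wtEq hh]
    congr 2
    ext i; fin_cases i <;> simp [ht]
  have h1 := hs 1 one_ne_zero
  have h2 := hs 2 two_ne_zero
  rw [one_pow, one_mul] at h1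
  have h3 : (2 ^ d - 1 : K) ≠ 0 := by
    rw [sub_ne_zero]
    have : (2 : ℕ) ^ d ≠ 1 := by
      have := Nat.one_lt_two_pow hd
      omega
    exact_mod_cast this
  have h4 : c = 0 := by
    rw [← h1] at h2
    refine (mul_eq_zero.1 (?_ : (2 ^ d - 1 : K) * c = 0)).resolve_left h3
    linear_combination -h2
  exact hcon ![1, 0, 0] (fun h0 => by simpa using congrFun h0 0) (by rw [hc1 0, h4])

/-- A form of degree at least two with vanishing Hessian determinant has linearly dependent partial
derivatives (in three variables). -/
lemma exists_dirD_eq_zero_of_det_hessian [CharZero K] {d : ℕ} (hd : 2 ≤ d)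
    {h : MvPolynomial (Fin 3) K} (hh : WtEq (fun _ => 1) d h) (hdet : (hessian h).det = 0) :
    ∃ e : Fin 3 → K, e ≠ 0 ∧ dirD e h = 0 := by
  by_cases h0 : h = 0
  · exact ⟨Pi.single 0 1, by simp, by rw [h0, map_zero]⟩
  let φ := algebraMap K (AlgebraicClosure K)
  have : CharZero (AlgebraicClosure K) := charZero_of_injective_algebraMap φ.injective
  set p := map φ h with hp
  have hpc : ∀ α, coeff α p = φ (coeff α h) := fun α => coeff_map φ h α
  have hph : WtEq (fun _ => 1) (d : ℚ) p := fun α hα => hh α fun h1 => hα (by rw [hpc, h1, map_zero])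
  have hpdet : (hessian p).det = 0 := by rw [hp, hessian_det_map, hdet, map_zero]
  obtain ⟨α, hα⟩ := ne_zero_iff.1 h0
  have hpα : coeff α p ≠ 0 := by rw [hpc]; exact (map_ne_zero φ).2 hα
  obtain ⟨v, hv, hvp⟩ := exists_eval_eq_zero (by omega) hph
  obtain ⟨e, he, heD⟩ := exists_dirD_dirD_eq_zero (f := p) (m := d) ⟨0, by simpa using hpdet⟩ hd
    (fun k hk h1 => by
      have h2 := h1 α hpα
      rw [hph α hpα] at h2
      have h3 : d ≤ k := by exact_mod_cast h2
      omega)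
    ⟨v, hv, by rw [dirD_iterate_eq_of_lead hph.lead, hvp, mul_zero, map_zero]⟩
  obtain ⟨e', he', he'D⟩ := exists_dirD_eq_zero_of_homogeneous hd hph hpdet he heD
  -- A linear functional that does not vanish at a coordinate of `e'` brings the relation down.
  obtain ⟨i, hi⟩ := Function.ne_iff.1 he'
  obtain ⟨ψ, hψ⟩ : ∃ ψ : Module.Dual K (AlgebraicClosure K), ψ (e' i) ≠ 0 := by
    by_contra! h1
    exact hi ((Module.forall_dual_apply_eq_zero_iff K (e' i)).1 h1)
  refine ⟨fun k => ψ (e' k), fun h1 => hψ (congrFun h1 i), ?_⟩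
  ext β
  have h1 := congrArg (fun q => ψ (coeff β q)) he'D
  simp only [dirD_fin_three, coeff_add, coeff_C_mul, hp, pderiv_map, coeff_map, map_add,
    coeff_zero, map_zero] at h1 ⊢
  have h2 : ∀ (x : AlgebraicClosure K) (y : K), ψ (x * φ y) = ψ x * y := fun x y => by
    rw [mul_comm, ← Algebra.smul_def, map_smul, smul_eq_mul, mul_comm]
  rw [h2, h2, h2] at h1
  exact h1

/-- A polynomial of degree at least three in three variables with constant Hessian determinant is
affine along some direction. -/
lemma exists_dirD_dirD_eq_zero_of_det [CharZero K] {f : MvPolynomial (Fin 3) K}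
    (hdet : ∃ c, (hessian f).det = C c) (hd : 3 ≤ f.totalDegree) :
    ∃ e : Fin 3 → K, e ≠ 0 ∧ dirD e (dirD e f) = 0 := by
  set d := f.totalDegree with hdd
  have hdQ : (3 : ℚ) ≤ d := by exact_mod_cast hd
  have hwt : ∀ α : Fin 3 →₀ ℕ, wt (fun _ => 1) α = ((α.sum fun _ e => e : ℕ) : ℚ) := fun α => by
    rw [Finsupp.sum_fintype _ _ (fun _ => rfl), wt]
    push_cast
    simp
  have hLE : WtLE (fun _ => 1) d f := fun α hα => by
    rw [hwt]
    exact_mod_cast le_totalDegree (mem_support_iff.2 hα)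
  have hL := hLE.lead
  set h := part (fun α => wt (fun _ => 1) α = (d : ℚ)) f with hh
  obtain ⟨c, hc⟩ := hdet
  obtain ⟨e, he, heD⟩ := exists_dirD_eq_zero_of_det_hessian (by omega : 2 ≤ d) hL.1
    (det_hessian_lead_eq_zero hc hL (by linarith))
  have h1 : eval e h = 0 := by
    have h2 := dirD_iterate_eq_of_lead hL.1.lead e
    rw [show d = (d - 1) + 1 by omega, Function.iterate_succ_apply, heD, iterate_map_zero] at h2
    have h3 := C_eq_zero.1 h2.symm
    exact (mul_eq_zero.1 h3).resolve_left (Nat.cast_ne_zero.2 (Nat.factorial_ne_zero _))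
  refine exists_dirD_dirD_eq_zero ⟨c, hc⟩ (by omega : 2 ≤ d) (fun k hk h2 => ?_)
    ⟨e, he, by rw [dirD_iterate_eq_of_lead hL, h1, mul_zero, map_zero]⟩
  have h3 : f.totalDegree ≤ k := by
    rw [totalDegree]
    refine Finset.sup_le fun α hα => ?_
    have := h2 α (mem_support_iff.1 hα)
    rw [hwt] at this
    exact_mod_cast this
  omega

end TopForm

/-! ### Invertibility of gradient maps -/

section Inverse

/-- A surjective endomorphism of a Noetherian ring is injective: the kernels of its iterates form an
ascending chain of ideals. -/
lemma injective_of_surjective_of_noetherian {R : Type*} [CommRing R] [IsNoetherianRing R]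
    (φ : R →+* R) (h : Function.Surjective φ) : Function.Injective φ := by
  let c : ℕ →o Ideal R := ⟨fun k => RingHom.ker (φ ^ k), monotone_nat_of_le_succ fun k x hx => by
    rw [RingHom.mem_ker] at hx ⊢
    rw [pow_succ', RingHom.mul_def, RingHom.comp_apply, hx, map_zero]⟩
  obtain ⟨k, hk⟩ := monotone_stabilizes_iff_noetherian.2 (inferInstanceAs (IsNoetherian R R)) c
  rw [injective_iff_map_eq_zero]
  intro x hx
  obtain ⟨y, rfl⟩ : ∃ y, (φ ^ k) y = x := by
    rw [RingHom.coe_pow]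
    exact h.iterate k x
  have h1 : y ∈ c (k + 1) := by
    change y ∈ RingHom.ker (φ ^ (k + 1))
    rw [RingHom.mem_ker, pow_succ', RingHom.mul_def, RingHom.comp_apply, hx]
  rw [← hk (k + 1) (by omega)] at h1
  exact h1

variable {K : Type*} [Field K] {n : ℕ}

/-- A polynomial map is invertible as soon as the coordinates are polynomials in its components. -/
lemma isInvertible_of_surjective {F : Fin n → MvPolynomial (Fin n) K}
    (h : Function.Surjective (bind₁ F)) : IsInvertible F := by
  have hinj := injective_of_surjective_of_noetherian (bind₁ F).toRingHom h
  let e := AlgEquiv.ofBijective (bind₁ F) ⟨hinj, h⟩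
  refine ⟨fun i => e.symm (X i), fun i => e.apply_symm_apply (X i), fun i => ?_⟩
  have h1 : bind₁ (fun i => e.symm (X i)) = (e.symm : MvPolynomial (Fin n) K →ₐ[K] _) := by
    ext1 i
    simp
  have h2 : F i = e (X i) := (bind₁_X_right F i).symm
  rw [h1, h2]
  exact e.symm_apply_apply (X i)

lemma surjective_of_X_mem_range {F : Fin n → MvPolynomial (Fin n) K}
    (h : ∀ i, X i ∈ (bind₁ F).range) : Function.Surjective (bind₁ F) := by
  rw [← AlgHom.range_eq_top, eq_top_iff, ← adjoin_range_X, Algebra.adjoin_le_iff]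
  rintro _ ⟨i, rfl⟩
  exact h i

lemma mem_supported_of_pderiv [CharZero K] {p : MvPolynomial (Fin n) K} {s : Set (Fin n)}
    (h : ∀ i, i ∉ s → pderiv i p = 0) : p ∈ supported K s := by
  rw [mem_supported]
  intro i hi
  by_contra his
  obtain ⟨α, hα, hi'⟩ := mem_vars_iff_mem_support i |>.1 (Finset.mem_coe.1 hi)
  exact Finsupp.mem_support_iff.1 hi' (pderiv_eq_zero_iff.1 (h i his) α (mem_support_iff.1 hα))

lemma det_of_zeroBelowAntidiagonal {R : Type*} [CommRing R] {M : Matrix (Fin n) (Fin n) R}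
    (hM : ZeroBelowAntidiagonal M) :
    M.det = Equiv.Perm.sign (Fin.revPerm : Equiv.Perm (Fin n)) * ∏ i, M i i.rev := by
  have h1 : (M.submatrix id Fin.revPerm).det = ∏ i, M i i.rev := by
    rw [Matrix.det_of_isUpperTriangular]
    · rfl
    · intro i j hij
      have hij' : (j : ℕ) < i := hij
      refine hM i _ ?_
      rw [Fin.revPerm_apply, Fin.val_rev]
      omega
  rw [← h1, Matrix.det_permute', ← mul_assoc]
  rcases Int.units_eq_one_or (Equiv.Perm.sign (Fin.revPerm : Equiv.Perm (Fin n))) with h | h <;>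
    rw [h] <;> simp

/-- If the Jacobian matrix of `F` has zeros below the anti-diagonal and constant nonzero
determinant, then the components of `F` generate the polynomial ring: each `F i` is, up to a nonzero
factor, a variable plus a polynomial in the preceding variables. -/
lemma surjective_of_zeroBelowAntidiagonal [CharZero K] {F : Fin n → MvPolynomial (Fin n) K}
    (hF : ZeroBelowAntidiagonal (jacobian F)) {c : K} (hc : c ≠ 0)
    (hdet : (jacobian F).det = C c) : Function.Surjective (bind₁ F) := by
  have hunit : ∀ i, ∃ a : K, a ≠ 0 ∧ pderiv (Fin.rev i) (F i) = C a := by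
    intro i
    have h1 : IsUnit (∏ i, jacobian F i i.rev) := by
      have h2 : IsUnit (jacobian F).det := by
        rw [hdet]
        exact (isUnit_iff_ne_zero.2 hc).map C
      rw [det_of_zeroBelowAntidiagonal hF] at h2
      exact isUnit_of_mul_isUnit_right h2
    have h3 := isUnit_of_dvd_unit
      (Finset.dvd_prod_of_mem (fun i => jacobian F i i.rev) (Finset.mem_univ i)) h1
    obtain ⟨a, ha, h4⟩ := isUnit_iff_eq_C_of_isReduced.1 h3
    exact ⟨a, ha.ne_zero, h4⟩
  refine surjective_of_X_mem_range fun i => ?_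
  induction hk : (i : ℕ) using Nat.strong_induction_on generalizing i with
  | _ k ih =>
    subst hk
    obtain ⟨a, ha, haF⟩ := hunit i.rev
    rw [Fin.rev_rev] at haF
    have hsup : F i.rev - C a * X i ∈ supported K {j : Fin n | (j : ℕ) < i} := by
      refine mem_supported_of_pderiv fun j hj => ?_
      rw [Set.mem_ofPred_eq, not_lt] at hj
      rcases eq_or_ne j i with rfl | hji
      · rw [map_sub, haF, pderiv_C_mul, pderiv_X_self, mul_one, sub_self]
      · have h1 : pderiv j (F i.rev) = 0 := hF i.rev j (by
          rw [Fin.val_rev]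
          have := Fin.val_ne_of_ne hji
          omega)
        rw [map_sub, h1, pderiv_C_mul, pderiv_X_of_ne hji.symm, mul_zero, sub_zero]
    have hle : supported K {j : Fin n | (j : ℕ) < i} ≤ (bind₁ F).range := by
      rw [supported_eq_adjoin_X, Algebra.adjoin_le_iff]
      rintro _ ⟨j, hj, rfl⟩
      exact ih j hj j rfl
    have h1 : F i.rev ∈ (bind₁ F).range := ⟨X i.rev, bind₁_X_right F _⟩
    have h2 : C a * X i ∈ (bind₁ F).range := by
      have := sub_mem h1 (hle hsup)
      rwa [sub_sub_cancel] at this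
    have h3 : X i = a⁻¹ • (C a * X i : MvPolynomial (Fin n) K) := by
      rw [smul_eq_C_mul, ← mul_assoc, ← map_mul, inv_mul_cancel₀ ha, map_one, one_mul]
    rw [h3]
    exact Subalgebra.smul_mem _ h2 _

/-- The gradient map of `f` satisfies the Jacobian conjecture if the Hessian matrix of `f` has zeros
below the anti-diagonal in suitable coordinates. -/
lemma satisfiesJacobianConjecture_grad [CharZero K] {f : MvPolynomial (Fin n) K}
    {T S : Matrix (Fin n) (Fin n) K} (hTS : T * S = 1)
    (h : ZeroBelowAntidiagonal (hessian (linSubst f T))) :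
    SatisfiesJacobianConjecture (grad f) := by
  rintro ⟨c, hc, hdet⟩
  have hT : T.det ≠ 0 := by
    intro h0
    have := congrArg Matrix.det hTS
    rw [Matrix.det_mul, h0, zero_mul, Matrix.det_one] at this
    exact zero_ne_one this
  have h1 : (jacobian (grad (linSubst f T))).det = C (T.det ^ 2 * c) := by
    have h2 := det_hessian_linSubst f T
    rw [show (hessian f).det = C c from hdet, linSubst_C, ← map_mul] at h2
    exact h2
  have hsurj := surjective_of_zeroBelowAntidiagonal (F := grad (linSubst f T)) h
    (mul_ne_zero (pow_ne_zero 2 hT) hc) h1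
  -- The gradient maps of `f` and of `f(Tx)` differ by linear automorphisms.
  have hcomp : ∀ p, bind₁ (grad (linSubst f T)) p =
      linSubst (bind₁ (grad f) (linSubst p T.transpose)) T := by
    intro p
    induction p using MvPolynomial.induction_on with
    | C a => simp
    | add p q hp hq => simp [hp, hq]
    | mul_X p i hp =>
      rw [map_mul, linSubst_mul, map_mul, linSubst_mul, hp, bind₁_X_right, grad, pderiv_linSubst,
        linSubst_X, map_sum, linSubst_sum]
      congr 1
      refine Finset.sum_congr rfl fun k _ => ?_
      rw [map_mul, bind₁_C_right, bind₁_X_right, linSubst_mul, linSubst_C, Matrix.transpose_apply,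
        grad]
  refine isInvertible_of_surjective fun p => ?_
  obtain ⟨q, hq⟩ := hsurj (linSubst p T)
  rw [hcomp] at hq
  exact ⟨_, linSubst_injective hTS hq⟩

end Inverse

/-! ### The quadratic part, and existence of antitriangular coordinates -/

section QuadraticPart

variable {K : Type*} [Field K] {n : ℕ}

lemma exists_of_coeff_dirD_ne {e : Fin n → K} {p : MvPolynomial (Fin n) K} {α : Fin n →₀ ℕ}
    (h : coeff α (dirD e p) ≠ 0) : ∃ i, coeff (α + Finsupp.single i 1) p ≠ 0 := by
  rw [dirD_apply, coeff_sum] at h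
  obtain ⟨i, _, hi⟩ := Finset.exists_ne_zero_of_sum_ne_zero h
  rw [coeff_C_mul] at hi
  exact ⟨i, (wt_sub_of_coeff_pderiv (w := 0) (right_ne_zero_of_mul hi)).1⟩

/-- The constant term of the second derivative in the direction `v` is twice the value of the
quadratic part at `v`. -/
lemma coeff_zero_dirD_dirD (v : Fin n → K) (f : MvPolynomial (Fin n) K) :
    coeff 0 (dirD v (dirD v f)) = 2 * eval v (quadraticPart f) := by
  have hq : WtEq (fun _ => 1) ((2 : ℕ) : ℚ) (quadraticPart f) := by
    intro α hα
    rw [quadraticPart, coeff_homogeneousComponent] at hα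
    split_ifs at hα with h
    · rw [wt, ← h, Finsupp.degree_eq_sum]
      simp
    · exact absurd rfl hα
  have h1 : (dirD v)^[2] (quadraticPart f) = _ := dirD_iterate_eq_of_lead hq.lead v
  have h2 : coeff 0 (dirD v (dirD v (f - quadraticPart f))) = 0 := by
    by_contra h3
    obtain ⟨i, hi⟩ := exists_of_coeff_dirD_ne h3
    obtain ⟨j, hj⟩ := exists_of_coeff_dirD_ne hi
    apply hj
    rw [coeff_sub, quadraticPart, coeff_homogeneousComponent, if_pos, sub_self]
    rw [map_add, map_add]
    simp
  have h4 : dirD v (dirD v (quadraticPart f)) = C (2 * eval v (quadraticPart f)) := by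
    simpa using h1
  rw [map_sub, map_sub, coeff_sub, h4, coeff_C, if_pos rfl] at h2
  exact sub_eq_zero.1 h2

lemma pderiv_pderiv_linSubst_self (f : MvPolynomial (Fin n) K) (T : Matrix (Fin n) (Fin n) K)
    (l : Fin n) : pderiv l (pderiv l (linSubst f T)) =
      linSubst (dirD (fun i => T i l) (dirD (fun i => T i l) f)) T := by
  have h : T.mulVec (Pi.single l 1) = fun i => T i l := by
    rw [Matrix.mulVec_single_one]
    rfl
  rw [pderiv_linSubst_single h, pderiv_linSubst_single h]

/-- The last column of a matrix that makes the Hessian matrix antitriangular is a zero of the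
quadratic part, as is every column with an index `l` for which `(l, l)` is below the
anti-diagonal. -/
lemma eval_quadraticPart_eq_zero [CharZero K] {f : MvPolynomial (Fin n) K}
    {T S : Matrix (Fin n) (Fin n) K} (hTS : T * S = 1)
    (h : ZeroBelowAntidiagonal (hessian (linSubst f T))) {l : Fin n} (hl : n ≤ (l : ℕ) + l) :
    eval (fun i => T i l) (quadraticPart f) = 0 := by
  have h1 := h l l hl
  rw [hessian_apply, pderiv_pderiv_linSubst_self, linSubst_eq_zero_iff hTS] at h1
  have h2 := coeff_zero_dirD_dirD (fun i => T i l) f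
  rw [h1, coeff_zero] at h2
  exact (mul_eq_zero.1 h2.symm).resolve_left two_ne_zero

/-- In two or three variables, a polynomial with constant Hessian determinant that is affine along
some direction has an antitriangular Hessian matrix in suitable coordinates. -/
lemma exists_zeroBelowAntidiagonal [CharZero K] (hn : 2 ≤ n) (hn3 : n ≤ 3)
    {f : MvPolynomial (Fin n) K} (hdet : ∃ c, (hessian f).det = C c) {e : Fin n → K} (he : e ≠ 0)
    (hD : dirD e (dirD e f) = 0) : ∃ T : Matrix.GeneralLinearGroup (Fin n) K,
      ZeroBelowAntidiagonal (hessian (linSubst f T.val)) := by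
  obtain rfl | rfl : n = 2 ∨ n = 3 := by omega
  · obtain ⟨T, S, hTS, hT1, -, -⟩ := exists_matrix_mulVec_single he (s := Set.univ) (j := 1)
      (by simp) (by simp)
    refine ⟨⟨T, S, hTS, mul_eq_one_comm.1 hTS⟩, fun i j hij => ?_⟩
    obtain ⟨rfl, rfl⟩ : i = 1 ∧ j = 1 := by omega
    rw [hessian_apply, pderiv_linSubst_single hT1, pderiv_linSubst_single hT1, hD, linSubst_zero]
  · obtain ⟨T, S, hTS, h22, h12⟩ := exists_antitriangular_of_dirD_dirD hdet he hD
    refine ⟨⟨T, S, hTS, mul_eq_one_comm.1 hTS⟩, fun i j hij => ?_⟩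
    have h3 : (i = 2 ∧ j = 2) ∨ (i = 1 ∧ j = 2) ∨ (i = 2 ∧ j = 1) := by omega
    rw [hessian_apply]
    rcases h3 with ⟨rfl, rfl⟩ | ⟨rfl, rfl⟩ | ⟨rfl, rfl⟩
    · exact h22
    · rw [pderiv_comm']
      exact h12
    · exact h12

/-- A polynomial of degree at least three in two or three variables with constant Hessian determinant
is affine along some direction. -/
lemma exists_dirD_dirD_eq_zero_of_totalDegree [CharZero K] (hn : 2 ≤ n) (hn3 : n ≤ 3)
    {f : MvPolynomial (Fin n) K} (hdet : ∃ c, (hessian f).det = C c) (hd : 3 ≤ f.totalDegree) :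
    ∃ e : Fin n → K, e ≠ 0 ∧ dirD e (dirD e f) = 0 := by
  obtain rfl | rfl : n = 2 ∨ n = 3 := by omega
  · obtain ⟨c, hc⟩ := hdet
    have h1 : hess2 0 1 f = C c := by
      rw [← hc, Matrix.det_fin_two]
      simp only [hessian_apply, hess2]
      rw [pderiv_comm' 1 0 f]
      ring
    obtain ⟨α, hα, h2⟩ : ∃ α, coeff α f ≠ 0 ∧ 3 ≤ α 0 + α 1 := by
      by_contra! h3
      have : f.totalDegree ≤ 2 := by
        rw [totalDegree]
        refine Finset.sup_le fun α hα => ?_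
        rw [Finsupp.sum_fintype _ _ (fun _ => rfl), Fin.sum_univ_two]
        have := h3 α (mem_support_iff.1 hα)
        omega
      omega
    obtain ⟨u, hu0, -, hD⟩ := exists_dirD_iterate_eq_zero (a := f) (c := c) (J₀ := 2)
      (i := (0 : Fin 2)) (j := 1) (μ := 1) (ν := 0) (by decide) (fun l h0 h1 => by omega)
      (by simp [Phi, h1, mul_comm]) (by norm_num) le_rfl (Or.inr ⟨le_rfl, α, hα, h2⟩)
      (fun I J hI hJ => by push_cast; omega) (fun J hJ => by push_cast; omega)
    exact ⟨u, hu0, hD⟩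
  · exact exists_dirD_dirD_eq_zero_of_det hdet hd

lemma wtLE_of_totalDegree_le {f : MvPolynomial (Fin n) K} {d : ℕ} (h : f.totalDegree ≤ d) :
    WtLE (fun _ => 1) d f := fun α hα => by
  have h1 := (le_totalDegree (mem_support_iff.2 hα)).trans h
  rw [Finsupp.sum_fintype _ _ (fun _ => rfl)] at h1
  simp only [wt, mul_one]
  exact_mod_cast h1

/-- A polynomial of degree at most two is affine along the zeros of its quadratic part. -/
lemma dirD_dirD_eq_zero_of_eval {f : MvPolynomial (Fin n) K} (hd : f.totalDegree ≤ 2)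
    {v : Fin n → K} (hv : eval v (quadraticPart f) = 0) : dirD v (dirD v f) = 0 := by
  have h1 := wtLE_of_totalDegree_le hd
  have h2 := coeff_zero_dirD_dirD v f
  rw [hv, mul_zero] at h2
  ext α
  rw [coeff_zero]
  by_contra hα
  obtain ⟨i, hi⟩ := exists_of_coeff_dirD_ne hα
  obtain ⟨j, hj⟩ := exists_of_coeff_dirD_ne hi
  have h3 := h1 _ hj
  rw [wt_add, wt_add, wt_single, wt_single] at h3
  simp only [Nat.cast_one, mul_one, Nat.cast_ofNat] at h3
  have h4 : ∑ k, (α k : ℚ) ≤ 0 := by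
    have : wt (fun _ => 1) α = ∑ k, (α k : ℚ) := by simp [wt]
    rw [this] at h3
    linarith
  have h5 : α = 0 := by
    ext k
    have h6 := (Finset.sum_eq_zero_iff_of_nonneg (fun k _ => Nat.cast_nonneg (α k))).1
      (le_antisymm h4 (Finset.sum_nonneg fun k _ => Nat.cast_nonneg (α k))) k (Finset.mem_univ k)
    exact_mod_cast h6
  exact hα (h5 ▸ h2)

/-- The gradient map of a polynomial of degree at most two is affine. -/
lemma satisfiesJacobianConjecture_of_totalDegree_le [CharZero K] {f : MvPolynomial (Fin n) K}
    (hd : f.totalDegree ≤ 2) : SatisfiesJacobianConjecture (grad f) := by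
  rintro ⟨c, hc, hdet⟩
  have hF : ∀ i, ∃ b, grad f i = C b + ∑ j, hessian f i j * X j := by
    intro i
    have h1 : ∀ k j, pderiv k (hessian f i j) = 0 := by
      intro k j
      rw [hessian_apply]
      have h2 := ((((wtLE_of_totalDegree_le hd).pderiv i).pderiv j).pderiv k).lt (E := 0)
        (by norm_num)
      exact h2.eq_zero_of_forall fun α => by
        simp only [wt, mul_one]
        positivity
    have h3 : ∀ k, pderiv k (grad f i - ∑ j, hessian f i j * X j) = 0 := by
      intro k
      rw [map_sub, map_sum, Finset.sum_eq_single k]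
      · rw [Derivation.leibniz, h1, pderiv_X_self]
        simp [hessian_apply, grad]
      · intro j _ hjk
        rw [Derivation.leibniz, h1, pderiv_X_of_ne hjk]
        simp
      · simp
    have h4 : grad f i - ∑ j, hessian f i j * X j ∈ supported K (∅ : Set (Fin n)) :=
      mem_supported_of_pderiv fun k _ => h3 k
    rw [supported_empty, Algebra.mem_bot] at h4
    obtain ⟨b, hb⟩ := h4
    exact ⟨b, by rw [← algebraMap_eq, hb]; ring⟩
  choose b hb using hF
  have hconst : ∀ i j, ∃ a : K, hessian f i j = C a := by
    intro i j
    have h4 : hessian f i j ∈ supported K (∅ : Set (Fin n)) :=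
      mem_supported_of_pderiv fun k _ => by
        rw [hessian_apply]
        have h2 := ((((wtLE_of_totalDegree_le hd).pderiv i).pderiv j).pderiv k).lt (E := 0)
          (by norm_num)
        exact h2.eq_zero_of_forall fun α => by
          simp only [wt, mul_one]
          positivity
    rw [supported_empty, Algebra.mem_bot] at h4
    obtain ⟨a, ha⟩ := h4
    exact ⟨a, ha.symm⟩
  choose a ha using hconst
  set M : Matrix (Fin n) (Fin n) K := Matrix.of a with hM
  have hMdet : M.det ≠ 0 := by
    have h1 : hessian f = M.map C := by
      ext1 i j
      rw [ha]
      rfl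
    have h2 : (hessian f).det = C c := hdet
    rw [h1, ← RingHom.mapMatrix_apply, ← RingHom.map_det] at h2
    rw [C_injective _ _ h2]
    exact hc
  have hinv : M⁻¹ * M = 1 := Matrix.nonsing_inv_mul _ (isUnit_iff_ne_zero.2 hMdet)
  refine isInvertible_of_surjective (surjective_of_X_mem_range fun i => ?_)
  have h1 : X i = ∑ j, C (M⁻¹ i j) * (grad f j - C (b j)) := by
    have h2 : ∀ j, grad f j - C (b j) = ∑ k, C (M j k) * X k := by
      intro j
      rw [hb, add_sub_cancel_left]
      exact Finset.sum_congr rfl fun k _ => by rw [ha]; rfl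
    simp only [h2, Finset.mul_sum, ← mul_assoc, ← map_mul]
    rw [Finset.sum_comm]
    simp only [← Finset.sum_mul, ← map_sum, ← Matrix.mul_apply, hinv, Matrix.one_apply]
    simp
  rw [h1]
  have hC : ∀ x : K, C x ∈ (bind₁ (grad f)).range := fun x => ⟨C x, bind₁_C_right _ _⟩
  exact sum_mem fun j _ => mul_mem (hC _) (sub_mem ⟨X j, bind₁_X_right _ _⟩ (hC _))

end QuadraticPart

end PolyMap

end

theorem mainTheorem1 {K : Type*} [Field K] [CharZero K] (n : ℕ)
    (f : MvPolynomial (Fin n) K)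
    (hf : ∃ c : K, (PolyMap.hessian f).det = MvPolynomial.C c) :
    -- (i)
    (∀ T : Matrix.GeneralLinearGroup (Fin n) K,
      PolyMap.ZeroBelowAntidiagonal (PolyMap.hessian (PolyMap.linSubst f T.val)) →
        PolyMap.SatisfiesJacobianConjecture (PolyMap.grad f) ∧
        ∀ hn : 2 ≤ n,
          MvPolynomial.eval (fun i => T.val i ⟨n - 1, by omega⟩) (PolyMap.quadraticPart f) = 0) ∧
    -- (ii)
    (2 ≤ n → n ≤ 3 → 3 ≤ f.totalDegree →
      (∃ T : Matrix.GeneralLinearGroup (Fin n) K,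
        PolyMap.ZeroBelowAntidiagonal (PolyMap.hessian (PolyMap.linSubst f T.val))) ∧
      PolyMap.VanishesAtNonzero (PolyMap.quadraticPart f)) ∧
    -- (iii)
    (f.totalDegree ≤ 2 → 2 ≤ n → n ≤ 3 →
      ((∃ T : Matrix.GeneralLinearGroup (Fin n) K,
        PolyMap.ZeroBelowAntidiagonal (PolyMap.hessian (PolyMap.linSubst f T.val))) ↔
      PolyMap.VanishesAtNonzero (PolyMap.quadraticPart f))) ∧
    -- (iv)
    (n ≤ 3 →
      PolyMap.SatisfiesJacobianConjecture (PolyMap.grad f) ∧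
      (3 ≤ f.totalDegree →
        ∃ T : Matrix.GeneralLinearGroup (Fin n) K,
          PolyMap.ZeroBelowAntidiagonal (PolyMap.hessian (PolyMap.linSubst f T.val)))) := by
  have hi : ∀ T : Matrix.GeneralLinearGroup (Fin n) K,
      PolyMap.ZeroBelowAntidiagonal (PolyMap.hessian (PolyMap.linSubst f T.val)) →
        PolyMap.SatisfiesJacobianConjecture (PolyMap.grad f) ∧
        ∀ hn : 2 ≤ n,
          MvPolynomial.eval (fun i => T.val i ⟨n - 1, by omega⟩) (PolyMap.quadraticPart f) = 0 :=
    fun T hT => ⟨PolyMap.satisfiesJacobianConjecture_grad T.val_inv hT,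
      fun hn =>
      PolyMap.eval_quadraticPart_eq_zero T.val_inv hT
        (show n ≤ (n - 1) + (n - 1) by omega)⟩
  -- The last column of an invertible matrix is a nonzero vector.
  have hvan : 2 ≤ n → (∃ T : Matrix.GeneralLinearGroup (Fin n) K,
      PolyMap.ZeroBelowAntidiagonal (PolyMap.hessian (PolyMap.linSubst f T.val))) →
      PolyMap.VanishesAtNonzero (PolyMap.quadraticPart f) := by
    rintro hn ⟨T, hT⟩
    refine ⟨_, fun h0 => ?_, (hi T hT).2 hn⟩
    have h1 := PolyMap.mulVec_ne_zero T.val_inv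
      (v := Pi.single (⟨n - 1, by omega⟩ : Fin n) 1) (by simp)
    rw [Matrix.mulVec_single_one] at h1
    exact h1 h0
  have hii : 2 ≤ n → n ≤ 3 → 3 ≤ f.totalDegree → ∃ T : Matrix.GeneralLinearGroup (Fin n) K,
      PolyMap.ZeroBelowAntidiagonal (PolyMap.hessian (PolyMap.linSubst f T.val)) := by
    intro hn hn3 hd
    obtain ⟨e, he, hD⟩ := PolyMap.exists_dirD_dirD_eq_zero_of_totalDegree hn hn3 hf hd
    exact PolyMap.exists_zeroBelowAntidiagonal hn hn3 hf he hD
  -- In at most one variable there are no positions below the anti-diagonal.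
  have hsmall : n ≤ 1 → ∃ T : Matrix.GeneralLinearGroup (Fin n) K,
      PolyMap.ZeroBelowAntidiagonal (PolyMap.hessian (PolyMap.linSubst f T.val)) :=
    fun hn => ⟨1, fun i j hij => by omega⟩
  have hT : n ≤ 3 → 3 ≤ f.totalDegree → ∃ T : Matrix.GeneralLinearGroup (Fin n) K,
      PolyMap.ZeroBelowAntidiagonal (PolyMap.hessian (PolyMap.linSubst f T.val)) := by
    intro hn3 hd
    rcases Nat.lt_or_ge n 2 with hn | hn
    · exact hsmall (by omega)
    · exact hii hn hn3 hd
  refine ⟨hi, fun hn hn3 hd => ⟨hii hn hn3 hd, hvan hn (hii hn hn3 hd)⟩,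
    fun hd hn hn3 => ⟨hvan hn, ?_⟩, fun hn3 => ⟨?_, hT hn3⟩⟩
  · rintro ⟨v, hv, hv0⟩
    exact PolyMap.exists_zeroBelowAntidiagonal hn hn3 hf hv
      (PolyMap.dirD_dirD_eq_zero_of_eval hd hv0)
  · rcases Nat.lt_or_ge f.totalDegree 3 with hd | hd
    · exact PolyMap.satisfiesJacobianConjecture_of_totalDegree_le (by omega)
    · obtain ⟨T, hT'⟩ := hT hn3 hd
      exact (hi T hT').1
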